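/- **Setting.** Let $d\ge 1$ and let $S=(S(n))_{n\ge 0}$ be the symmetric nearest-neighbor random walk on $\mathbb Z^d$ started at $0$ (independent steps, uniform on the $2d$ unit vectors $\pm e_i$), with expectation $E$. For $x\in\mathbb Z^d$ let $H(x)=\inf\{n\ge 0: S(n)=x\}$, and for $\ell\in\mathbb R^d\setminus\{0\}$, $u\in\mathbb R$, let $H_\ell(u)=\inf\{n\ge 0:\ \ell\cdot S(n)\ge u\}$ be the entrance time into the half-space $\{x:\ell\cdot x\ge u\}$ (it is almost surely finite). *Quenched.* Let $V=(V_x)_{x\in\mathbb Z^d}$ be independent, identically and not trivially distributed (that is, not almost surely constant) real random variables in $L^d(\Omega,\mathcal F,\mathbb P)$ with $\operatorname{ess\,inf}V_x=0$, independent of the walk. Put $\Psi(n,\omega)=\sum_{1\le m\le n}V_{S(m)}(\omega)$ and, for $\lambda\ge 0$, $$a_\lambda(x,\omega)=-\log E\big[e^{-\lambda H(x)-\Psi(H(x),\omega)};\,H(x)<\infty\big],\quad x\in\mathbb Z^d .$$ Let $\alpha_\lambda$ be the quenched Lyapunov norm on $\mathbb R^d$, $$\alpha_\lambda(x)=\lim_{n\to\infty}\tfrac1n\,\mathbb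 E\big[a_\lambda(\lfloor nx\rfloor,\cdot)\big],$$ where $\lfloor\cdot\rfloor$ is taken coordinatewise. *Annealed.* Let $\varphi:[0,\infty)\to[0,\infty)$ be non-constant, non-decreasing and concave with $\varphi(0)=0$ and $\lim_{t\to\infty}\varphi(t)/t=0$. Put $l_x(n)=\#\{1\le m\le n:S(m)=x\}$, $\Phi(n)=\sum_{x\in\mathbb Z^d}\varphi(l_x(n))$ and, for $\lambda\ge 0$, $$b_\lambda(x)=-\log E\big[e^{-\lambda H(x)-\Phi(H(x))};\,H(x)<\infty\big],\qquad \beta_\lambda(x)=\lim_{n\to\infty}\tfrac1n\, b_\lambda(\lfloor nx\rfloor)\quad(x\in\mathbb R^d).$$ For $\ell\in\mathbb R^d$ the dual norms are $\alpha^*_\lambda(\ell)=\sup_{x\ne 0}\frac{\ell\cdot x}{\alpha_\lambda(x)}$ and $\beta^*_\lambda(\ell)=\sup_{x\ne 0}\frac{\ell\cdot x}{\beta_\lambda(x)}$. **Corollary 1 (Point to hyperplane characterization of dual norms).** a) There is a set of full $\mathbb P$-measure on which, for all $\lambda\in[0,\infty)$ and all $\ell\in\mathbb R^d\setminus\{0\}$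 simultaneously, $$\lim_{u\to\infty}\frac1u\log E\Big[\exp\big(-\lambda H_\ell(u)-\Psi(H_\ell(u),\omega)\big)\Big]=-\frac1{\alpha^*_\lambda(\ell)} .$$ b) For all $\lambda\in[0,\infty)$ and all $\ell\in\mathbb R^d\setminus\{0\}$, $$\lim_{u\to\infty}\frac1u\log E\Big[\exp\big(-\lambda H_\ell(u)-\Phi(H_\ell(u))\big)\Big]=-\frac1{\beta^*_\lambda(\ell)} .$$ -/

import Mathlib

open MeasureTheory ProbabilityTheory Filter Topology
open scoped ENNReal

noncomputable section

namespace RandomPotential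

/-! ### The symmetric nearest-neighbor random walk on the lattice -/

/-- The sites of the lattice `ℤ^d`. -/
abbrev Site (d : ℕ) := Fin d → ℤ

/-- The `2d` unit steps: `(i, true)` is `e_i` and `(i, false)` is `-e_i`. -/
def unitStep {d : ℕ} (e : Fin d × Bool) : Site d :=
  Pi.single e.1 (if e.2 then 1 else -1)

/-- The sample space of the walk: sequences of steps. -/
abbrev WalkSpace (d : ℕ) := ℕ → Fin d × Bool

/-- The law `P` of the walk: the steps are independent and uniform on the `2d` unit steps. -/
def walkMeasure (d : ℕ) [NeZero d] : Measure (WalkSpace d) :=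
  Measure.infinitePi fun _ : ℕ => (PMF.uniformOfFintype (Fin d × Bool)).toMeasure

/-- The position `S(n)` of the walk; `S(0) = 0`. -/
def walk {d : ℕ} (w : WalkSpace d) (n : ℕ) : Site d :=
  ∑ k ∈ Finset.range n, unitStep (w k)

/-- The first time `inf {n ≥ 0 : S(n) ∈ A}` at which the walk is in `A` (`⊤` if it never is). -/
def hittingTime {d : ℕ} (A : Set (Site d)) (w : WalkSpace d) : ℕ∞ :=
  ⨅ n ∈ {n : ℕ | walk w n ∈ A}, (n : ℕ∞)

/-- The lattice points of the half-space `{x ∈ ℝ^d : ℓ · x ≥ u}`. -/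
def halfSpace {d : ℕ} (l : Fin d → ℝ) (u : ℝ) : Set (Site d) :=
  {x | u ≤ ∑ i, l i * (x i : ℝ)}

/-- `exp (-λ t - c(t))` for a time `t` in `{0, 1, 2, …, ∞}`, with the value `0` at `t = ∞`. -/
def discount (lam : ℝ) (c : ℕ → ℝ) (t : ℕ∞) : ℝ :=
  if t = ⊤ then 0 else Real.exp (-lam * (t.toNat : ℝ) - c t.toNat)

/-- `E[exp (-λ H - c(H)); H < ∞]`, where `H` is the hitting time of `A` and `c` is a
path potential, that is, a real number `c w n` for every path `w` and time `n`. -/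
def hittingWeight {d : ℕ} [NeZero d] (lam : ℝ) (c : WalkSpace d → ℕ → ℝ)
    (A : Set (Site d)) : ℝ :=
  ∫ w, discount lam (c w) (hittingTime A w) ∂(walkMeasure d)

/-- The lattice point next to the point `n x`: the coordinatewise integer part of `n x`
(it is `n x` itself if `x` is a lattice point). -/
def latticePoint {d : ℕ} (n : ℕ) (x : Fin d → ℝ) : Site d :=
  fun i => ⌊(n : ℝ) * x i⌋

/-- The dual norm `N*(ℓ) = sup_{x ≠ 0} (ℓ · x) / N(x)` of a norm `N` on `ℝ^d`. -/
def dualNorm {d : ℕ} (N : (Fin d → ℝ) → ℝ) (l : Fin d → ℝ) : ℝ :=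
  ⨆ x : {x : Fin d → ℝ // x ≠ 0}, (∑ i, l i * x.1 i) / N x.1

/-! ### The quenched setting -/

/-- The assumption on the random potential: independent, identically and not trivially
distributed random variables in `L^d` with essential infimum `0`. (The essential infimum is
taken in the extended reals, so this says that `V_x ≥ 0` a.s. and that `V_x < ε` with positive
probability for all `ε > 0`.) -/
structure IsQuenchedPotential {d : ℕ} {Ω : Type*} [MeasurableSpace Ω] (μ : Measure Ω)
    (V : Site d → Ω → ℝ) : Prop where
  measurable : ∀ x, Measurable (V x)
  indep : iIndepFun V μ
  identDistrib : ∀ x y, IdentDistrib (V x) (V y) μ μ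
  nontrivial : ∀ x, ∀ c : ℝ, ¬ ∀ᵐ ω ∂μ, V x ω = c
  memLp : ∀ x, MemLp (V x) (d : ℝ≥0∞) μ
  essInf_eq_zero : ∀ x, essInf (fun ω => (V x ω : EReal)) μ = 0

/-- The quenched path potential `Ψ(n, ω) = ∑_{1 ≤ m ≤ n} V_{S(m)}(ω)`; here `v` is the
realization `x ↦ V_x(ω)` of the potential. -/
def quenchedPathPotential {d : ℕ} (v : Site d → ℝ) (w : WalkSpace d) (n : ℕ) : ℝ :=
  ∑ m ∈ Finset.Icc 1 n, v (walk w m)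

/-- The two-point function `a_λ(x, ω) = -log E[exp (-λ H(x) - Ψ(H(x), ω)); H(x) < ∞]`. -/
def quenchedTwoPoint {d : ℕ} [NeZero d] (lam : ℝ) (v : Site d → ℝ) (x : Site d) : ℝ :=
  -Real.log (hittingWeight lam (quenchedPathPotential v) {x})

/-- The quenched Lyapunov function `α_λ(x)` on `ℝ^d`: the limit of `𝔼[a_λ([n x], ·)] / n`. -/
def quenchedLyapunov {d : ℕ} [NeZero d] {Ω : Type*} [MeasurableSpace Ω] (μ : Measure Ω)
    (V : Site d → Ω → ℝ) (lam : ℝ) (x : Fin d → ℝ) : ℝ :=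
  limUnder atTop fun n : ℕ =>
    (∫ ω, quenchedTwoPoint lam (fun z => V z ω) (latticePoint n x) ∂μ) / (n : ℝ)

/-! ### The annealed setting -/

/-- The assumption on `φ : [0,∞) → [0,∞)`: non constant, non decreasing, concave, `φ(0) = 0`
and `φ(t)/t → 0`. Only the restriction of `φ` to `[0,∞)` matters. -/
structure IsAnnealedPotential (φ : ℝ → ℝ) : Prop where
  nonneg : ∀ t, 0 ≤ t → 0 ≤ φ t
  nonconstant : ∃ s t : ℝ, 0 ≤ s ∧ 0 ≤ t ∧ φ s ≠ φ t
  monotone : MonotoneOn φ (Set.Ici 0)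
  concave : ConcaveOn ℝ (Set.Ici 0) φ
  map_zero : φ 0 = 0
  sublinear : Tendsto (fun t => φ t / t) atTop (𝓝 0)

/-- The number `l_x(n) = #{1 ≤ m ≤ n : S(m) = x}` of visits to `x` up to time `n`. -/
def visits {d : ℕ} (w : WalkSpace d) (x : Site d) (n : ℕ) : ℕ :=
  ((Finset.Icc 1 n).filter fun m => walk w m = x).card

/-- The annealed path potential `Φ(n) = ∑_{x ∈ ℤ^d} φ(l_x(n))` (finitely many nonzero terms). -/
def annealedPathPotential {d : ℕ} (φ : ℝ → ℝ) (w : WalkSpace d) (n : ℕ) : ℝ :=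
  ∑' x : Site d, φ (visits w x n)

/-- The two-point function `b_λ(x) = -log E[exp (-λ H(x) - Φ(H(x))); H(x) < ∞]`. -/
def annealedTwoPoint {d : ℕ} [NeZero d] (lam : ℝ) (φ : ℝ → ℝ) (x : Site d) : ℝ :=
  -Real.log (hittingWeight lam (annealedPathPotential φ) {x})

/-- The annealed Lyapunov function `β_λ(x)` on `ℝ^d`: the limit of `b_λ([n x]) / n`. -/
def annealedLyapunov {d : ℕ} [NeZero d] (φ : ℝ → ℝ) (lam : ℝ) (x : Fin d → ℝ) : ℝ :=
  limUnder atTop fun n : ℕ => annealedTwoPoint lam φ (latticePoint n x) / (n : ℝ)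

end RandomPotential

end

/-!
Both parts are instances of one deterministic statement, `RandomPotential.tendsto_log_halfSpace`.
Let `g` be a subadditive function on `ℤ^d` comparable to the norm; by Fekete's lemma the Lyapunov
function `N(x) = lim g([n x]) / n` exists, and it is subadditive, homogeneous and comparable to the
norm. Suppose that costs `A y` of hitting the sites `y` satisfy `A y ≥ (1 - ε) N(y)` for all but
finitely many `y`, and `A (q k x) ≤ q k (N(x) + ε)` along the multiples of some `k` in every lattice
direction `x`. The weight of a half-space is at least that of each of its points and at most the sum
of the weights of its points. As `y ↦ exp (-δ N(y))` is summable, the sum decays like `exp (-inf N)`, the infimum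
being over the half-space; by definition of the dual norm it is `u / N*(ℓ)`, and the lattice
directions in which `(ℓ · x) / N(x)` is close to `N*(ℓ)` give the matching lower bound.

Annealed: as `φ` is subadditive, `b_λ` itself is subadditive, and the costs are `g = b_λ`, so that
both bounds follow from Fekete's lemma (`RandomPotential.tendsto_annealed`).

Quenched: here `g = 𝔼[a_λ]` while the costs are random.

* Upper bound (`exists_eventually_envCost_le`). Requiring that a site be hit within a fixed time `T`
  makes the costs of consecutive segments of a ray finite range functions of the environment. The
  strong law of large numbers applies to them along residue classes, and `T → ∞` recovers `𝔼[a_λ]`.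
* Truncation (`exists_meanCost_le_truncLaw`). Under the path measure weighted by the truncated
  potential, the part of the potential cut off is bounded in mean by means of Jensen's inequality
  and Chebyshev's association inequality, so that truncating the potential at a high level changes
  `𝔼[a_λ]` by a factor close to `1`. Only integrability of the potential is used.
* Lower bound (`eventually_le_envCost`). For bounded potentials the mean of the lower rate of the
  costs along a ray is at least the Lyapunov norm, by the stopping argument from the proof of
  Kingman's theorem (`le_integral_of_subadditive`). As the rate is almost surely at most the
  Lyapunov norm by the upper bound, the two agree; no ergodicity is needed. Bounded potentials have
  Lipschitz costs, so that finitely many rays control all sites.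
* All `λ` at once (`ae_forall_envCost_bounds`). Costs increase in `λ` and costs divided by `λ`
  decrease in `λ`, whence the rational values of `λ` suffice; `λ = 0` is one of them.
-/

noncomputable section

namespace RandomPotential

open scoped NNReal

/-! ### Lyapunov norms of subadditive functions on the lattice -/

/-- A lattice point, viewed as a point of `ℝ^d`. -/
def toReal {d : ℕ} (x : Site d) : Fin d → ℝ := fun i => (x i : ℝ)

lemma norm_toReal {d : ℕ} (x : Site d) : ‖toReal x‖ = ‖x‖ := by
  simp only [toReal, Pi.norm_def]
  congr 2

lemma toReal_add {d : ℕ} (x y : Site d) : toReal (x + y) = toReal x + toReal y := by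
  ext i; simp [toReal]

lemma toReal_nsmul {d : ℕ} (n : ℕ) (x : Site d) : toReal (n • x) = n • toReal x := by
  ext i; simp [toReal]

lemma nsmul_apply_real {d : ℕ} (n : ℕ) (x : Fin d → ℝ) (i : Fin d) :
    (n • x) i = n * x i := by
  rw [Pi.smul_apply, nsmul_eq_mul]

lemma mem_halfSpace {d : ℕ} {l : Fin d → ℝ} {u : ℝ} {y : Site d} :
    y ∈ halfSpace l u ↔ u ≤ ∑ i, l i * toReal y i := Iff.rfl

/-- The Lyapunov function `x ↦ lim g([n x]) / n` on `ℝ^d` of a function `g` on the lattice. -/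
def lyapunov {d : ℕ} (g : Site d → ℝ) (x : Fin d → ℝ) : ℝ :=
  limUnder atTop fun n : ℕ => g (latticePoint n x) / (n : ℝ)

/-- A subadditive function on the lattice that is comparable to the norm. -/
structure IsSubadditiveCost {d : ℕ} (g : Site d → ℝ) (c C : ℝ) : Prop where
  pos : 0 < c
  add_le : ∀ x y, g (x + y) ≤ g x + g y
  le : ∀ x, c * ‖x‖ ≤ g x
  ge : ∀ x, g x ≤ C * ‖x‖

namespace IsSubadditiveCost

variable {d : ℕ} {g : Site d → ℝ} {c C : ℝ}

lemma nonneg (h : IsSubadditiveCost g c C) (x : Site d) : 0 ≤ g x :=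
  (mul_nonneg h.pos.le (norm_nonneg _)).trans (h.le x)

lemma const_nonneg [NeZero d] (h : IsSubadditiveCost g c C) : 0 ≤ C := by
  have h1 := (h.le fun _ => 1).trans (h.ge fun _ => 1)
  have h2 : ‖(fun _ => 1 : Site d)‖ = 1 := by
    rw [pi_norm_const]; simp
  rw [h2] at h1
  linarith [h.pos]

lemma le_add_of_near [NeZero d] (h : IsSubadditiveCost g c C) {x y : Site d} {r : ℝ}
    (hr : ‖x - y‖ ≤ r) : g x ≤ g y + C * r := by
  have h1 := h.add_le y (x - y)
  have h2 := h.ge (x - y)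
  have h3 := mul_le_mul_of_nonneg_left hr h.const_nonneg
  rw [add_sub_cancel] at h1
  linarith

lemma apply_nsmul_le (h : IsSubadditiveCost g c C) (n : ℕ) (x : Site d) :
    g (n • x) ≤ n * g x := by
  induction n with
  | zero => simpa using h.ge 0
  | succ k ih =>
    have := h.add_le (k • x) x
    rw [succ_nsmul]
    push_cast
    linarith

end IsSubadditiveCost

lemma norm_latticePoint_sub {d : ℕ} (n : ℕ) (x : Fin d → ℝ) :
    ‖toReal (latticePoint n x) - n • x‖ ≤ 1 := by
  rw [pi_norm_le_iff_of_nonneg zero_le_one]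
  intro i
  simp only [toReal, latticePoint, Pi.sub_apply, nsmul_apply_real, Real.norm_eq_abs]
  rw [abs_le]
  constructor <;> linarith [Int.floor_le ((n : ℝ) * x i), Int.lt_floor_add_one ((n : ℝ) * x i)]

lemma toReal_sub {d : ℕ} (x y : Site d) : toReal (x - y) = toReal x - toReal y := by
  ext i; simp [toReal]

lemma norm_sub_eq_toReal {d : ℕ} (x y : Site d) : ‖x - y‖ = ‖toReal x - toReal y‖ := by
  rw [← norm_toReal, toReal_sub]

lemma norm_latticePoint_add {d : ℕ} (n : ℕ) (x y : Fin d → ℝ) :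
    ‖latticePoint n (x + y) - (latticePoint n x + latticePoint n y)‖ ≤ 3 := by
  rw [norm_sub_eq_toReal, toReal_add]
  have h1 := norm_latticePoint_sub n (x + y)
  have h2 := norm_latticePoint_sub n x
  have h3 := norm_latticePoint_sub n y
  calc _ = ‖(toReal (latticePoint n (x + y)) - n • (x + y))
        - (toReal (latticePoint n x) - n • x) - (toReal (latticePoint n y) - n • y)‖ := by
        congr 1; rw [smul_add]; abel
    _ ≤ _ := (norm_sub_le _ _).trans (add_le_add (norm_sub_le _ _) le_rfl)
    _ ≤ 3 := by linarith

lemma norm_latticePoint_add_left {d : ℕ} (m n : ℕ) (x : Fin d → ℝ) :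
    ‖latticePoint (m + n) x - (latticePoint m x + latticePoint n x)‖ ≤ 3 := by
  rw [norm_sub_eq_toReal, toReal_add]
  have h1 := norm_latticePoint_sub (m + n) x
  have h2 := norm_latticePoint_sub m x
  have h3 := norm_latticePoint_sub n x
  calc _ = ‖(toReal (latticePoint (m + n) x) - (m + n) • x)
        - (toReal (latticePoint m x) - m • x) - (toReal (latticePoint n x) - n • x)‖ := by
        congr 1; rw [add_smul]; abel
    _ ≤ _ := (norm_sub_le _ _).trans (add_le_add (norm_sub_le _ _) le_rfl)
    _ ≤ 3 := by linarith

lemma tendsto_norm_latticePoint_div {d : ℕ} (x : Fin d → ℝ) :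
    Tendsto (fun n : ℕ => ‖latticePoint n x‖ / (n : ℝ)) atTop (𝓝 ‖x‖) := by
  have h2 : Tendsto (fun n : ℕ => 1 / (n : ℝ)) atTop (𝓝 0) :=
    tendsto_const_div_atTop_nhds_zero_nat _
  rw [tendsto_iff_norm_sub_tendsto_zero]
  refine squeeze_zero' (Eventually.of_forall fun n => norm_nonneg _) ?_ h2
  filter_upwards [eventually_gt_atTop 0] with n hn
  have hn' : (0 : ℝ) < n := by exact_mod_cast hn
  have h1 := (abs_norm_sub_norm_le _ _).trans (norm_latticePoint_sub n x)
  rw [norm_toReal, ← Nat.cast_smul_eq_nsmul ℝ, norm_smul, Real.norm_of_nonneg hn'.le] at h1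
  have h3 : ‖latticePoint n x‖ / (n : ℝ) - ‖x‖ = (‖latticePoint n x‖ - n * ‖x‖) / n := by
    field_simp
  rw [h3, norm_div, Real.norm_of_nonneg hn'.le, Real.norm_eq_abs]
  gcongr

lemma latticePoint_toReal {d : ℕ} (n : ℕ) (x : Site d) : latticePoint n (toReal x) = n • x := by
  ext i
  simp only [latticePoint, toReal, Pi.smul_apply, nsmul_eq_mul]
  exact_mod_cast Int.floor_intCast (R := ℝ) ((n : ℤ) * x i)

lemma abs_dot_le {d : ℕ} (l : Fin d → ℝ) (x : Fin d → ℝ) : |∑ i, l i * x i| ≤ (∑ i, |l i|) * ‖x‖ := by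
  rw [Finset.sum_mul]
  refine (Finset.abs_sum_le_sum_abs _ _).trans (Finset.sum_le_sum fun i _ => ?_)
  rw [abs_mul]
  gcongr
  exact norm_le_pi_norm x i

namespace IsSubadditiveCost

variable {d : ℕ} [NeZero d] {g : Site d → ℝ} {c C : ℝ}

/-- The limit defining the Lyapunov function exists: up to a bounded error from the integer parts,
`n ↦ g [n x]` is subadditive, so that Fekete's lemma applies. -/
lemma tendsto_lyapunov (h : IsSubadditiveCost g c C) (x : Fin d → ℝ) :
    Tendsto (fun n : ℕ => g (latticePoint n x) / (n : ℝ)) atTop (𝓝 (lyapunov g x)) := by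
  have hC := h.const_nonneg
  have hs : Subadditive fun n : ℕ => g (latticePoint n x) + C * 3 := by
    intro m n
    have h1 := h.le_add_of_near (norm_latticePoint_add_left m n x)
    have h2 := h.add_le (latticePoint m x) (latticePoint n x)
    simp only
    linarith
  have hb : BddBelow (Set.range fun n : ℕ => (g (latticePoint n x) + C * 3) / (n : ℝ)) := by
    refine ⟨0, ?_⟩
    rintro _ ⟨n, rfl⟩
    have := h.nonneg (latticePoint n x)
    positivity
  have h1 := hs.tendsto_lim hb
  have h2 : Tendsto (fun n : ℕ => C * 3 / (n : ℝ)) atTop (𝓝 0) :=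
    tendsto_const_div_atTop_nhds_zero_nat _
  have h3 : Tendsto (fun n : ℕ => g (latticePoint n x) / (n : ℝ)) atTop (𝓝 hs.lim) := by
    have := h1.sub h2
    rw [sub_zero] at this
    refine this.congr fun n => ?_
    ring
  rw [lyapunov, h3.limUnder_eq]
  exact h3

lemma lyapunov_add_le (h : IsSubadditiveCost g c C) (x y : Fin d → ℝ) :
    lyapunov g (x + y) ≤ lyapunov g x + lyapunov g y := by
  have h2 : Tendsto (fun n : ℕ => C * 3 / (n : ℝ)) atTop (𝓝 0) :=
    tendsto_const_div_atTop_nhds_zero_nat _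
  have h3 := ((h.tendsto_lyapunov x).add (h.tendsto_lyapunov y)).add h2
  rw [add_zero] at h3
  refine le_of_tendsto_of_tendsto' (h.tendsto_lyapunov (x + y)) h3 fun n => ?_
  rw [← add_div, ← add_div]
  gcongr
  have h1 := h.le_add_of_near (norm_latticePoint_add n x y)
  have h4 := h.add_le (latticePoint n x) (latticePoint n y)
  linarith

lemma le_lyapunov (h : IsSubadditiveCost g c C) (x : Fin d → ℝ) : c * ‖x‖ ≤ lyapunov g x := by
  refine le_of_tendsto_of_tendsto' ((tendsto_norm_latticePoint_div x).const_mul c)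
    (h.tendsto_lyapunov x) fun n => ?_
  rw [← mul_div_assoc]
  gcongr
  exact h.le _

lemma lyapunov_le (h : IsSubadditiveCost g c C) (x : Fin d → ℝ) : lyapunov g x ≤ C * ‖x‖ := by
  refine le_of_tendsto_of_tendsto' (h.tendsto_lyapunov x)
    ((tendsto_norm_latticePoint_div x).const_mul C) fun n => ?_
  rw [← mul_div_assoc]
  gcongr
  exact h.ge _

lemma lyapunov_pos (h : IsSubadditiveCost g c C) {x : Fin d → ℝ} (hx : x ≠ 0) :
    0 < lyapunov g x :=
  (mul_pos h.pos (norm_pos_iff.2 hx)).trans_le (h.le_lyapunov x)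

lemma lyapunov_nonneg (h : IsSubadditiveCost g c C) (x : Fin d → ℝ) :
    0 ≤ lyapunov g x :=
  (mul_nonneg h.pos.le (norm_nonneg _)).trans (h.le_lyapunov x)

lemma lyapunov_nsmul (h : IsSubadditiveCost g c C) (k : ℕ) (x : Fin d → ℝ) :
    lyapunov g (k • x) = k * lyapunov g x := by
  rcases Nat.eq_zero_or_pos k with rfl | hk
  · have h1 := h.lyapunov_le (0 : Fin d → ℝ)
    have h2 := h.le_lyapunov (0 : Fin d → ℝ)
    simp only [norm_zero, mul_zero] at h1 h2
    simp [le_antisymm h1 h2]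
  have h1 : Tendsto (fun n : ℕ => n * k) atTop atTop :=
    tendsto_id.atTop_mul_const' hk
  have h2 := ((h.tendsto_lyapunov x).comp h1).const_mul (k : ℝ)
  refine tendsto_nhds_unique (h.tendsto_lyapunov (k • x)) (h2.congr fun n => ?_)
  have h3 : latticePoint (n * k) x = latticePoint n (k • x) := by
    ext i; simp [latticePoint, mul_assoc]
  have hk' : (k : ℝ) ≠ 0 := by positivity
  simp only [Function.comp, h3]
  push_cast
  rw [mul_comm (n : ℝ), ← mul_div_assoc, mul_div_mul_left _ _ hk']

lemma tendsto_apply_nsmul (h : IsSubadditiveCost g c C) (x : Site d) :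
    Tendsto (fun n : ℕ => g (n • x) / (n : ℝ)) atTop (𝓝 (lyapunov g (toReal x))) := by
  simpa [latticePoint_toReal] using h.tendsto_lyapunov (toReal x)

lemma lyapunov_toReal_le (h : IsSubadditiveCost g c C) (x : Site d) :
    lyapunov g (toReal x) ≤ g x := by
  refine le_of_tendsto (h.tendsto_apply_nsmul x) ?_
  filter_upwards [eventually_gt_atTop 0] with n hn
  have hn' : (0 : ℝ) < n := by exact_mod_cast hn
  rw [div_le_iff₀ hn', mul_comm]
  exact h.apply_nsmul_le n x

lemma nsmul_lyapunov_le (h : IsSubadditiveCost g c C) (n : ℕ) (x : Site d) :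
    n * lyapunov g (toReal x) ≤ g (n • x) := by
  rw [← h.lyapunov_nsmul, ← toReal_nsmul]
  exact h.lyapunov_toReal_le _

lemma lyapunov_le_add_of_near (h : IsSubadditiveCost g c C) {x y : Fin d → ℝ} {r : ℝ}
    (hr : ‖x - y‖ ≤ r) : lyapunov g x ≤ lyapunov g y + C * r := by
  have h1 := h.lyapunov_add_le y (x - y)
  have h2 := h.lyapunov_le (x - y)
  have h3 := mul_le_mul_of_nonneg_left hr h.const_nonneg
  rw [add_sub_cancel] at h1
  linarith

/-! ### The dual norm -/

variable (l : Fin d → ℝ)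

lemma bddAbove_dual (h : IsSubadditiveCost g c C) :
    BddAbove (Set.range fun x : {x : Fin d → ℝ // x ≠ 0} =>
      (∑ i, l i * x.1 i) / lyapunov g x.1) := by
  refine ⟨(∑ i, |l i|) / c, ?_⟩
  rintro _ ⟨⟨x, hx⟩, rfl⟩
  have h0 := h.pos
  simp only
  rw [div_le_div_iff₀ (h.lyapunov_pos hx) h0]
  calc (∑ i, l i * x i) * c ≤ ((∑ i, |l i|) * ‖x‖) * c := by
        gcongr; exact (le_abs_self _).trans (abs_dot_le l x)
    _ = (∑ i, |l i|) * (c * ‖x‖) := by ring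
    _ ≤ _ := by
        have : 0 ≤ ∑ i, |l i| := Finset.sum_nonneg fun i _ => abs_nonneg _
        gcongr; exact h.le_lyapunov x

lemma dot_le_dualNorm_mul (h : IsSubadditiveCost g c C) (x : Fin d → ℝ) :
    ∑ i, l i * x i ≤ dualNorm (lyapunov g) l * lyapunov g x := by
  by_cases hx : x = 0
  · have h1 := h.lyapunov_le (0 : Fin d → ℝ)
    have h2 := h.lyapunov_nonneg (0 : Fin d → ℝ)
    simp only [norm_zero, mul_zero] at h1
    simp [hx, le_antisymm h1 h2]
  · rw [← div_le_iff₀ (h.lyapunov_pos hx)]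
    exact le_ciSup (h.bddAbove_dual l) ⟨x, hx⟩

lemma dualNorm_pos (h : IsSubadditiveCost g c C) (hl : l ≠ 0) : 0 < dualNorm (lyapunov g) l := by
  have h1 := h.dot_le_dualNorm_mul l l
  have h2 : 0 < ∑ i, l i * l i := by
    obtain ⟨i, hi⟩ := Function.ne_iff.1 hl
    exact Finset.sum_pos' (fun i _ => mul_self_nonneg _)
      ⟨i, Finset.mem_univ _, mul_self_pos.2 hi⟩
  by_contra hneg
  nlinarith [h.lyapunov_nonneg l, not_lt.1 hneg]

/-- The supremum in the dual norm may be restricted to lattice points. -/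
lemma exists_site_lt_dualNorm (h : IsSubadditiveCost g c C) {r : ℝ}
    (hr : r < dualNorm (lyapunov g) l) :
    ∃ x : Site d, r * lyapunov g (toReal x) < ∑ i, l i * toReal x i := by
  have : Nonempty {x : Fin d → ℝ // x ≠ 0} := by
    refine ⟨fun _ => 1, fun h0 => ?_⟩
    simpa using congrFun h0 0
  obtain ⟨⟨x, hx⟩, hlt⟩ := exists_lt_of_lt_ciSup hr
  simp only at hlt
  rw [lt_div_iff₀ (h.lyapunov_pos hx), ← sub_pos] at hlt
  set a := ∑ i, l i * x i - r * lyapunov g x with ha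
  set L := ∑ i, |l i| with hL
  -- at the lattice point `[n x]` both sides differ from their values at `n x` by a constant
  obtain ⟨n, hn⟩ := exists_nat_gt ((L + |r| * C) / a)
  rw [div_lt_iff₀ hlt] at hn
  refine ⟨latticePoint n x, ?_⟩
  have h1 := norm_latticePoint_sub n x
  have h2 : |lyapunov g (toReal (latticePoint n x)) - n * lyapunov g x| ≤ C := by
    rw [← h.lyapunov_nsmul, abs_le]
    have h3 := h.lyapunov_le_add_of_near h1
    rw [norm_sub_rev] at h1
    have h4 := h.lyapunov_le_add_of_near h1
    constructor <;> linarith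
  have h3 : |∑ i, l i * (toReal (latticePoint n x) - n • x) i| ≤ L :=
    (abs_dot_le l _).trans (mul_le_of_le_one_right
      (Finset.sum_nonneg fun i _ => abs_nonneg _) h1)
  have h4 : ∑ i, l i * (toReal (latticePoint n x) - n • x) i =
      ∑ i, l i * toReal (latticePoint n x) i - n * ∑ i, l i * x i := by
    rw [Finset.mul_sum, ← Finset.sum_sub_distrib]
    refine Finset.sum_congr rfl fun i _ => ?_
    simp only [Pi.sub_apply, nsmul_apply_real]
    ring
  rw [h4] at h3
  have h5 : |r * (lyapunov g (toReal (latticePoint n x)) - n * lyapunov g x)| ≤ |r| * C := by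
    rw [abs_mul]; gcongr
  rw [mul_sub] at h5
  have h6 : n * a = n * ∑ i, l i * x i - r * (n * lyapunov g x) := by rw [ha]; ring
  linarith [(abs_le.1 h3).1, (abs_le.1 h5).2]

end IsSubadditiveCost

/-! ### From point-to-point to point-to-hyperplane -/

/-- Exponential decay in the norm is summable over the lattice. -/
lemma summable_exp_neg_norm {d : ℕ} {a : ℝ} (ha : 0 < a) :
    Summable fun y : Site d => Real.exp (-(a * ‖y‖)) := by
  rcases Nat.eq_zero_or_pos d with rfl | hd
  · exact Summable.of_finite
  have hd' : (0 : ℝ) < d := by exact_mod_cast hd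
  set b := a / d with hb
  have hb0 : 0 < b := by positivity
  have h1 : Summable fun k : ℤ => Real.exp (-(b * |(k : ℝ)|)) := by
    have h2 : Summable fun n : ℕ => Real.exp (-(b * n)) := by
      have := Real.summable_exp_nat_mul_iff.2 (neg_lt_zero.2 hb0)
      refine this.congr fun n => ?_
      congr 1; ring
    refine Summable.of_nat_of_neg ?_ ?_ <;> simpa using h2
  refine summable_of_sum_le (c := (∑' k : ℤ, Real.exp (-(b * |(k : ℝ)|))) ^ d)
    (fun y => (Real.exp_pos _).le) fun s => ?_
  classical
  let t : Fin d → Finset ℤ := fun i => s.image fun y => y i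
  calc ∑ y ∈ s, Real.exp (-(a * ‖y‖))
      ≤ ∑ y ∈ s, ∏ i, Real.exp (-(b * |(y i : ℝ)|)) := by
        refine Finset.sum_le_sum fun y _ => ?_
        rw [← Real.exp_sum]
        refine Real.exp_le_exp.2 ?_
        rw [Finset.sum_neg_distrib, neg_le_neg_iff, ← Finset.mul_sum]
        calc b * ∑ i, |(y i : ℝ)| ≤ b * ∑ _i : Fin d, ‖y‖ := by
              gcongr with i
              simpa [Int.norm_eq_abs] using norm_le_pi_norm y i
          _ = a * ‖y‖ := by
              rw [Finset.sum_const, Finset.card_univ, Fintype.card_fin, nsmul_eq_mul, hb]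
              field_simp
    _ ≤ ∑ y ∈ Fintype.piFinset t, ∏ i, Real.exp (-(b * |(y i : ℝ)|)) := by
        refine Finset.sum_le_sum_of_subset_of_nonneg (fun y hy => ?_) fun y _ _ => by positivity
        rw [Fintype.mem_piFinset]
        exact fun i => Finset.mem_image_of_mem _ hy
    _ = ∏ i, ∑ k ∈ t i, Real.exp (-(b * |(k : ℝ)|)) :=
        (Finset.prod_univ_sum t fun _ (k : ℤ) => Real.exp (-(b * |(k : ℝ)|))).symm
    _ ≤ ∏ _i : Fin d, ∑' k : ℤ, Real.exp (-(b * |(k : ℝ)|)) := by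
        refine Finset.prod_le_prod (fun i _ => Finset.sum_nonneg fun k _ => (Real.exp_pos _).le)
          fun i _ => h1.sum_le_tsum _ fun k _ => (Real.exp_pos _).le
    _ = _ := by simp

/-- If point-to-point weights `exp (-A y)` decay along every lattice direction at most, and at
all but finitely many points at least, as predicted by the Lyapunov norm, then point-to-half-space
weights `W u` decay with the inverse of the dual norm as rate. -/
theorem tendsto_log_halfSpace {d : ℕ} [NeZero d] {g : Site d → ℝ} {c C : ℝ}
    (h : IsSubadditiveCost g c C) {l : Fin d → ℝ} (hl : l ≠ 0) {W : ℝ → ℝ} {A : Site d → ℝ}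
    (hWge : ∀ u, ∀ y ∈ halfSpace l u, Real.exp (-A y) ≤ W u)
    (hWle : ∀ u, ENNReal.ofReal (W u) ≤ ∑' y : halfSpace l u, ENNReal.ofReal (Real.exp (-A y)))
    (hAle : ∀ x : Site d, ∀ ε > 0, ∃ k : ℕ, 0 < k ∧ ∀ᶠ q : ℕ in atTop,
      A (q • k • x) ≤ q * (k * (lyapunov g (toReal x) + ε)))
    (hAge : ∀ ε > 0, ∀ᶠ y in cofinite, (1 - ε) * lyapunov g (toReal y) ≤ A y) :
    Tendsto (fun u : ℝ => 1 / u * Real.log (W u)) atTop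
      (𝓝 (-(1 / dualNorm (lyapunov g) l))) := by
  have hN := h.dualNorm_pos l hl
  set N := dualNorm (lyapunov g) l with hNdef
  have hdot : ∀ y : Site d, ∑ i, l i * toReal y i ≤ N * lyapunov g (toReal y) :=
    fun y => h.dot_le_dualNorm_mul l (toReal y)
  refine tendsto_order.2 ⟨fun b hb => ?_, fun b hb => ?_⟩
  · -- lower bound, from a nearly optimal lattice direction `x`
    have hb1 : 1 / N < -b := by linarith
    have hb0 : 0 < -b := (by positivity : 0 < 1 / N).trans hb1
    have hb2 : 1 / (-b) < N := by
      rw [div_lt_iff₀ hN] at hb1; rw [div_lt_iff₀ hb0]; linarith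
    obtain ⟨x, hx⟩ := h.exists_site_lt_dualNorm l hb2
    set s := ∑ i, l i * toReal x i with hs
    set a := lyapunov g (toReal x) with ha
    rw [div_mul_eq_mul_div, one_mul, div_lt_iff₀ hb0] at hx
    have ha0 : 0 ≤ a := h.lyapunov_nonneg _
    have hs0 : 0 < s := by
      by_contra hneg
      nlinarith [not_lt.1 hneg]
    have hε : 0 < (s * -b - a) / 2 := by linarith
    set ε := (s * -b - a) / 2 with hεdef
    obtain ⟨k, hk, hev⟩ := hAle x ε hε
    have hk' : (0 : ℝ) < k := by exact_mod_cast hk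
    have hq : Tendsto (fun u : ℝ => ⌈u / (k * s)⌉₊) atTop atTop :=
      tendsto_nat_ceil_atTop.comp (tendsto_id.atTop_div_const (by positivity))
    filter_upwards [hq.eventually hev, eventually_gt_atTop 0,
      eventually_gt_atTop (k * (a + ε) * s / ε)] with u hu hu0 hu1
    set q := ⌈u / (k * s)⌉₊ with hqdef
    have h1 : u ≤ q * (k * s) := by
      have := Nat.le_ceil (u / (k * s))
      rwa [div_le_iff₀ (by positivity)] at this
    have h2 : (q : ℝ) ≤ u / (k * s) + 1 := (Nat.ceil_lt_add_one (by positivity)).le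
    have hmem : q • k • x ∈ halfSpace l u := by
      rw [mem_halfSpace]
      refine h1.trans_eq ?_
      rw [hs, Finset.mul_sum, Finset.mul_sum]
      refine Finset.sum_congr rfl fun i _ => ?_
      simp only [toReal_nsmul, nsmul_apply_real]
      ring
    have h3 := Real.log_le_log (Real.exp_pos _) (hWge u _ hmem)
    rw [Real.log_exp] at h3
    have h4 : A (q • k • x) < u * -b := by
      refine hu.trans_lt ?_
      have h5 : (q : ℝ) * (k * (a + ε)) ≤ (u / (k * s) + 1) * (k * (a + ε)) := by gcongr
      refine h5.trans_lt ?_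
      have h6 : (u / (k * s) + 1) * (k * (a + ε)) = (u * (a + ε) + k * (a + ε) * s) / s := by
        field_simp
      rw [h6, div_lt_iff₀ hs0]
      rw [div_lt_iff₀ hε] at hu1
      have h7 : u * -b * s = u * (a + 2 * ε) := by rw [hεdef]; ring
      rw [h7]
      linarith
    rw [one_div, inv_mul_eq_div, lt_div_iff₀ hu0]
    linarith
  · -- upper bound, by summing over all points of the half-space
    have hb1 : -b < 1 / N := by linarith
    obtain ⟨ε, hε, hε1, hε2⟩ : ∃ ε : ℝ, 0 < ε ∧ 2 * ε < 1 ∧ -b < (1 - 2 * ε) / N := by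
      have hcont : Tendsto (fun ε : ℝ => (1 - 2 * ε) / N) (𝓝[>] 0) (𝓝 ((1 - 2 * 0) / N)) := by
        apply Tendsto.mono_left _ nhdsWithin_le_nhds
        exact Continuous.tendsto (by fun_prop) _
      rw [mul_zero, sub_zero] at hcont
      have h1 := hcont.eventually (eventually_gt_nhds hb1)
      have h2 : ∀ᶠ ε : ℝ in 𝓝[>] 0, ε < 1 / 2 :=
        nhdsWithin_le_nhds (eventually_lt_nhds (by norm_num))
      obtain ⟨ε, h3, h4, h5⟩ := (h1.and (h2.and self_mem_nhdsWithin)).exists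
      exact ⟨ε, h5, by linarith, h3⟩
    have hsum := summable_exp_neg_norm (d := d) (mul_pos hε h.pos)
    set K := ∑' y : Site d, Real.exp (-(ε * c * ‖y‖)) with hK
    have hK0 : 0 < K := by
      refine hsum.tsum_pos (fun y => (Real.exp_pos _).le) 0 (Real.exp_pos _)
    -- the finitely many exceptional points lie outside half-spaces far away
    have hfin : ∀ᶠ u : ℝ in atTop, ∀ y ∈ halfSpace l u,
        (1 - ε) * lyapunov g (toReal y) ≤ A y := by
      have hf := hAge ε hε
      rw [eventually_cofinite] at hf
      obtain ⟨B, hB⟩ := (hf.image fun y => ∑ i, l i * (y i : ℝ)).bddAbove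
      filter_upwards [eventually_gt_atTop B] with u hu y hy
      by_contra hy'
      have := hB (Set.mem_image_of_mem _ hy')
      rw [mem_halfSpace] at hy
      exact absurd (hy.trans this) (not_le.2 hu)
    have hlim : Tendsto (fun u : ℝ => 1 / u * Real.log K - (1 - 2 * ε) / N) atTop
        (𝓝 (0 * Real.log K - (1 - 2 * ε) / N)) := by
      refine Tendsto.sub_const (Tendsto.mul_const _ ?_) _
      exact (tendsto_inv_atTop_zero (𝕜 := ℝ)).congr fun u => (one_div u).symm
    have hlim' := hlim.eventually (eventually_lt_nhds (b := b) (by linarith))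
    obtain ⟨z, hz⟩ : ∃ z : Site d, 0 < ∑ i, l i * toReal z i := by
      obtain ⟨z, hz⟩ := h.exists_site_lt_dualNorm l hN
      exact ⟨z, by simpa using hz⟩
    filter_upwards [hfin, hlim', eventually_gt_atTop 0] with u hu hub hu0
    refine lt_of_le_of_lt ?_ hub
    have hbound : W u ≤ Real.exp (-((1 - 2 * ε) * (u / N))) * K := by
      refine (ENNReal.ofReal_le_ofReal_iff (by positivity)).1 ((hWle u).trans ?_)
      rw [ENNReal.ofReal_mul (Real.exp_pos _).le, hK,
        ENNReal.ofReal_tsum_of_nonneg (fun y => (Real.exp_pos _).le) hsum, ← ENNReal.tsum_mul_left]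
      refine le_trans (ENNReal.tsum_le_tsum fun y => ?_) (ENNReal.tsum_comp_le_tsum_of_injective
        Subtype.val_injective _)
      rw [← ENNReal.ofReal_mul (Real.exp_pos _).le, ← Real.exp_add]
      refine ENNReal.ofReal_le_ofReal (Real.exp_le_exp.2 ?_)
      have h1 := hu y y.2
      have h2 : u / N ≤ lyapunov g (toReal y.1) := by
        rw [div_le_iff₀ hN, mul_comm]
        exact le_trans y.2 (hdot y)
      have h3 := h.le_lyapunov (toReal y.1)
      rw [norm_toReal] at h3
      have h4 : (1 - 2 * ε) * (u / N) ≤ (1 - 2 * ε) * lyapunov g (toReal y.1) := by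
        gcongr
      have h5 : ε * (c * ‖y.1‖) ≤ ε * lyapunov g (toReal y.1) := by gcongr
      linarith
    -- positivity matters, as `Real.log` vanishes at `0`
    have hWpos : 0 < W u := by
      obtain ⟨n, hn⟩ := exists_nat_gt (u / ∑ i, l i * toReal z i)
      rw [div_lt_iff₀ hz] at hn
      refine (Real.exp_pos _).trans_le (hWge u (n • z) ?_)
      rw [mem_halfSpace]
      refine hn.le.trans_eq ?_
      rw [Finset.mul_sum]
      refine Finset.sum_congr rfl fun i _ => ?_
      simp only [toReal_nsmul, nsmul_apply_real]
      ring
    have h1 := Real.log_le_log hWpos hbound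
    rw [Real.log_mul (Real.exp_pos _).ne' hK0.ne', Real.log_exp] at h1
    calc 1 / u * Real.log (W u) ≤ 1 / u * (-((1 - 2 * ε) * (u / N)) + Real.log K) := by gcongr
      _ = _ := by field_simp; ring

/-! ### The Markov property of the walk -/

/-- The sequence of steps after time `n`. -/
def shiftWalk {d : ℕ} (n : ℕ) (w : WalkSpace d) : WalkSpace d := fun k => w (n + k)

/-- The first `n` steps of one sequence, followed by another sequence. -/
def concatWalk {d : ℕ} (n : ℕ) (p : WalkSpace d × WalkSpace d) : WalkSpace d :=
  fun k => if k < n then p.1 k else p.2 (k - n)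

instance {d : ℕ} [NeZero d] : IsProbabilityMeasure (walkMeasure d) := by
  unfold walkMeasure; infer_instance

section Walk

variable {d : ℕ}

lemma walk_zero (w : WalkSpace d) : walk w 0 = 0 := by simp [walk]

lemma walk_succ (w : WalkSpace d) (n : ℕ) : walk w (n + 1) = walk w n + unitStep (w n) := by
  simp [walk, Finset.sum_range_succ]

lemma walk_add (w : WalkSpace d) (n m : ℕ) :
    walk w (n + m) = walk w n + walk (shiftWalk n w) m := by
  simp [walk, Finset.sum_range_add, shiftWalk]

lemma walk_congr {w w' : WalkSpace d} {n m : ℕ} (h : ∀ k < n, w k = w' k) (hm : m ≤ n) :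
    walk w m = walk w' m :=
  Finset.sum_congr rfl fun k hk => by rw [h k ((Finset.mem_range.1 hk).trans_le hm)]

lemma shiftWalk_concatWalk (n : ℕ) (p : WalkSpace d × WalkSpace d) :
    shiftWalk n (concatWalk n p) = p.2 := by
  ext1 k; simp [shiftWalk, concatWalk]

lemma concatWalk_apply_of_lt {n k : ℕ} (h : k < n) (p : WalkSpace d × WalkSpace d) :
    concatWalk n p k = p.1 k := by
  simp [concatWalk, h]

lemma measurable_concatWalk (n : ℕ) : Measurable (concatWalk (d := d) n) := by
  refine measurable_pi_lambda _ fun k => ?_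
  unfold concatWalk
  split_ifs <;> fun_prop

lemma measurable_shiftWalk (n : ℕ) : Measurable (shiftWalk (d := d) n) :=
  measurable_pi_lambda _ fun _ => measurable_pi_apply _

/-- The steps before and after time `n` are independent, and the latter have the law of the
walk. -/
lemma measurePreserving_concatWalk [NeZero d] (n : ℕ) :
    MeasurePreserving (concatWalk (d := d) n) ((walkMeasure d).prod (walkMeasure d))
      (walkMeasure d) := by
  refine ⟨measurable_concatWalk n, ?_⟩
  refine Measure.eq_infinitePi _ fun s t ht => ?_
  rw [Measure.map_apply (measurable_concatWalk n) (.pi s.countable_toSet fun _ _ => ht _)]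
  have h1 : concatWalk n ⁻¹' ((s : Set ℕ).pi t) =
      (((s.filter (· < n) : Finset ℕ) : Set ℕ).pi t) ×ˢ
        ((((s.filter (¬ · < n)).image (· - n) : Finset ℕ) : Set ℕ).pi fun j => t (n + j)) := by
    ext p
    simp only [Set.mem_preimage, Set.mem_pi, Set.mem_prod, Finset.mem_coe, Finset.mem_filter,
      Finset.mem_image, concatWalk]
    constructor
    · intro h
      refine ⟨fun k hk => by simpa [hk.2] using h k hk.1, ?_⟩
      rintro _ ⟨k, ⟨hk, hkn⟩, rfl⟩
      have := h k hk
      rw [if_neg hkn] at this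
      rwa [Nat.add_sub_cancel' (not_lt.1 hkn)]
    · rintro ⟨h, h'⟩ k hk
      split_ifs with hkn
      · exact h k ⟨hk, hkn⟩
      · have := h' (k - n) ⟨k, ⟨hk, hkn⟩, rfl⟩
        rwa [Nat.add_sub_cancel' (not_lt.1 hkn)] at this
  rw [h1, Measure.prod_prod, walkMeasure, Measure.infinitePi_pi _ fun i _ => ht i,
    Measure.infinitePi_pi _ fun i _ => ht _, Finset.prod_image,
    ← Finset.prod_filter_mul_prod_filter_not s (· < n)]
  · congr 1
    refine Finset.prod_congr rfl fun k hk => ?_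
    rw [Nat.add_sub_cancel' (not_lt.1 (Finset.mem_filter.1 hk).2)]
  · intro a ha b hb hab
    simp only [Finset.coe_filter, Set.mem_ofPred_eq, not_lt] at ha hb
    replace hab : a - n = b - n := hab
    omega

/-- A function of the walk that depends only on the first `n` steps. -/
def DependsOnSteps {β : Type*} (n : ℕ) (f : WalkSpace d → β) : Prop :=
  ∀ w w' : WalkSpace d, (∀ k < n, w k = w' k) → f w = f w'

lemma DependsOnSteps.measurable {β : Type*} [MeasurableSpace β] [NeZero d] {n : ℕ}
    {f : WalkSpace d → β} (hf : DependsOnSteps n f) : Measurable f := by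
  let r : WalkSpace d → (Fin n → Fin d × Bool) := fun w k => w k
  let e : (Fin n → Fin d × Bool) → WalkSpace d :=
    fun p k => if h : k < n then p ⟨k, h⟩ else (0, true)
  have h1 : f = (f ∘ e) ∘ r := by
    ext1 w
    refine hf _ _ fun k hk => ?_
    simp [e, r, hk]
  rw [h1]
  exact (measurable_of_finite _).comp (measurable_pi_lambda _ fun k => measurable_pi_apply _)

/-- The Markov property at a fixed time. -/
lemma lintegral_mul_shiftWalk [NeZero d] {n : ℕ} {f G : WalkSpace d → ℝ≥0∞}
    (hf : DependsOnSteps n f) (hG : Measurable G) :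
    ∫⁻ w, f w * G (shiftWalk n w) ∂walkMeasure d =
      (∫⁻ w, f w ∂walkMeasure d) * ∫⁻ w, G w ∂walkMeasure d := by
  have hm : Measurable fun w => f w * G (shiftWalk n w) :=
    hf.measurable.mul (hG.comp (measurable_shiftWalk n))
  rw [← (measurePreserving_concatWalk n).lintegral_comp hm,
    ← lintegral_prod_mul hf.measurable.aemeasurable hG.aemeasurable]
  refine lintegral_congr fun p => ?_
  rw [shiftWalk_concatWalk, hf _ p.1 fun k hk => concatWalk_apply_of_lt hk p]

/-! ### Hitting times -/

lemma hittingTime_le {A : Set (Site d)} {w : WalkSpace d} {n : ℕ} (h : walk w n ∈ A) :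
    hittingTime A w ≤ n :=
  iInf₂_le n h

lemma hittingTime_eq_coe_iff {A : Set (Site d)} {w : WalkSpace d} {n : ℕ} :
    hittingTime A w = n ↔ walk w n ∈ A ∧ ∀ m < n, walk w m ∉ A := by
  constructor
  · intro h
    have h2 : ∀ m < n, walk w m ∉ A := by
      intro m hm hmA
      have := hittingTime_le hmA
      rw [h] at this
      exact absurd (Nat.cast_le.1 this) (not_le.2 hm)
    refine ⟨?_, h2⟩
    by_contra hn
    have : ((n + 1 : ℕ) : ℕ∞) ≤ hittingTime A w := by
      refine le_iInf₂ fun m hm => Nat.cast_le.2 ?_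
      rcases lt_trichotomy m n with h' | h' | h'
      · exact absurd hm (h2 m h')
      · subst h'; exact absurd hm hn
      · exact h'
    rw [h, Nat.cast_le] at this
    omega
  · rintro ⟨h1, h2⟩
    refine le_antisymm (hittingTime_le h1) (le_iInf₂ fun m hm => Nat.cast_le.2 ?_)
    by_contra hlt
    exact h2 m (not_le.1 hlt) hm

lemma exists_hittingTime_eq {A : Set (Site d)} {w : WalkSpace d} {n : ℕ} (h : walk w n ∈ A) :
    ∃ m ≤ n, hittingTime A w = m := by
  have h1 := hittingTime_le h
  obtain ⟨m, hm⟩ := ENat.ne_top_iff_exists.1 (ne_top_of_le_ne_top (ENat.natCast_ne_top n) h1)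
  rw [← hm, Nat.cast_le] at h1
  exact ⟨m, h1, hm.symm⟩

lemma dependsOnSteps_hittingTime_eq (A : Set (Site d)) (n : ℕ) :
    DependsOnSteps n fun w => hittingTime A w = n := by
  intro w w' h
  simp only [hittingTime_eq_coe_iff, eq_iff_iff]
  rw [walk_congr h le_rfl]
  refine and_congr_right fun _ => forall₂_congr fun m hm => ?_
  rw [walk_congr h hm.le]

/-- A walk from `0` to `x` visits at least `‖x‖` sites after time `0`: some coordinate takes all
values between `0` and `‖x‖` in modulus. -/
lemma norm_walk_le_card (w : WalkSpace d) (n : ℕ) :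
    ‖walk w n‖ ≤ ((Finset.Icc 1 n).image (walk w)).card := by
  rw [pi_norm_le_iff_of_nonneg (Nat.cast_nonneg _)]
  intro i
  let h : ℕ → ℕ := fun m => (walk w m i).natAbs
  have hstep : ∀ m, h (m + 1) ≤ h m + 1 := by
    intro m
    simp only [h, walk_succ, Pi.add_apply]
    refine (Int.natAbs_add_le _ _).trans (Nat.add_le_add_left ?_ _)
    unfold unitStep
    by_cases hi : i = (w m).1
    · rw [hi, Pi.single_eq_same]; split_ifs <;> simp
    · rw [Pi.single_eq_of_ne hi]; simp
  have hivt : ∀ n, ∀ k ≤ h n, ∃ m ≤ n, h m = k := by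
    intro n
    induction n with
    | zero =>
      intro k hk
      simp only [h, walk_zero, Pi.zero_apply, Int.natAbs_zero, Nat.le_zero] at hk
      exact ⟨0, le_rfl, by simp [h, walk_zero, hk]⟩
    | succ n ih =>
      intro k hk
      rcases (hk.trans (hstep n)).lt_or_eq with h1 | h1
      · obtain ⟨m, hm, hmk⟩ := ih k (Nat.lt_succ_iff.1 h1)
        exact ⟨m, hm.trans n.le_succ, hmk⟩
      · exact ⟨n + 1, le_rfl, le_antisymm (h1 ▸ hstep n) hk⟩
  have hsub : Finset.Icc 1 (h n) ⊆
      ((Finset.Icc 1 n).image (walk w)).image fun z => (z i).natAbs := by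
    intro k hk
    rw [Finset.mem_Icc] at hk
    obtain ⟨m, hm, hmk⟩ := hivt n k hk.2
    have hm0 : m ≠ 0 := by
      rintro rfl
      simp only [h, walk_zero, Pi.zero_apply, Int.natAbs_zero] at hmk
      omega
    exact Finset.mem_image.2 ⟨walk w m, Finset.mem_image_of_mem _
      (Finset.mem_Icc.2 ⟨Nat.one_le_iff_ne_zero.2 hm0, hm⟩), hmk⟩
  have hcard := (Finset.card_le_card hsub).trans Finset.card_image_le
  rw [Nat.card_Icc, Nat.add_sub_cancel] at hcard
  rw [Int.norm_eq_abs, ← Int.cast_abs, Int.abs_eq_natAbs, Int.cast_natCast]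
  exact_mod_cast hcard

lemma unitStep_ne_zero (e : Fin d × Bool) : unitStep e ≠ 0 := by
  intro h
  have := congrFun h e.1
  unfold unitStep at this
  rw [Pi.single_eq_same] at this
  cases h2 : e.2 <;> simp [h2] at this

/-- Every lattice point `x` is a sum of at most `d ‖x‖` unit steps. -/
lemma site_induction {p : Site d → ℕ → Prop} (h0 : p 0 0)
    (hstep : ∀ x n e, p x n → p (x + unitStep e) (n + 1)) (x : Site d) :
    ∃ n : ℕ, p x n ∧ (n : ℝ) ≤ d * ‖x‖ := by
  have h1 : ∀ n : ℕ, ∀ x : Site d, ∑ i, (x i).natAbs = n → p x n := by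
    intro n
    induction n with
    | zero =>
      intro x hx
      have : x = 0 := by
        ext i
        simpa using (Finset.sum_eq_zero_iff.1 hx) i (Finset.mem_univ i)
      rwa [this]
    | succ n ih =>
      intro x hx
      obtain ⟨i, hi⟩ : ∃ i, x i ≠ 0 := by
        by_contra hall
        push Not at hall
        simp [hall] at hx
      obtain ⟨e, he, hs⟩ : ∃ e : Fin d × Bool, e.1 = i ∧
          (x i - unitStep e i).natAbs + 1 = (x i).natAbs := by
        rcases lt_or_gt_of_ne hi with h | h
        · refine ⟨(i, false), rfl, ?_⟩
          simp only [unitStep, Pi.single_eq_same, Bool.false_eq_true, if_false]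
          omega
        · refine ⟨(i, true), rfl, ?_⟩
          simp only [unitStep, Pi.single_eq_same, if_true]
          omega
      have hx' : ∑ j, ((x - unitStep e) j).natAbs = n := by
        have h2 : ∑ j ∈ Finset.univ.erase i, ((x - unitStep e) j).natAbs =
            ∑ j ∈ Finset.univ.erase i, (x j).natAbs := by
          refine Finset.sum_congr rfl fun j hj => ?_
          rw [Pi.sub_apply, unitStep, he, Pi.single_eq_of_ne (Finset.ne_of_mem_erase hj), sub_zero]
        rw [← Finset.add_sum_erase _ _ (Finset.mem_univ i)] at hx ⊢
        rw [h2, Pi.sub_apply]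
        omega
      have := hstep _ n e (ih _ hx')
      rwa [sub_add_cancel] at this
  refine ⟨_, h1 _ x rfl, ?_⟩
  push_cast
  calc ∑ i, ((x i).natAbs : ℝ) ≤ ∑ _i : Fin d, ‖x‖ := by
        refine Finset.sum_le_sum fun i _ => ?_
        have := norm_le_pi_norm x i
        rwa [Int.norm_eq_abs, ← Int.cast_abs, Int.abs_eq_natAbs, Int.cast_natCast] at this
    _ = d * ‖x‖ := by simp

/-! ### Weights of hitting times -/

/-- A path potential that starts at zero, accumulates along the path and only depends on the
path up to the present. -/
structure IsPathPotential (c : WalkSpace d → ℕ → ℝ) : Prop where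
  zero : ∀ w, c w 0 = 0
  mono : ∀ w, Monotone (c w)
  adapted : ∀ n, DependsOnSteps n fun w => c w n

lemma IsPathPotential.nonneg {c : WalkSpace d → ℕ → ℝ} (hc : IsPathPotential c)
    (w : WalkSpace d) (n : ℕ) : 0 ≤ c w n :=
  (hc.zero w).symm.trans_le (hc.mono w n.zero_le)

/-- The contribution `exp (-λ H - c(H)); H = n ≤ T` to the weight of the hitting time `H`
of `A`. -/
def hitTerm (lam : ℝ) (c : WalkSpace d → ℕ → ℝ) (A : Set (Site d)) (T : ℕ∞) (n : ℕ)
    (w : WalkSpace d) : ℝ≥0∞ :=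
  open Classical in
  if hittingTime A w = n ∧ (n : ℕ∞) ≤ T then ENNReal.ofReal (Real.exp (-lam * n - c w n)) else 0

/-- The discount `exp (-λ H - c(H)); H ≤ T, H < ∞` at the hitting time `H` of `A`, with a time
horizon `T`. -/
def hitDiscount (lam : ℝ) (c : WalkSpace d → ℕ → ℝ) (A : Set (Site d)) (T : ℕ∞)
    (w : WalkSpace d) : ℝ≥0∞ :=
  ∑' n, hitTerm lam c A T n w

/-- The weight `E[exp (-λ H - c(H)); H ≤ T, H < ∞]` of the hitting time `H` of `A`. A finite
horizon `T` makes it a function of finitely many values of a random potential. -/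
def hitWeight [NeZero d] (lam : ℝ) (c : WalkSpace d → ℕ → ℝ) (A : Set (Site d)) (T : ℕ∞) : ℝ≥0∞ :=
  ∫⁻ w, hitDiscount lam c A T w ∂walkMeasure d

variable {lam : ℝ} {c c' : WalkSpace d → ℕ → ℝ} {A : Set (Site d)} {T : ℕ∞}

lemma hitTerm_dependsOnSteps (hc : IsPathPotential c) (n : ℕ) :
    DependsOnSteps n (hitTerm lam c A T n) := by
  intro w w' h
  have h1 := dependsOnSteps_hittingTime_eq A n w w' h
  have h2 := hc.adapted n w w' h
  simp only [eq_iff_iff] at h1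
  simp only [hitTerm, h1, h2]

lemma hitDiscount_of_eq {w : WalkSpace d} {n : ℕ} (h : hittingTime A w = n) :
    hitDiscount lam c A T w = hitTerm lam c A T n w := by
  refine tsum_eq_single n fun m hm => ?_
  rw [hitTerm, if_neg]
  rintro ⟨h1, -⟩
  exact hm (Nat.cast_injective (h1.symm.trans h))

lemma hitTerm_of_eq {w : WalkSpace d} {n : ℕ} (h : hittingTime A w = n) (hn : (n : ℕ∞) ≤ T) :
    hitTerm lam c A T n w = ENNReal.ofReal (Real.exp (-lam * n - c w n)) := by
  rw [hitTerm, if_pos ⟨h, hn⟩]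

lemma hitDiscount_eq_zero {w : WalkSpace d} (h : hittingTime A w = ⊤ ∨ T < hittingTime A w) :
    hitDiscount lam c A T w = 0 := by
  refine ENNReal.tsum_eq_zero.2 fun n => ?_
  rw [hitTerm, if_neg]
  rintro ⟨h1, h2⟩
  rcases h with h | h
  · rw [h1] at h; exact ENat.natCast_ne_top n h
  · rw [h1] at h; exact absurd h2 (not_le.2 h)

lemma hitDiscount_eq_discount (w : WalkSpace d) :
    hitDiscount lam c A ⊤ w = ENNReal.ofReal (discount lam (c w) (hittingTime A w)) := by
  by_cases h : hittingTime A w = ⊤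
  · rw [hitDiscount_eq_zero (Or.inl h), discount, if_pos h, ENNReal.ofReal_zero]
  · obtain ⟨n, hn⟩ := ENat.ne_top_iff_exists.1 h
    rw [hitDiscount_of_eq hn.symm, hitTerm_of_eq hn.symm le_top, discount, if_neg h, ← hn,
      ENat.toNat_natCast]

lemma hitDiscount_le {w : WalkSpace d} {b : ℝ≥0∞}
    (h : ∀ n : ℕ, hittingTime A w = n → (n : ℕ∞) ≤ T →
      ENNReal.ofReal (Real.exp (-lam * n - c w n)) ≤ b) :
    hitDiscount lam c A T w ≤ b := by
  by_cases h1 : hittingTime A w = ⊤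
  · rw [hitDiscount_eq_zero (Or.inl h1)]; exact zero_le
  · obtain ⟨n, hn⟩ := ENat.ne_top_iff_exists.1 h1
    by_cases h2 : (n : ℕ∞) ≤ T
    · rw [hitDiscount_of_eq hn.symm, hitTerm_of_eq hn.symm h2]
      exact h n hn.symm h2
    · rw [hitDiscount_eq_zero (Or.inr (hn ▸ not_le.1 h2))]; exact zero_le

lemma hitDiscount_le_one (hlam : 0 ≤ lam) (hc : IsPathPotential c) (w : WalkSpace d) :
    hitDiscount lam c A T w ≤ 1 := by
  refine hitDiscount_le fun n _ _ => ?_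
  rw [← ENNReal.ofReal_one]
  refine ENNReal.ofReal_le_ofReal (Real.exp_le_one_iff.2 ?_)
  have h1 := hc.nonneg w n
  have h2 : 0 ≤ lam * n := by positivity
  linarith

lemma hitDiscount_anti {lam' : ℝ} {T' : ℕ∞} (hl : lam' ≤ lam) (hT : T ≤ T') (w : WalkSpace d)
    (h : ∀ n, c' w n ≤ c w n) :
    hitDiscount lam c A T w ≤ hitDiscount lam' c' A T' w := by
  refine hitDiscount_le fun n hn hnT => ?_
  rw [hitDiscount_of_eq hn, hitTerm_of_eq hn (hnT.trans hT)]
  refine ENNReal.ofReal_le_ofReal (Real.exp_le_exp.2 ?_)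
  have := mul_le_mul_of_nonneg_right hl (Nat.cast_nonneg (α := ℝ) n)
  linarith [h n]

lemma hitDiscount_le_of_mem (hlam : 0 ≤ lam) (hc : IsPathPotential c) {y : Site d} (hy : y ∈ A)
    (w : WalkSpace d) : hitDiscount lam c {y} T w ≤ hitDiscount lam c A T w := by
  refine hitDiscount_le fun n hn hnT => ?_
  have h1 : walk w n ∈ A := by
    rw [(hittingTime_eq_coe_iff.1 hn).1]; exact hy
  obtain ⟨m, hm, hmA⟩ := exists_hittingTime_eq h1
  rw [hitDiscount_of_eq hmA, hitTerm_of_eq hmA ((Nat.cast_le.2 hm).trans hnT)]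
  refine ENNReal.ofReal_le_ofReal (Real.exp_le_exp.2 ?_)
  have h2 := hc.mono w hm
  have h3 : lam * m ≤ lam * n := by gcongr
  linarith

lemma hitDiscount_le_tsum (w : WalkSpace d) :
    hitDiscount lam c A T w ≤ ∑' y : A, hitDiscount lam c {y.1} T w := by
  refine hitDiscount_le fun n hn hnT => ?_
  obtain ⟨h1, h2⟩ := hittingTime_eq_coe_iff.1 hn
  have h3 : hittingTime {walk w n} w = n := by
    refine hittingTime_eq_coe_iff.2 ⟨rfl, fun m hm hmn => h2 m hm ?_⟩
    rw [Set.mem_singleton_iff] at hmn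
    rwa [hmn]
  refine le_trans ?_ (ENNReal.le_tsum (⟨walk w n, h1⟩ : A))
  rw [hitDiscount_of_eq h3, hitTerm_of_eq h3 hnT]

/-- The discount at the hitting time of `x + y` is at least the discount at the hitting time of
`x` times the discount, for the walk thereafter, at the hitting time of `y`. -/
lemma hitTerm_mul_le {S : ℕ∞} {c'' : WalkSpace d → ℕ → ℝ} (hlam : 0 ≤ lam)
    (hc'' : IsPathPotential c'') {x y : Site d} {w : WalkSpace d}
    (h : ∀ n m, walk w n = x → c'' w (n + m) ≤ c w n + c' (shiftWalk n w) m) (n : ℕ) :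
    hitTerm lam c {x} S n w * hitDiscount lam c' {y} T (shiftWalk n w) ≤
      hitDiscount lam c'' {x + y} (S + T) w := by
  by_cases h1 : hittingTime {x} w = n ∧ (n : ℕ∞) ≤ S
  swap
  · rw [hitTerm, if_neg h1, zero_mul]; exact zero_le
  obtain ⟨h1, hnS⟩ := h1
  by_cases h2 : hittingTime {y} (shiftWalk n w) = ⊤
  · rw [hitDiscount_eq_zero (Or.inl h2), mul_zero]; exact zero_le
  obtain ⟨m, hm⟩ := ENat.ne_top_iff_exists.1 h2
  by_cases hmT : (m : ℕ∞) ≤ T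
  swap
  · rw [hitDiscount_eq_zero (Or.inr (hm ▸ not_le.1 hmT)), mul_zero]; exact zero_le
  rw [hitTerm_of_eq h1 hnS, hitDiscount_of_eq hm.symm, hitTerm_of_eq hm.symm hmT,
    ← ENNReal.ofReal_mul (Real.exp_pos _).le, ← Real.exp_add]
  have hx : walk w n = x := (hittingTime_eq_coe_iff.1 h1).1
  have hy : walk (shiftWalk n w) m = y := (hittingTime_eq_coe_iff.1 hm.symm).1
  have hxy : walk w (n + m) ∈ ({x + y} : Set (Site d)) := by
    rw [walk_add, hx, hy]; rfl
  obtain ⟨k, hk, hkA⟩ := exists_hittingTime_eq hxy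
  have hkT : (k : ℕ∞) ≤ S + T := by
    refine (Nat.cast_le.2 hk).trans ?_
    push_cast
    exact add_le_add hnS hmT
  rw [hitDiscount_of_eq hkA, hitTerm_of_eq hkA hkT]
  refine ENNReal.ofReal_le_ofReal (Real.exp_le_exp.2 ?_)
  have h3 := h n m hx
  have h4 := hc''.mono w hk
  have h5 : (k : ℝ) ≤ n + m := by exact_mod_cast hk
  nlinarith

variable [NeZero d]

lemma measurable_hitTerm (hc : IsPathPotential c) (n : ℕ) : Measurable (hitTerm lam c A T n) :=
  (hitTerm_dependsOnSteps hc n).measurable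

lemma measurable_hitDiscount (hc : IsPathPotential c) : Measurable (hitDiscount lam c A T) :=
  Measurable.tsum fun n => measurable_hitTerm hc n

lemma hitWeight_le_one (hlam : 0 ≤ lam) (hc : IsPathPotential c) : hitWeight lam c A T ≤ 1 := by
  refine (lintegral_mono fun w => hitDiscount_le_one hlam hc w).trans ?_
  simp

lemma hitWeight_ne_top (hlam : 0 ≤ lam) (hc : IsPathPotential c) : hitWeight lam c A T ≠ ⊤ :=
  ne_top_of_le_ne_top ENNReal.one_ne_top (hitWeight_le_one hlam hc)

lemma hitWeight_anti {lam' : ℝ} {T' : ℕ∞} (hl : lam' ≤ lam) (hT : T ≤ T')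
    (h : ∀ w n, c' w n ≤ c w n) : hitWeight lam c A T ≤ hitWeight lam' c' A T' :=
  lintegral_mono fun w => hitDiscount_anti hl hT w (h w)

lemma hittingWeight_eq (hc : IsPathPotential c) :
    hittingWeight lam c A = (hitWeight lam c A ⊤).toReal := by
  have h0 : ∀ w, 0 ≤ discount lam (c w) (hittingTime A w) := by
    intro w
    unfold discount
    split_ifs
    · exact le_rfl
    · exact (Real.exp_pos _).le
  have h1 : (fun w => discount lam (c w) (hittingTime A w)) =
      fun w => (hitDiscount lam c A ⊤ w).toReal := by
    ext1 w
    rw [hitDiscount_eq_discount, ENNReal.toReal_ofReal (h0 w)]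
  rw [hittingWeight, integral_eq_lintegral_of_nonneg_ae (Eventually.of_forall h0)]
  · simp only [hitWeight, hitDiscount_eq_discount]
  · rw [h1]
    exact (measurable_hitDiscount hc).ennreal_toReal.aestronglyMeasurable

lemma hitWeight_le_of_mem (hlam : 0 ≤ lam) (hc : IsPathPotential c) {y : Site d} (hy : y ∈ A) :
    hitWeight lam c {y} T ≤ hitWeight lam c A T :=
  lintegral_mono fun w => hitDiscount_le_of_mem hlam hc hy w

lemma hitWeight_le_tsum (hc : IsPathPotential c) :
    hitWeight lam c A T ≤ ∑' y : A, hitWeight lam c {y.1} T := by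
  rw [hitWeight]
  refine (lintegral_mono fun w => hitDiscount_le_tsum w).trans_eq ?_
  exact lintegral_tsum fun y => (measurable_hitDiscount hc).aemeasurable

/-- Supermultiplicativity of point-to-point weights, by the Markov property at the hitting time
of `x`. -/
lemma hitWeight_mul_le {S : ℕ∞} {c'' : WalkSpace d → ℕ → ℝ} (hlam : 0 ≤ lam)
    (hc : IsPathPotential c) (hc' : IsPathPotential c') (hc'' : IsPathPotential c'')
    {x y : Site d}
    (h : ∀ w n m, walk w n = x → c'' w (n + m) ≤ c w n + c' (shiftWalk n w) m) :
    hitWeight lam c {x} S * hitWeight lam c' {y} T ≤ hitWeight lam c'' {x + y} (S + T) := by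
  have h1 : hitWeight lam c {x} S = ∑' n, ∫⁻ w, hitTerm lam c {x} S n w ∂walkMeasure d :=
    lintegral_tsum fun n => (measurable_hitTerm hc n).aemeasurable
  rw [h1, ← ENNReal.tsum_mul_right]
  have h2 : ∀ n, (∫⁻ w, hitTerm lam c {x} S n w ∂walkMeasure d) * hitWeight lam c' {y} T =
      ∫⁻ w, hitTerm lam c {x} S n w * hitDiscount lam c' {y} T (shiftWalk n w) ∂walkMeasure d :=
    fun n => (lintegral_mul_shiftWalk (hitTerm_dependsOnSteps hc n)
      (measurable_hitDiscount hc')).symm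
  simp_rw [h2]
  have hm : ∀ n, Measurable fun w =>
      hitTerm lam c {x} S n w * hitDiscount lam c' {y} T (shiftWalk n w) := fun n =>
    (measurable_hitTerm hc n).mul ((measurable_hitDiscount hc').comp (measurable_shiftWalk n))
  rw [← lintegral_tsum fun n => (hm n).aemeasurable]
  refine lintegral_mono fun w => ?_
  by_cases h3 : hittingTime {x} w = ⊤
  · rw [ENNReal.tsum_eq_zero.2]
    · exact zero_le
    · intro n
      rw [hitTerm, if_neg, zero_mul]
      rintro ⟨h4, -⟩
      rw [h3] at h4
      exact ENat.top_ne_natCast n h4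
  · obtain ⟨n, hn⟩ := ENat.ne_top_iff_exists.1 h3
    rw [tsum_eq_single n]
    · exact hitTerm_mul_le hlam hc'' (h w) n
    · intro m hm
      rw [hitTerm, if_neg, zero_mul]
      rintro ⟨h4, -⟩
      exact hm (Nat.cast_injective (h4.symm.trans hn.symm))

lemma hitWeight_zero (hc : IsPathPotential c) : hitWeight lam c {0} T = 1 := by
  have h1 : ∀ w, hitDiscount lam c {0} T w = 1 := by
    intro w
    have h2 : hittingTime {0} w = (0 : ℕ) :=
      hittingTime_eq_coe_iff.2 ⟨walk_zero w, fun m hm => absurd hm (Nat.not_lt_zero m)⟩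
    rw [hitDiscount_of_eq h2, hitTerm_of_eq h2 (by simp), hc.zero]
    simp
  simp [hitWeight, h1]

lemma walkMeasure_step (e : Fin d × Bool) :
    walkMeasure d {w | w 0 = e} = ENNReal.ofReal (1 / (2 * d)) := by
  have h1 : {w : WalkSpace d | w 0 = e} = (fun w => w 0) ⁻¹' {e} := rfl
  rw [h1, ← Measure.map_apply (measurable_pi_apply 0) (measurableSet_singleton e), walkMeasure,
    Measure.infinitePi_map_eval, PMF.toMeasure_apply_singleton _ _ (measurableSet_singleton e),
    PMF.uniformOfFintype_apply, Fintype.card_prod, Fintype.card_fin, Fintype.card_bool,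
    one_div, ENNReal.ofReal_inv_of_pos]
  · congr 1
    rw [mul_comm, ENNReal.ofReal_mul zero_le_two, ENNReal.ofReal_natCast]
    simp
  · have : 0 < d := Nat.pos_of_ne_zero (NeZero.ne d)
    positivity

/-- A lower bound for the weight of a unit step, from walks that make this step first. -/
lemma le_hitWeight_unitStep {e : Fin d × Bool} {b : ℝ} (hT : 1 ≤ T)
    (hb : ∀ w, w 0 = e → c w 1 ≤ b) :
    ENNReal.ofReal (Real.exp (-(Real.log (2 * d) + lam + b))) ≤
      hitWeight lam c {unitStep e} T := by
  have hd : (0 : ℝ) < 2 * d := by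
    have : 0 < d := Nat.pos_of_ne_zero (NeZero.ne d)
    positivity
  have hms : MeasurableSet {w : WalkSpace d | w 0 = e} :=
    (measurable_pi_apply 0 : Measurable fun w : WalkSpace d => w 0) (measurableSet_singleton e)
  calc ENNReal.ofReal (Real.exp (-(Real.log (2 * d) + lam + b)))
      = ∫⁻ w in {w : WalkSpace d | w 0 = e}, ENNReal.ofReal (Real.exp (-lam - b))
          ∂walkMeasure d := by
        rw [setLIntegral_const, walkMeasure_step, ← ENNReal.ofReal_mul (Real.exp_pos _).le]
        congr 1
        rw [show -(Real.log (2 * d) + lam + b) = (-lam - b) - Real.log (2 * d) by ring,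
          Real.exp_sub, Real.exp_log hd]
        ring
    _ ≤ ∫⁻ w in {w : WalkSpace d | w 0 = e}, hitDiscount lam c {unitStep e} T w
          ∂walkMeasure d := by
        refine setLIntegral_mono' hms fun w hw => ?_
        have h1 : hittingTime {unitStep e} w = (1 : ℕ) := by
          refine hittingTime_eq_coe_iff.2 ⟨?_, fun m hm => ?_⟩
          · rw [show (1 : ℕ) = 0 + 1 from rfl, walk_succ, walk_zero, zero_add, hw]; rfl
          · rw [Nat.lt_one_iff.1 hm, walk_zero]
            exact fun h => unitStep_ne_zero e h.symm
        rw [hitDiscount_of_eq h1, hitTerm_of_eq h1 (by simpa using hT)]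
        refine ENNReal.ofReal_le_ofReal (Real.exp_le_exp.2 ?_)
        have := hb w hw
        push_cast
        linarith
    _ ≤ _ := setLIntegral_le_lintegral _ _

/-- Scaling down `λ` by `t ≤ 1` lowers the exponential cost by at most this factor, by Jensen's
inequality for `s ↦ s ^ t`. -/
lemma hitWeight_mul_le_rpow {t : ℝ} (ht0 : 0 < t) (ht : t < 1) (hc : IsPathPotential c) :
    hitWeight (t * lam) c A T ≤ hitWeight lam c A T ^ t := by
  have h1 : ∀ w, hitDiscount (t * lam) c A T w ≤ hitDiscount lam c A T w ^ t := by
    intro w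
    refine hitDiscount_le fun n hn hnT => ?_
    rw [hitDiscount_of_eq hn, hitTerm_of_eq hn hnT,
      ENNReal.ofReal_rpow_of_pos (Real.exp_pos _), ← Real.exp_mul]
    refine ENNReal.ofReal_le_ofReal (Real.exp_le_exp.2 ?_)
    have := hc.nonneg w n
    nlinarith
  refine (lintegral_mono h1).trans ?_
  have hpq : (1 / t).HolderConjugate (1 / (1 - t)) := by
    rw [Real.holderConjugate_iff]
    refine ⟨by rw [lt_div_iff₀ ht0]; linarith, ?_⟩
    rw [one_div, one_div, inv_inv, inv_inv]; ring
  have h2 := ENNReal.lintegral_mul_le_Lp_mul_Lq (walkMeasure d) hpq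
    ((measurable_hitDiscount (lam := lam) (A := A) (T := T) hc).pow_const t).aemeasurable
    (g := fun _ => 1) aemeasurable_const
  simp only [Pi.mul_apply, mul_one, ENNReal.one_rpow, lintegral_const, measure_univ,
    ← ENNReal.rpow_mul, one_div, mul_inv_cancel₀ ht0.ne', ENNReal.rpow_one, inv_inv] at h2
  exact h2

end Walk

/-! ### Point-to-point costs -/

section Cost

variable {d : ℕ} [NeZero d] {lam : ℝ} {c c' c'' : WalkSpace d → ℕ → ℝ} {S T : ℕ∞}

/-- The cost `-log E[exp (-λ H - c(H)); H ≤ T, H < ∞]` of hitting `x` before the horizon `T`. -/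
def hitCost (lam : ℝ) (c : WalkSpace d → ℕ → ℝ) (x : Site d) (T : ℕ∞) : ℝ :=
  -Real.log (hitWeight lam c {x} T).toReal

lemma hitCost_nonneg (hlam : 0 ≤ lam) (hc : IsPathPotential c) (x : Site d) :
    0 ≤ hitCost lam c x T := by
  rw [hitCost, Left.nonneg_neg_iff]
  refine Real.log_nonpos ENNReal.toReal_nonneg ?_
  exact ENNReal.toReal_le_of_le_ofReal zero_le_one (by simpa using hitWeight_le_one hlam hc)

lemma hitWeight_toReal_pos (hlam : 0 ≤ lam) (hc : IsPathPotential c) {x : Site d}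
    (h : hitWeight lam c {x} T ≠ 0) : 0 < (hitWeight lam c {x} T).toReal :=
  ENNReal.toReal_pos h (hitWeight_ne_top hlam hc)

lemma ofReal_exp_neg_hitCost (hlam : 0 ≤ lam) (hc : IsPathPotential c) {x : Site d}
    (h : hitWeight lam c {x} T ≠ 0) :
    ENNReal.ofReal (Real.exp (-hitCost lam c x T)) = hitWeight lam c {x} T := by
  rw [hitCost, neg_neg, Real.exp_log (hitWeight_toReal_pos hlam hc h),
    ENNReal.ofReal_toReal (hitWeight_ne_top hlam hc)]

lemma hitCost_le_of_le {x : Site d} {b : ℝ} (hlam : 0 ≤ lam) (hc : IsPathPotential c)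
    (h : ENNReal.ofReal (Real.exp (-b)) ≤ hitWeight lam c {x} T) : hitCost lam c x T ≤ b := by
  have h1 := (ENNReal.ofReal_le_iff_le_toReal (hitWeight_ne_top hlam hc)).1 h
  have h2 := Real.log_le_log (Real.exp_pos _) h1
  rw [Real.log_exp] at h2
  rw [hitCost]; linarith

lemma le_hitCost_of_le {x : Site d} {b : ℝ} (hlam : 0 ≤ lam) (hc : IsPathPotential c)
    (h0 : hitWeight lam c {x} T ≠ 0)
    (h : hitWeight lam c {x} T ≤ ENNReal.ofReal (Real.exp (-b))) : b ≤ hitCost lam c x T := by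
  have h1 := ENNReal.toReal_le_of_le_ofReal (Real.exp_pos _).le h
  have h2 := Real.log_le_log (hitWeight_toReal_pos hlam hc h0) h1
  rw [Real.log_exp] at h2
  rw [hitCost]; linarith

lemma hitCost_add_le (hlam : 0 ≤ lam)
    (hc : IsPathPotential c) (hc' : IsPathPotential c') (hc'' : IsPathPotential c'') {x y : Site d}
    (h : ∀ w n m, walk w n = x → c'' w (n + m) ≤ c w n + c' (shiftWalk n w) m)
    (h0 : hitWeight lam c {x} S ≠ 0) (h0' : hitWeight lam c' {y} T ≠ 0) :
    hitCost lam c'' (x + y) (S + T) ≤ hitCost lam c x S + hitCost lam c' y T := by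
  refine hitCost_le_of_le hlam hc'' ?_
  rw [neg_add, Real.exp_add, ENNReal.ofReal_mul (Real.exp_pos _).le,
    ofReal_exp_neg_hitCost hlam hc h0, ofReal_exp_neg_hitCost hlam hc' h0']
  exact hitWeight_mul_le hlam hc hc' hc'' h

lemma hitCost_mono {lam' : ℝ} (hlam : 0 ≤ lam) (hl : lam ≤ lam') (hc : IsPathPotential c)
    (hc' : IsPathPotential c') (h : ∀ w n, c w n ≤ c' w n) {x : Site d}
    (h0 : hitWeight lam' c' {x} T ≠ 0) : hitCost lam c x T ≤ hitCost lam' c' x T := by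
  refine hitCost_le_of_le hlam hc ?_
  rw [ofReal_exp_neg_hitCost (hlam.trans hl) hc' h0]
  exact hitWeight_anti hl le_rfl h

/-- The cost divided by `λ` decreases in `λ`. -/
lemma mul_hitCost_le {t : ℝ} (ht0 : 0 < t) (ht : t < 1) (hlam : 0 ≤ lam) (hc : IsPathPotential c)
    {x : Site d} (h0 : hitWeight lam c {x} T ≠ 0) (h0' : hitWeight (t * lam) c {x} T ≠ 0) :
    t * hitCost lam c x T ≤ hitCost (t * lam) c x T := by
  refine le_hitCost_of_le (by positivity) hc h0' ?_
  refine (hitWeight_mul_le_rpow ht0 ht hc).trans_eq ?_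
  rw [← ofReal_exp_neg_hitCost hlam hc h0, ENNReal.ofReal_rpow_of_pos (Real.exp_pos _),
    ← Real.exp_mul]
  congr 2; ring

/-- The weight of a set is at least that of each of its points, as the set is hit no later. -/
lemma exp_neg_hitCost_le (hlam : 0 ≤ lam) (hc : IsPathPotential c)
    (h0 : ∀ y, hitWeight lam c {y} ⊤ ≠ 0) {A : Set (Site d)} {y : Site d} (hy : y ∈ A) :
    Real.exp (-hitCost lam c y ⊤) ≤ hittingWeight lam c A := by
  rw [hittingWeight_eq hc]
  refine (ENNReal.ofReal_le_iff_le_toReal (hitWeight_ne_top hlam hc)).1 ?_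
  rw [ofReal_exp_neg_hitCost hlam hc (h0 y)]
  exact hitWeight_le_of_mem hlam hc hy

/-- The weight of a set is at most the sum of the weights of its points: the set is hit in one of
them, at the hitting time of this point. -/
lemma ofReal_hittingWeight_le (hlam : 0 ≤ lam) (hc : IsPathPotential c)
    (h0 : ∀ y, hitWeight lam c {y} ⊤ ≠ 0) (A : Set (Site d)) :
    ENNReal.ofReal (hittingWeight lam c A) ≤
      ∑' y : A, ENNReal.ofReal (Real.exp (-hitCost lam c y ⊤)) := by
  rw [hittingWeight_eq hc, ENNReal.ofReal_toReal (hitWeight_ne_top hlam hc)]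
  simp_rw [ofReal_exp_neg_hitCost hlam hc (h0 _)]
  exact hitWeight_le_tsum hc

lemma hitWeight_ne_zero_of_le {x : Site d} {b : ℝ}
    (h : ENNReal.ofReal (Real.exp (-b)) ≤ hitWeight lam c {x} T) :
    hitWeight lam c {x} T ≠ 0 :=
  ((ENNReal.ofReal_pos.2 (Real.exp_pos _)).trans_le h).ne'

end Cost

/-! ### The annealed case -/

section Annealed

variable {d : ℕ} {φ : ℝ → ℝ}

namespace IsAnnealedPotential

lemma div_mul_le (hφ : IsAnnealedPotential φ) {r s : ℝ} (hr : 0 ≤ r) (hrs : r ≤ s) (hs : 0 < s) :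
    r / s * φ s ≤ φ r := by
  have h1 : 0 ≤ 1 - r / s := by rw [sub_nonneg, div_le_one hs]; exact hrs
  have h2 := hφ.concave.right (Set.mem_Ici.2 hs.le) (Set.mem_Ici.2 (le_refl (0 : ℝ)))
    (div_nonneg hr hs.le) h1 (by ring)
  simp only [smul_eq_mul, mul_zero, add_zero, hφ.map_zero] at h2
  rwa [div_mul_cancel₀ _ hs.ne'] at h2

lemma apply_one_pos (hφ : IsAnnealedPotential φ) : 0 < φ 1 := by
  refine (hφ.nonneg 1 zero_le_one).lt_of_ne' fun h1 => ?_
  have h0 : ∀ t, 0 ≤ t → φ t = 0 := by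
    intro t ht
    refine le_antisymm ?_ (hφ.nonneg t ht)
    rcases le_total t 1 with h | h
    · exact (hφ.monotone (Set.mem_Ici.2 ht) (Set.mem_Ici.2 zero_le_one) h).trans_eq h1
    · have h2 := hφ.div_mul_le zero_le_one h (by linarith)
      by_contra hneg
      have : 0 < 1 / t * φ t := mul_pos (by positivity) (not_le.1 hneg)
      linarith
  obtain ⟨s, t, hs, ht, hne⟩ := hφ.nonconstant
  exact hne (by rw [h0 s hs, h0 t ht])

lemma add_le (hφ : IsAnnealedPotential φ) {s t : ℝ} (hs : 0 ≤ s) (ht : 0 ≤ t) :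
    φ (s + t) ≤ φ s + φ t := by
  rcases (add_nonneg hs ht).eq_or_lt with h | h
  · have h1 : s = 0 := by linarith
    have h2 : t = 0 := by linarith
    simp [h1, h2, hφ.map_zero]
  · have h1 := hφ.div_mul_le hs (le_add_of_nonneg_right ht) h
    have h2 := hφ.div_mul_le ht (le_add_of_nonneg_left hs) h
    have h3 : s / (s + t) * φ (s + t) + t / (s + t) * φ (s + t) = φ (s + t) := by
      field_simp
    linarith

end IsAnnealedPotential

lemma visits_eq_zero {w : WalkSpace d} {x : Site d} {n : ℕ}
    (h : x ∉ (Finset.Icc 1 n).image (walk w)) : visits w x n = 0 := by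
  rw [visits, Finset.card_eq_zero, Finset.filter_eq_empty_iff]
  exact fun m hm hmx => h (Finset.mem_image.2 ⟨m, hm, hmx⟩)

lemma one_le_visits {w : WalkSpace d} {x : Site d} {n : ℕ}
    (h : x ∈ (Finset.Icc 1 n).image (walk w)) : 1 ≤ visits w x n := by
  obtain ⟨m, hm, hmx⟩ := Finset.mem_image.1 h
  exact Finset.card_pos.2 ⟨m, Finset.mem_filter.2 ⟨hm, hmx⟩⟩

lemma visits_mono (w : WalkSpace d) (x : Site d) : Monotone (visits w x) := fun _ _ h =>
  Finset.card_le_card (Finset.filter_subset_filter _ (Finset.Icc_subset_Icc le_rfl h))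

lemma visits_congr {w w' : WalkSpace d} {n : ℕ} (h : ∀ k < n, w k = w' k) (x : Site d) :
    visits w x n = visits w' x n := by
  refine congrArg Finset.card (Finset.filter_congr fun m hm => ?_)
  rw [walk_congr h (Finset.mem_Icc.1 hm).2]

lemma visits_add (w : WalkSpace d) (x : Site d) (n m : ℕ) :
    visits w x (n + m) = visits w x n + visits (shiftWalk n w) (x - walk w n) m := by
  have h1 : ∀ w : WalkSpace d, ∀ x n,
      visits w x n = ∑ m ∈ Finset.Ico 1 (n + 1), if walk w m = x then 1 else 0 := by
    intro w x n
    rw [visits, Finset.card_filter]; rfl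
  rw [h1, h1, h1, ← Finset.sum_Ico_consecutive _ (show 1 ≤ n + 1 by omega)
    (show n + 1 ≤ n + m + 1 by omega)]
  congr 1
  rw [show n + 1 = 1 + n by omega, show n + m + 1 = (m + 1) + n by omega,
    ← Finset.sum_Ico_add']
  refine Finset.sum_congr rfl fun k _ => ?_
  simp only [add_comm k n, walk_add, eq_sub_iff_add_eq']

lemma annealedPathPotential_eq_sum (hφ : IsAnnealedPotential φ) (w : WalkSpace d) (n : ℕ)
    {s : Finset (Site d)} (hs : (Finset.Icc 1 n).image (walk w) ⊆ s) :
    annealedPathPotential φ w n = ∑ x ∈ s, φ (visits w x n) :=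
  tsum_eq_sum fun x hx => by
    rw [visits_eq_zero fun h => hx (hs h), Nat.cast_zero, hφ.map_zero]

lemma isPathPotential_annealed (hφ : IsAnnealedPotential φ) :
    IsPathPotential (annealedPathPotential (d := d) φ) where
  zero w := by
    rw [annealedPathPotential_eq_sum hφ w 0 (s := ∅) (by simp)]; simp
  mono w := by
    intro n m hnm
    have h := Finset.image_subset_image (f := walk w)
      (Finset.Icc_subset_Icc (le_refl 1) hnm)
    rw [annealedPathPotential_eq_sum hφ w n h, annealedPathPotential_eq_sum hφ w m subset_rfl]
    refine Finset.sum_le_sum fun x _ => hφ.monotone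
      (Set.mem_Ici.2 (Nat.cast_nonneg _)) (Set.mem_Ici.2 (Nat.cast_nonneg _)) ?_
    exact Nat.cast_le.2 (visits_mono w x hnm)
  adapted n := fun w w' h => by
    simp only [annealedPathPotential, visits_congr h]

lemma annealedPathPotential_add_le (hφ : IsAnnealedPotential φ) (w : WalkSpace d) (n m : ℕ) :
    annealedPathPotential φ w (n + m) ≤
      annealedPathPotential φ w n + annealedPathPotential φ (shiftWalk n w) m := by
  have h3 : annealedPathPotential φ (shiftWalk n w) m =
      ∑' x : Site d, φ (visits (shiftWalk n w) (x - walk w n) m) :=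
    ((Equiv.subRight (walk w n)).tsum_eq fun x => φ (visits (shiftWalk n w) x m)).symm
  have h4 : annealedPathPotential φ (shiftWalk n w) m =
      ∑ x ∈ (Finset.Icc 1 (n + m)).image (walk w),
        φ (visits (shiftWalk n w) (x - walk w n) m) := by
    rw [h3]
    refine tsum_eq_sum fun x hx => ?_
    have h5 := visits_eq_zero hx
    rw [visits_add] at h5
    rw [show visits (shiftWalk n w) (x - walk w n) m = 0 by omega, Nat.cast_zero, hφ.map_zero]
  rw [annealedPathPotential_eq_sum hφ w n (Finset.image_subset_image
    (Finset.Icc_subset_Icc le_rfl (Nat.le_add_right n m))), h4,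
    annealedPathPotential_eq_sum hφ w (n + m) subset_rfl, ← Finset.sum_add_distrib]
  refine Finset.sum_le_sum fun x _ => ?_
  rw [visits_add, Nat.cast_add]
  exact hφ.add_le (Nat.cast_nonneg _) (Nat.cast_nonneg _)

lemma mul_norm_le_annealedPathPotential (hφ : IsAnnealedPotential φ) (w : WalkSpace d) (n : ℕ) :
    φ 1 * ‖walk w n‖ ≤ annealedPathPotential φ w n := by
  rw [annealedPathPotential_eq_sum hφ w n subset_rfl]
  calc φ 1 * ‖walk w n‖ ≤ φ 1 * ((Finset.Icc 1 n).image (walk w)).card := by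
        have := hφ.apply_one_pos
        gcongr; exact norm_walk_le_card w n
    _ = ∑ x ∈ (Finset.Icc 1 n).image (walk w), φ 1 := by
        rw [Finset.sum_const, nsmul_eq_mul, mul_comm]
    _ ≤ _ := by
        refine Finset.sum_le_sum fun x hx => hφ.monotone
          (Set.mem_Ici.2 zero_le_one) (Set.mem_Ici.2 (Nat.cast_nonneg _)) ?_
        exact_mod_cast one_le_visits hx

lemma annealedPathPotential_one (hφ : IsAnnealedPotential φ) (w : WalkSpace d) :
    annealedPathPotential φ w 1 = φ 1 := by
  rw [annealedPathPotential_eq_sum hφ w 1 (s := {walk w 1}) (by simp)]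
  simp [visits, Finset.filter_singleton]

variable [NeZero d] {lam : ℝ}

lemma annealedTwoPoint_eq (hφ : IsAnnealedPotential φ) (x : Site d) :
    annealedTwoPoint lam φ x = hitCost lam (annealedPathPotential φ) x ⊤ := by
  rw [annealedTwoPoint, hittingWeight_eq (isPathPotential_annealed hφ), hitCost]

lemma exists_le_annealed_hitWeight (hφ : IsAnnealedPotential φ) (hlam : 0 ≤ lam) (x : Site d) :
    ∃ n : ℕ, ENNReal.ofReal (Real.exp (-(n * (Real.log (2 * d) + lam + φ 1)))) ≤
      hitWeight lam (annealedPathPotential φ) {x} ⊤ ∧ (n : ℝ) ≤ d * ‖x‖ := by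
  have hc := isPathPotential_annealed (d := d) hφ
  refine site_induction (p := fun x n =>
    ENNReal.ofReal (Real.exp (-((n : ℕ) * (Real.log (2 * d) + lam + φ 1)))) ≤
      hitWeight lam (annealedPathPotential φ) {x} ⊤) ?_ ?_ x
  · rw [hitWeight_zero hc]; simp
  · intro x n e h
    have h1 := hitWeight_mul_le (S := ⊤) (T := ⊤) hlam hc hc hc (x := x) (y := unitStep e)
      fun w n m _ => annealedPathPotential_add_le hφ w n m
    rw [top_add] at h1
    refine le_trans ?_ h1
    refine le_trans ?_ (mul_le_mul' h (le_hitWeight_unitStep le_top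
      fun w _ => (annealedPathPotential_one hφ w).le))
    rw [← ENNReal.ofReal_mul (Real.exp_pos _).le, ← Real.exp_add]
    refine (congrArg _ (congrArg _ ?_)).le
    push_cast; ring

lemma annealed_hitWeight_ne_zero (hφ : IsAnnealedPotential φ) (hlam : 0 ≤ lam) (x : Site d) :
    hitWeight lam (annealedPathPotential φ) {x} ⊤ ≠ 0 := by
  obtain ⟨n, hn, -⟩ := exists_le_annealed_hitWeight hφ hlam x
  exact hitWeight_ne_zero_of_le hn

lemma log_two_mul_nonneg : 0 ≤ Real.log (2 * d) := by
  refine Real.log_nonneg ?_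
  have : (1 : ℝ) ≤ d := by exact_mod_cast Nat.one_le_iff_ne_zero.2 (NeZero.ne d)
  linarith

/-- The annealed two-point function is subadditive, since the walk after hitting `x` may be treated
as if it saw fresh sites (`φ` is subadditive), and it is at least `φ 1` times the number of sites
visited. -/
lemma isSubadditiveCost_annealed (hφ : IsAnnealedPotential φ) (hlam : 0 ≤ lam) :
    IsSubadditiveCost (annealedTwoPoint (d := d) lam φ) (φ 1)
      (d * (Real.log (2 * d) + lam + φ 1)) := by
  have hc := isPathPotential_annealed (d := d) hφ
  have h0 := annealed_hitWeight_ne_zero (d := d) hφ hlam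
  refine ⟨hφ.apply_one_pos, fun x y => ?_, fun x => ?_, fun x => ?_⟩
  · rw [annealedTwoPoint_eq hφ, annealedTwoPoint_eq hφ, annealedTwoPoint_eq hφ]
    have := hitCost_add_le (S := ⊤) (T := ⊤) hlam hc hc hc (x := x) (y := y)
      (fun w n m _ => annealedPathPotential_add_le hφ w n m) (h0 x) (h0 y)
    rwa [top_add] at this
  · rw [annealedTwoPoint_eq hφ]
    refine le_hitCost_of_le hlam hc (h0 x) ?_
    refine (lintegral_mono (g := fun _ => ENNReal.ofReal (Real.exp (-(φ 1 * ‖x‖))))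
      fun w => hitDiscount_le fun n hn _ => ?_).trans (by simp)
    refine ENNReal.ofReal_le_ofReal (Real.exp_le_exp.2 ?_)
    have h1 := mul_norm_le_annealedPathPotential hφ w n
    rw [(hittingTime_eq_coe_iff.1 hn).1] at h1
    have h2 : 0 ≤ lam * n := by positivity
    linarith
  · rw [annealedTwoPoint_eq hφ]
    obtain ⟨n, hn, hnx⟩ := exists_le_annealed_hitWeight hφ hlam x
    refine (hitCost_le_of_le hlam hc hn).trans ?_
    have h1 := hφ.apply_one_pos
    have h2 := log_two_mul_nonneg (d := d)
    calc n * (Real.log (2 * d) + lam + φ 1) ≤ (d * ‖x‖) * (Real.log (2 * d) + lam + φ 1) := by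
          gcongr
      _ = _ := by ring

/-- The annealed limit: the costs are themselves the subadditive function, so that the bounds on
costs hold at every site. -/
theorem tendsto_annealed (hφ : IsAnnealedPotential φ) (hlam : 0 ≤ lam) {l : Fin d → ℝ}
    (hl : l ≠ 0) :
    Tendsto (fun u : ℝ => 1 / u * Real.log
        (hittingWeight lam (annealedPathPotential φ) (halfSpace l u))) atTop
      (𝓝 (-(1 / dualNorm (annealedLyapunov φ lam) l))) := by
  have hc := isPathPotential_annealed (d := d) hφ
  have h0 := annealed_hitWeight_ne_zero (d := d) hφ hlam
  have h := isSubadditiveCost_annealed (d := d) hφ hlam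
  refine tendsto_log_halfSpace h hl
    (A := fun y => hitCost lam (annealedPathPotential φ) y ⊤)
    (fun u y hy => exp_neg_hitCost_le hlam hc h0 hy)
    (fun u => ofReal_hittingWeight_le hlam hc h0 _) (fun x ε hε => ?_) fun ε hε => ?_
  · refine ⟨1, one_pos, ?_⟩
    filter_upwards [(h.tendsto_apply_nsmul x).eventually (eventually_lt_nhds
      (lt_add_of_pos_right _ hε)), eventually_gt_atTop 0] with q hq hq0
    have hq0' : (0 : ℝ) < q := by exact_mod_cast hq0
    rw [div_lt_iff₀ hq0', annealedTwoPoint_eq hφ] at hq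
    rw [one_smul, Nat.cast_one, one_mul]
    linarith
  · refine Eventually.of_forall fun y => ?_
    have h1 := h.lyapunov_toReal_le y
    rw [annealedTwoPoint_eq hφ] at h1
    have h2 := mul_nonneg hε.le (h.lyapunov_nonneg (toReal y))
    linarith

end Annealed

/-! ### Environments -/

section Env

variable {d : ℕ}

/-- A realization of a nonnegative potential on the lattice. -/
abbrev Env (d : ℕ) := Site d → ℝ≥0

/-- The law of a potential with independent values of law `ν`. -/
def envMeasure (d : ℕ) (ν : Measure ℝ≥0) : Measure (Env d) :=
  Measure.infinitePi fun _ : Site d => ν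

instance (ν : Measure ℝ≥0) [IsProbabilityMeasure ν] : IsProbabilityMeasure (envMeasure d ν) := by
  unfold envMeasure; infer_instance

/-- The environment seen from the site `x`. -/
def shiftEnv (x : Site d) (v : Env d) : Env d := fun z => v (x + z)

lemma shiftEnv_zero (v : Env d) : shiftEnv 0 v = v := by
  ext1 z; simp [shiftEnv]

lemma shiftEnv_shiftEnv (x y : Site d) (v : Env d) :
    shiftEnv y (shiftEnv x v) = shiftEnv (x + y) v := by
  ext1 z; simp [shiftEnv, add_assoc]

lemma measurable_shiftEnv (x : Site d) : Measurable (shiftEnv x) :=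
  measurable_pi_lambda _ fun _ => measurable_pi_apply _

lemma measurePreserving_shiftEnv (ν : Measure ℝ≥0) [IsProbabilityMeasure ν] (x : Site d) :
    MeasurePreserving (shiftEnv x) (envMeasure d ν) (envMeasure d ν) :=
  ⟨measurable_shiftEnv x, Measure.map_infinitePi_infinitePi_of_inj (add_right_injective x)⟩

/-- The path potential `∑_{1 ≤ m ≤ n} v(S(m))` of an environment. -/
def envPotential (v : Env d) : WalkSpace d → ℕ → ℝ :=
  quenchedPathPotential fun z => (v z : ℝ)

lemma isPathPotential_env (v : Env d) : IsPathPotential (envPotential v) where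
  zero w := by simp [envPotential, quenchedPathPotential]
  mono w := by
    intro n m h
    exact Finset.sum_le_sum_of_subset_of_nonneg (Finset.Icc_subset_Icc le_rfl h)
      fun z _ _ => NNReal.coe_nonneg _
  adapted n := fun w w' h => by
    unfold envPotential quenchedPathPotential
    refine Finset.sum_congr rfl fun m hm => ?_
    rw [walk_congr h (Finset.mem_Icc.1 hm).2]

lemma envPotential_add (v : Env d) (w : WalkSpace d) (n m : ℕ) :
    envPotential v w (n + m) =
      envPotential v w n + envPotential (shiftEnv (walk w n) v) (shiftWalk n w) m := by
  have h1 : ∀ (v : Env d) (w : WalkSpace d) n,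
      envPotential v w n = ∑ m ∈ Finset.Ico 1 (n + 1), (v (walk w m) : ℝ) := by
    intro v w n; rfl
  rw [h1, h1, h1, ← Finset.sum_Ico_consecutive _ (show 1 ≤ n + 1 by omega)
    (show n + 1 ≤ n + m + 1 by omega)]
  congr 1
  rw [show n + 1 = 1 + n by omega, show n + m + 1 = (m + 1) + n by omega,
    ← Finset.sum_Ico_add']
  refine Finset.sum_congr rfl fun k _ => ?_
  rw [add_comm k n, walk_add, shiftEnv]

lemma envPotential_mono {v v' : Env d} (h : ∀ z, v z ≤ v' z) (w : WalkSpace d) (n : ℕ) :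
    envPotential v w n ≤ envPotential v' w n :=
  Finset.sum_le_sum (s := Finset.Icc 1 n) fun m _ => NNReal.coe_le_coe.2 (h (walk w m))

lemma norm_walk_le (w : WalkSpace d) (n : ℕ) : ‖walk w n‖ ≤ n := by
  refine (norm_walk_le_card w n).trans ?_
  exact_mod_cast Finset.card_image_le.trans_eq (by simp)

lemma envPotential_congr {v v' : Env d} {n : ℕ} (h : ∀ z : Site d, ‖z‖ ≤ n → v z = v' z)
    (w : WalkSpace d) : envPotential v w n = envPotential v' w n := by
  unfold envPotential quenchedPathPotential
  refine Finset.sum_congr rfl fun m hm => ?_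
  refine congrArg NNReal.toReal (h _ ?_)
  exact (norm_walk_le w m).trans (Nat.cast_le.2 (Finset.mem_Icc.1 hm).2)

lemma measurable_walk [NeZero d] (n : ℕ) : Measurable fun w : WalkSpace d => walk w n :=
  DependsOnSteps.measurable (n := n) fun _ _ h => walk_congr h le_rfl

lemma envPotential_one {v : Env d} {w : WalkSpace d} {e : Fin d × Bool} (h : w 0 = e) :
    envPotential v w 1 = v (unitStep e) := by
  simp [envPotential, quenchedPathPotential, walk, h]

lemma integrable_apply {ν : Measure ℝ≥0} [IsProbabilityMeasure ν]
    (hν : Integrable (fun t : ℝ≥0 => (t : ℝ)) ν) (z : Site d) :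
    Integrable (fun v : Env d => (v z : ℝ)) (envMeasure d ν) :=
  (measurePreserving_eval_infinitePi (fun _ : Site d => ν) z).integrable_comp_of_integrable hν

lemma integral_apply (ν : Measure ℝ≥0) [IsProbabilityMeasure ν] (z : Site d) :
    ∫ v : Env d, (v z : ℝ) ∂envMeasure d ν = ∫ t, (t : ℝ) ∂ν := by
  have h := measurePreserving_eval_infinitePi (fun _ : Site d => ν) z
  have h2 := integral_map (μ := envMeasure d ν) (φ := fun v : Env d => v z)
    h.measurable.aemeasurable (f := fun t : ℝ≥0 => (t : ℝ))
    measurable_coe_nnreal_real.aestronglyMeasurable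
  rw [← h2]
  exact congrArg (fun m => ∫ t : ℝ≥0, (t : ℝ) ∂m) h.map_eq

lemma integrable_list_sum {ν : Measure ℝ≥0} [IsProbabilityMeasure ν]
    (hν : Integrable (fun t : ℝ≥0 => (t : ℝ)) ν) (L : List (Site d)) :
    Integrable (fun v : Env d => (L.map fun z => (v z : ℝ)).sum) (envMeasure d ν) ∧
      ∫ v : Env d, (L.map fun z => (v z : ℝ)).sum ∂envMeasure d ν =
        L.length * ∫ t, (t : ℝ) ∂ν := by
  induction L with
  | nil => simp
  | cons z L ih =>
    simp only [List.map_cons, List.sum_cons]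
    refine ⟨(integrable_apply hν z).add ih.1, ?_⟩
    rw [integral_add (integrable_apply hν z) ih.1, ih.2, integral_apply]
    push_cast [List.length_cons]; ring

variable [NeZero d]

lemma measurable_env_walk (n : ℕ) :
    Measurable fun p : Env d × WalkSpace d => p.1 (walk p.2 n) := by
  have h1 : Measurable fun p : Env d × Site d => p.1 p.2 :=
    measurable_from_prod_countable_left fun z => measurable_pi_apply z
  exact h1.comp (measurable_fst.prodMk ((measurable_walk n).comp measurable_snd))

lemma measurable_envPotential (n : ℕ) :
    Measurable fun p : Env d × WalkSpace d => envPotential p.1 p.2 n := by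
  unfold envPotential quenchedPathPotential
  exact Finset.measurable_sum _ fun m _ => (measurable_env_walk m).coe_nnreal_real

lemma measurableSet_hittingTime_eq (A : Set (Site d)) (n : ℕ) :
    MeasurableSet {w : WalkSpace d | hittingTime A w = n} :=
  measurableSet_setOfPred.2 (dependsOnSteps_hittingTime_eq A n).measurable

lemma measurable_hitTerm_env (lam : ℝ) (A : Set (Site d)) (T : ℕ∞) (n : ℕ) :
    Measurable fun p : Env d × WalkSpace d => hitTerm lam (envPotential p.1) A T n p.2 := by
  unfold hitTerm
  refine Measurable.ite ?_ ?_ measurable_const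
  · exact ((measurableSet_hittingTime_eq A n).preimage measurable_snd).inter (.const _)
  · exact ((measurable_const.sub (measurable_envPotential n)).exp).ennreal_ofReal

lemma measurable_hitDiscount_env (lam : ℝ) (A : Set (Site d)) (T : ℕ∞) :
    Measurable fun p : Env d × WalkSpace d => hitDiscount lam (envPotential p.1) A T p.2 :=
  Measurable.tsum fun n => measurable_hitTerm_env lam A T n

/-! ### Quenched weights and costs -/

/-- The quenched weight of the hitting time of `x`, with horizon `T`. -/
def envWeight (lam : ℝ) (v : Env d) (x : Site d) (T : ℕ∞) : ℝ≥0∞ :=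
  hitWeight lam (envPotential v) {x} T

/-- The quenched cost of hitting `x` before the horizon `T`. -/
def envCost (lam : ℝ) (v : Env d) (x : Site d) (T : ℕ∞) : ℝ :=
  hitCost lam (envPotential v) x T

lemma measurable_envWeight (lam : ℝ) (x : Site d) (T : ℕ∞) :
    Measurable fun v : Env d => envWeight lam v x T :=
  (measurable_hitDiscount_env lam {x} T).lintegral_prod_right'

lemma measurable_envCost (lam : ℝ) (x : Site d) (T : ℕ∞) :
    Measurable fun v : Env d => envCost lam v x T :=
  ((measurable_envWeight lam x T).ennreal_toReal.log).neg

lemma envWeight_congr {lam : ℝ} {v v' : Env d} {T : ℕ} (h : ∀ z : Site d, ‖z‖ ≤ T → v z = v' z)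
    (x : Site d) : envWeight lam v x T = envWeight lam v' x T := by
  refine lintegral_congr fun w => tsum_congr fun n => ?_
  unfold hitTerm
  split_ifs with hn
  · rw [envPotential_congr fun z hz => h z (hz.trans (Nat.cast_le.2 (Nat.cast_le.1 hn.2)))]
  · rfl

variable {lam : ℝ}

lemma envWeight_mul_le (hlam : 0 ≤ lam) (v : Env d) (x y : Site d) (S T : ℕ∞) :
    envWeight lam v x S * envWeight lam (shiftEnv x v) y T ≤ envWeight lam v (x + y) (S + T) := by
  refine hitWeight_mul_le hlam (isPathPotential_env v) (isPathPotential_env _)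
    (isPathPotential_env v) fun w n m h => ?_
  rw [envPotential_add, h]

/-- Walks along a fixed path to `x` of length `n ≤ d ‖x‖` bound the cost of hitting `x` by time
`n`. -/
lemma exists_path_bound (hlam : 0 ≤ lam) (x : Site d) : ∃ n : ℕ, (n : ℝ) ≤ d * ‖x‖ ∧
    ∃ L : List (Site d), L.length = n ∧ ∀ v : Env d,
      ENNReal.ofReal (Real.exp (-(n * (Real.log (2 * d) + lam) +
        (L.map fun z => (v z : ℝ)).sum))) ≤ envWeight lam v x n := by
  refine (site_induction (p := fun x n =>
    ∃ L : List (Site d), L.length = n ∧ ∀ v : Env d,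
      ENNReal.ofReal (Real.exp (-((n : ℕ) * (Real.log (2 * d) + lam) +
        (L.map fun z => (v z : ℝ)).sum))) ≤ envWeight lam v x n) ?_ ?_ x).imp
    fun n h => h.symm
  · refine ⟨[], rfl, fun v => ?_⟩
    rw [envWeight, hitWeight_zero (isPathPotential_env v)]; simp
  · rintro x n e ⟨L, hL, h⟩
    refine ⟨(x + unitStep e) :: L, by simp [hL], fun v => ?_⟩
    have h1 := envWeight_mul_le hlam v x (unitStep e) n 1
    rw [← Nat.cast_one, ← Nat.cast_add] at h1
    refine le_trans ?_ h1
    refine le_trans ?_ (mul_le_mul' (h v) (le_hitWeight_unitStep (e := e)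
      (b := (v (x + unitStep e) : ℝ)) (by simp) fun w hw => (envPotential_one hw).le))
    rw [← ENNReal.ofReal_mul (Real.exp_pos _).le, ← Real.exp_add]
    refine (congrArg _ (congrArg _ ?_)).le
    rw [List.map_cons, List.sum_cons]
    push_cast; ring

lemma envWeight_mono_time (v : Env d) (x : Site d) {S T : ℕ∞} (h : S ≤ T) :
    envWeight lam v x S ≤ envWeight lam v x T :=
  hitWeight_anti le_rfl h fun _ _ => le_rfl

/-- The site `x` can be reached within the time `T`, so that costs with horizon `T` are genuine
logarithms. -/
def Reachable (x : Site d) (T : ℕ∞) : Prop :=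
  ∀ (lam : ℝ) (v : Env d), 0 ≤ lam → envWeight lam v x T ≠ 0

lemma reachable_top (x : Site d) : Reachable x ⊤ := by
  intro lam v hlam
  obtain ⟨n, -, L, -, h⟩ := exists_path_bound hlam x
  exact hitWeight_ne_zero_of_le ((h v).trans (envWeight_mono_time v x le_top))

lemma envCost_nonneg (hlam : 0 ≤ lam) (v : Env d) (x : Site d) (T : ℕ∞) :
    0 ≤ envCost lam v x T :=
  hitCost_nonneg hlam (isPathPotential_env v) x

lemma envCost_add_le (hlam : 0 ≤ lam) (v : Env d) {x y : Site d} {T : ℕ∞}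
    (hy : Reachable y T) :
    envCost lam v (x + y) ⊤ ≤ envCost lam v x ⊤ + envCost lam (shiftEnv x v) y T := by
  have := hitCost_add_le (S := ⊤) (T := T) hlam (isPathPotential_env v)
    (isPathPotential_env (shiftEnv x v)) (isPathPotential_env v) (x := x) (y := y)
    (fun w n m h => by rw [envPotential_add, h]) (reachable_top x lam v hlam) (hy lam _ hlam)
  rwa [top_add] at this

lemma envCost_zero (v : Env d) (T : ℕ∞) : envCost lam v 0 T = 0 := by
  rw [envCost, hitCost, hitWeight_zero (isPathPotential_env v)]; simp

/-- Every site is reachable in finite time, at a cost bounded by the potential along a path. -/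
lemma exists_envCost_le (hlam : 0 ≤ lam) (x : Site d) : ∃ n : ℕ, (n : ℝ) ≤ d * ‖x‖ ∧
    ∃ L : List (Site d), L.length = n ∧ ∀ (T : ℕ∞), (n : ℕ∞) ≤ T → Reachable x T ∧
      ∀ v : Env d, envCost lam v x T ≤
        n * (Real.log (2 * d) + lam) + (L.map fun z => (v z : ℝ)).sum := by
  obtain ⟨n, hn, L, hL, h⟩ := exists_path_bound hlam x
  refine ⟨n, hn, L, hL, fun T hT => ⟨fun lam' v hlam' => ?_, fun v => ?_⟩⟩
  · -- weights for different `λ ≥ 0` vanish simultaneously up to the finite time `n`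
    have h1 := hitWeight_ne_zero_of_le (h v)
    intro h0
    have h2 : hitWeight lam' (envPotential v) {x} (n : ℕ∞) = 0 :=
      le_antisymm ((envWeight_mono_time v x hT).trans_eq h0) zero_le
    refine h1 ?_
    rw [hitWeight, lintegral_eq_zero_iff (measurable_hitDiscount (isPathPotential_env v))] at h2 ⊢
    filter_upwards [h2] with w hw
    simp only [hitDiscount, Pi.zero_apply, ENNReal.tsum_eq_zero] at hw ⊢
    intro k
    have := hw k
    unfold hitTerm at this ⊢
    split_ifs with hk
    · rw [if_pos hk, ENNReal.ofReal_eq_zero] at this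
      exact absurd this (not_le.2 (Real.exp_pos _))
    · rfl
  · exact hitCost_le_of_le hlam (isPathPotential_env v) ((h v).trans (envWeight_mono_time v x hT))

lemma integrable_envCost {ν : Measure ℝ≥0} [IsProbabilityMeasure ν]
    (hν : Integrable (fun t : ℝ≥0 => (t : ℝ)) ν) (hlam : 0 ≤ lam) (x : Site d) :
    Integrable (fun v => envCost lam v x ⊤) (envMeasure d ν) := by
  obtain ⟨n, -, L, -, h⟩ := exists_envCost_le hlam x
  refine ((integrable_const (n * (Real.log (2 * d) + lam))).add
    (integrable_list_sum hν L).1).mono'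
    (measurable_envCost lam x ⊤).aestronglyMeasurable (Eventually.of_forall fun v => ?_)
  rw [Real.norm_of_nonneg (envCost_nonneg hlam v x ⊤)]
  exact (h ⊤ le_top).2 v

/-- The mean quenched two-point function. -/
def meanCost (lam : ℝ) (ν : Measure ℝ≥0) (x : Site d) : ℝ :=
  ∫ v, envCost lam v x ⊤ ∂envMeasure d ν

lemma meanCost_add_le {ν : Measure ℝ≥0} [IsProbabilityMeasure ν]
    (hν : Integrable (fun t : ℝ≥0 => (t : ℝ)) ν) (hlam : 0 ≤ lam) (x y : Site d) :
    meanCost lam ν (x + y) ≤ meanCost lam ν x + meanCost lam ν y := by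
  have hm := measurePreserving_shiftEnv (d := d) ν x
  have h1 := integrable_envCost hν hlam x
  have h2 := integrable_envCost hν hlam y
  have h3 : Integrable (fun v => envCost lam (shiftEnv x v) y ⊤) (envMeasure d ν) :=
    hm.integrable_comp_of_integrable h2
  have h4 : meanCost lam ν y = ∫ v, envCost lam (shiftEnv x v) y ⊤ ∂envMeasure d ν := by
    rw [meanCost]
    conv_lhs => rw [← hm.map_eq]
    exact integral_map hm.measurable.aemeasurable
      (measurable_envCost lam y ⊤).aestronglyMeasurable
  rw [h4, meanCost, meanCost, ← integral_add h1 h3]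
  exact integral_mono (integrable_envCost hν hlam _) (h1.add h3)
    fun v => envCost_add_le hlam v (reachable_top y)

lemma meanCost_le {ν : Measure ℝ≥0} [IsProbabilityMeasure ν]
    (hν : Integrable (fun t : ℝ≥0 => (t : ℝ)) ν) (hlam : 0 ≤ lam) (x : Site d) :
    meanCost lam ν x ≤ d * (Real.log (2 * d) + lam + ∫ t, (t : ℝ) ∂ν) * ‖x‖ := by
  obtain ⟨n, hn, L, hL, h⟩ := exists_envCost_le hlam x
  have h1 := integrable_list_sum (d := d) hν L
  have h2 : meanCost lam ν x ≤ ∫ v : Env d, (n * (Real.log (2 * d) + lam) +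
      (L.map fun z => (v z : ℝ)).sum) ∂envMeasure d ν :=
    integral_mono (integrable_envCost hν hlam _) ((integrable_const _).add h1.1)
      (h ⊤ le_top).2
  rw [integral_add (integrable_const _) h1.1, h1.2, hL, integral_const] at h2
  simp only [probReal_univ, one_smul] at h2
  have h3 : 0 ≤ ∫ t, (t : ℝ) ∂ν := integral_nonneg fun t => t.2
  have h4 := log_two_mul_nonneg (d := d)
  calc _ ≤ _ := h2
    _ = n * (Real.log (2 * d) + lam + ∫ t, (t : ℝ) ∂ν) := by ring
    _ ≤ (d * ‖x‖) * (Real.log (2 * d) + lam + ∫ t, (t : ℝ) ∂ν) := by gcongr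
    _ = _ := by ring

/-- The mean quenched weight decays exponentially: a walk to `x` sees at least `‖x‖` independent
values of the potential. -/
lemma lintegral_envWeight_le (ν : Measure ℝ≥0) [IsProbabilityMeasure ν] (hlam : 0 ≤ lam)
    {ρ : ℝ≥0∞} (hρ : ρ = ∫⁻ t : ℝ≥0, ENNReal.ofReal (Real.exp (-(t : ℝ))) ∂ν) (hρ1 : ρ ≤ 1)
    (x : Site d) :
    ∫⁻ v, envWeight lam v x ⊤ ∂envMeasure d ν ≤ ρ ^ ‖x‖ := by
  have hswap : ∫⁻ v, envWeight lam v x ⊤ ∂envMeasure d ν =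
      ∫⁻ w, ∫⁻ v, hitDiscount lam (envPotential v) {x} ⊤ w ∂envMeasure d ν ∂walkMeasure d :=
    lintegral_lintegral_swap (measurable_hitDiscount_env lam {x} ⊤).aemeasurable
  rw [hswap]
  refine (lintegral_mono (g := fun _ => ρ ^ ‖x‖) fun w => ?_).trans (by simp)
  by_cases h : hittingTime {x} w = ⊤
  · simp [hitDiscount_eq_zero (Or.inl h)]
  obtain ⟨n, hn⟩ := ENat.ne_top_iff_exists.1 h
  have hx : walk w n = x := (hittingTime_eq_coe_iff.1 hn.symm).1
  set R := (Finset.Icc 1 n).image (walk w) with hR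
  have hind : iIndepFun (fun (z : Site d) (v : Env d) => ENNReal.ofReal (Real.exp (-(v z : ℝ))))
      (envMeasure d ν) :=
    iIndepFun_infinitePi (X := fun _ (t : ℝ≥0) => ENNReal.ofReal (Real.exp (-(t : ℝ))))
      (fun _ => by fun_prop)
  calc ∫⁻ v, hitDiscount lam (envPotential v) {x} ⊤ w ∂envMeasure d ν
      ≤ ∫⁻ v, ∏ z ∈ R, ENNReal.ofReal (Real.exp (-(v z : ℝ))) ∂envMeasure d ν := by
        refine lintegral_mono fun v => hitDiscount_le fun m hm _ => ?_
        obtain rfl : n = m := Nat.cast_injective (hn.trans hm)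
        rw [← ENNReal.ofReal_prod_of_nonneg fun _ _ => (Real.exp_pos _).le, ← Real.exp_sum]
        refine ENNReal.ofReal_le_ofReal (Real.exp_le_exp.2 ?_)
        have h1 : ∑ z ∈ R, (v z : ℝ) ≤ envPotential v w n := by
          rw [hR]
          exact Finset.sum_image_le_of_nonneg fun _ _ => NNReal.coe_nonneg _
        have h2 : 0 ≤ lam * n := by positivity
        rw [Finset.sum_neg_distrib]
        linarith
    _ = ρ ^ R.card := by
        have h1 := lintegral_prod_eq_prod_lintegral_of_indepFun R _ hind
          (fun z => by fun_prop)
        rw [h1]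
        refine Finset.prod_eq_pow_card fun z _ => ?_
        rw [hρ, ← (measurePreserving_eval_infinitePi (fun _ : Site d => ν) z).lintegral_comp
          (by fun_prop)]
        rfl
    _ ≤ ρ ^ ‖x‖ := by
        rw [← ENNReal.rpow_natCast]
        refine ENNReal.rpow_le_rpow_of_exponent_ge hρ1 ?_
        rw [← hx]
        exact norm_walk_le_card w n

/-- The exponential decay rate of the mean quenched weights. -/
lemma exists_mul_norm_le_meanCost {ν : Measure ℝ≥0} [IsProbabilityMeasure ν]
    (hν : Integrable (fun t : ℝ≥0 => (t : ℝ)) ν) (hpos : ν (Set.Ioi 0) ≠ 0) :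
    ∃ c : ℝ, 0 < c ∧ ∀ lam : ℝ, 0 ≤ lam → ∀ x : Site d, c * ‖x‖ ≤ meanCost lam ν x := by
  set r := ∫ t : ℝ≥0, Real.exp (-(t : ℝ)) ∂ν with hr
  have hle : ∀ t : ℝ≥0, Real.exp (-(t : ℝ)) ≤ 1 := fun t => Real.exp_le_one_iff.2 (by simp)
  have hi : Integrable (fun t : ℝ≥0 => Real.exp (-(t : ℝ))) ν :=
    (integrable_const (1 : ℝ)).mono' (by fun_prop) (Eventually.of_forall fun t => by
      rw [Real.norm_of_nonneg (Real.exp_pos _).le]; exact hle t)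
  have hr0 : 0 < r := integral_exp_pos hi
  have hr1 : r < 1 := by
    have h1 : 0 < ∫ t : ℝ≥0, (1 - Real.exp (-(t : ℝ))) ∂ν := by
      rw [integral_pos_iff_support_of_nonneg (fun t => sub_nonneg.2 (hle t))
        ((integrable_const _).sub hi)]
      refine (pos_iff_ne_zero.2 hpos).trans_le (measure_mono fun t ht => ?_)
      have : (0 : ℝ) < t := NNReal.coe_pos.2 ht
      simp only [Function.mem_support, ne_eq, sub_eq_zero]
      intro h
      have h2 := Real.exp_lt_exp.2 (neg_lt_zero.2 this)
      rw [Real.exp_zero] at h2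
      linarith
    rw [integral_sub (integrable_const _) hi, integral_const] at h1
    simp only [probReal_univ, one_smul] at h1
    linarith
  have hρ : ENNReal.ofReal r = ∫⁻ t : ℝ≥0, ENNReal.ofReal (Real.exp (-(t : ℝ))) ∂ν :=
    ofReal_integral_eq_lintegral_ofReal hi (Eventually.of_forall fun t => (Real.exp_pos _).le)
  refine ⟨-Real.log r, neg_pos.2 (Real.log_neg hr0 hr1), fun lam hlam x => ?_⟩
  have h1 := lintegral_envWeight_le ν hlam hρ (by simpa using hr1.le) x
  rw [ENNReal.ofReal_rpow_of_pos hr0] at h1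
  set s := r ^ ‖x‖ with hs
  have hs0 : 0 < s := Real.rpow_pos_of_pos hr0 _
  have h0 := integrable_envCost hν hlam x
  have hpv : ∀ v : Env d, (envWeight lam v x ⊤).toReal = Real.exp (-envCost lam v x ⊤) := fun v => by
    rw [envCost, hitCost, neg_neg, Real.exp_log]
    · rfl
    · exact hitWeight_toReal_pos hlam (isPathPotential_env v) (reachable_top x lam v hlam)
  have hfin : ∀ v : Env d, envWeight lam v x ⊤ < ⊤ := fun v =>
    (hitWeight_ne_top hlam (isPathPotential_env v)).lt_top
  have hi2 : Integrable (fun v : Env d => (envWeight lam v x ⊤).toReal) (envMeasure d ν) :=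
    integrable_toReal_of_lintegral_ne_top (measurable_envWeight lam x ⊤).aemeasurable
      (ne_top_of_le_ne_top ENNReal.ofReal_ne_top h1)
  have h2 : ∫ v, (envWeight lam v x ⊤).toReal ∂envMeasure d ν ≤ s := by
    rw [integral_toReal (measurable_envWeight lam x ⊤).aemeasurable
      (Eventually.of_forall hfin)]
    exact ENNReal.toReal_le_of_le_ofReal hs0.le h1
  -- integrate the linear lower bound of the exponential at the point where it equals `s`
  have h3 : ∫ v, (s * (1 - Real.log s) - s * envCost lam v x ⊤) ∂envMeasure d ν ≤ s := by
    refine le_trans (integral_mono ((integrable_const _).sub (h0.const_mul s)) hi2 fun v => ?_) h2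
    have h4 := Real.add_one_le_exp (-envCost lam v x ⊤ - Real.log s)
    rw [Real.exp_sub, Real.exp_log hs0, le_div_iff₀ hs0] at h4
    simp only [hpv]
    linarith
  rw [integral_sub (integrable_const _) (h0.const_mul s), integral_const, integral_const_mul] at h3
  simp only [probReal_univ, one_smul] at h3
  change _ - s * meanCost lam ν x ≤ s at h3
  have h5 : 0 ≤ s * (meanCost lam ν x + Real.log s) := by linarith
  have h6 := nonneg_of_mul_nonneg_right h5 hs0
  rw [hs, Real.log_rpow hr0] at h6
  linarith

lemma isSubadditiveCost_meanCost {ν : Measure ℝ≥0} [IsProbabilityMeasure ν]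
    (hν : Integrable (fun t : ℝ≥0 => (t : ℝ)) ν) (hpos : ν (Set.Ioi 0) ≠ 0) :
    ∃ c : ℝ, ∀ lam : ℝ, 0 ≤ lam → IsSubadditiveCost (meanCost (d := d) lam ν) c
      (d * (Real.log (2 * d) + lam + ∫ t, (t : ℝ) ∂ν)) := by
  obtain ⟨c, hc, h⟩ := exists_mul_norm_le_meanCost (d := d) hν hpos
  exact ⟨c, fun lam hlam => ⟨hc, meanCost_add_le hν hlam, h lam hlam, meanCost_le hν hlam⟩⟩

end Env

/-! ### Truncation of the potential -/

/-- Chebyshev's association inequality: oppositely ordered functions are negatively correlated. -/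
lemma lintegral_mul_mul_lintegral_le {α : Type*} [MeasurableSpace α] (P : Measure α) [SFinite P]
    {f g D : α → ℝ≥0∞} (hf : Measurable f) (hg : Measurable g) (hD : Measurable D)
    (h : ∀ a b, f a ≤ f b → g b ≤ g a) :
    (∫⁻ a, f a * g a * D a ∂P) * ∫⁻ a, D a ∂P ≤ (∫⁻ a, f a * D a ∂P) * ∫⁻ a, g a * D a ∂P := by
  have key : ∀ a b, f a * g a + f b * g b ≤ f a * g b + f b * g a := by
    have aux : ∀ a b, f a ≤ f b → f a * g a + f b * g b ≤ f a * g b + f b * g a := by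
      intro a b hab
      obtain ⟨r, hr⟩ := exists_add_of_le hab
      obtain ⟨s, hs⟩ := exists_add_of_le (h a b hab)
      rw [hr, hs]
      have h1 : f a * (g b + s) + (f a + r) * g b + r * s =
          f a * g b + (f a + r) * (g b + s) := by ring
      rw [← h1]
      exact le_self_add
    intro a b
    rcases le_total (f a) (f b) with hab | hab
    · exact aux a b hab
    · have := aux b a hab
      rw [add_comm] at this
      exact this.trans_eq (add_comm _ _)
  have hfD : Measurable fun a => f a * D a := hf.mul hD
  have hgD : Measurable fun a => g a * D a := hg.mul hD
  have hfgD : Measurable fun a => f a * g a * D a := (hf.mul hg).mul hD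
  -- integrate the pointwise inequality over two independent copies
  have h2 : 2 * ((∫⁻ a, f a * g a * D a ∂P) * ∫⁻ a, D a ∂P) ≤
      2 * ((∫⁻ a, f a * D a ∂P) * ∫⁻ a, g a * D a ∂P) := by
    calc 2 * ((∫⁻ a, f a * g a * D a ∂P) * ∫⁻ a, D a ∂P)
        = ∫⁻ p, (f p.1 * g p.1 * D p.1) * D p.2 ∂(P.prod P) +
            ∫⁻ p, D p.1 * (f p.2 * g p.2 * D p.2) ∂(P.prod P) := by
          rw [lintegral_prod_mul hfgD.aemeasurable hD.aemeasurable,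
            lintegral_prod_mul hD.aemeasurable hfgD.aemeasurable]
          ring
      _ = ∫⁻ p, (f p.1 * g p.1 + f p.2 * g p.2) * (D p.1 * D p.2) ∂(P.prod P) := by
          rw [← lintegral_add_left (by fun_prop)]
          refine lintegral_congr fun p => ?_
          ring
      _ ≤ ∫⁻ p, (f p.1 * g p.2 + f p.2 * g p.1) * (D p.1 * D p.2) ∂(P.prod P) := by
          exact lintegral_mono fun p => mul_le_mul' (key p.1 p.2) le_rfl
      _ = ∫⁻ p, (f p.1 * D p.1) * (g p.2 * D p.2) ∂(P.prod P) +
            ∫⁻ p, (g p.1 * D p.1) * (f p.2 * D p.2) ∂(P.prod P) := by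
          rw [← lintegral_add_left (by fun_prop)]
          refine lintegral_congr fun p => ?_
          ring
      _ = _ := by
          rw [lintegral_prod_mul hfD.aemeasurable hgD.aemeasurable,
            lintegral_prod_mul hgD.aemeasurable hfD.aemeasurable]
          ring
  exact (ENNReal.mul_le_mul_iff_right two_ne_zero ENNReal.ofNat_ne_top).1 h2

section Tilt

variable {d : ℕ}

/-- The hitting time of `x` as a natural number, with the junk value `0` if `x` is not hit. -/
def hitNat (x : Site d) (w : WalkSpace d) : ℕ := (hittingTime {x} w).toNat

lemma measurable_hitNat [NeZero d] (x : Site d) : Measurable (hitNat x) := by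
  have h1 : Measurable (hittingTime {x} : WalkSpace d → ℕ∞) := by
    refine measurable_to_countable' fun n => ?_
    induction n using ENat.recTopCoe with
    | coe n => exact measurableSet_hittingTime_eq {x} n
    | top =>
      have h2 : (hittingTime {x} : WalkSpace d → ℕ∞) ⁻¹' {⊤} =
          (⋃ n : ℕ, {w : WalkSpace d | hittingTime {x} w = n})ᶜ := by
        ext w
        simp only [Set.mem_preimage, Set.mem_singleton_iff, Set.mem_compl_iff, Set.mem_iUnion,
          Set.mem_ofPred_eq, not_exists]
        constructor
        · intro h n hn; rw [h] at hn; exact ENat.top_ne_natCast n hn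
        · intro h
          by_contra hne
          obtain ⟨n, hn⟩ := ENat.ne_top_iff_exists.1 hne
          exact h n hn.symm
      rw [h2]
      exact (MeasurableSet.iUnion fun n => measurableSet_hittingTime_eq {x} n).compl
  exact (measurable_of_countable ENat.toNat).comp h1

lemma envPotential_add_env (u f : Env d) (w : WalkSpace d) (n : ℕ) :
    envPotential (u + f) w n = envPotential u w n + envPotential f w n := by
  simp [envPotential, quenchedPathPotential, Finset.sum_add_distrib]

lemma ofReal_envPotential (f : Env d) (w : WalkSpace d) (n : ℕ) :
    ENNReal.ofReal (envPotential f w n) = ∑' z, (f z : ℝ≥0∞) * visits w z n := by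
  have h1 : ENNReal.ofReal (envPotential f w n) =
      ∑ m ∈ Finset.Icc 1 n, (f (walk w m) : ℝ≥0∞) := by
    rw [envPotential, quenchedPathPotential,
      ENNReal.ofReal_sum_of_nonneg fun _ _ => NNReal.coe_nonneg _]
    simp
  have h2 : ∀ z, (f z : ℝ≥0∞) * visits w z n =
      ∑ m ∈ Finset.Icc 1 n, if walk w m = z then (f z : ℝ≥0∞) else 0 := by
    intro z
    rw [visits, Finset.card_filter]
    push_cast
    rw [Finset.mul_sum]
    simp
  simp_rw [h1, h2]
  rw [Summable.tsum_finsetSum fun _ _ => ENNReal.summable]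
  refine Finset.sum_congr rfl fun m _ => ?_
  rw [tsum_eq_single (walk w m) fun z hz => if_neg hz.symm, if_pos rfl]

lemma envPotential_single (z : Site d) (r : ℝ≥0) (w : WalkSpace d) (n : ℕ) :
    envPotential (Pi.single z r) w n = r * visits w z n := by
  have h1 : ∀ m, (((Pi.single z r : Env d) (walk w m) : ℝ≥0) : ℝ) =
      r * if walk w m = z then 1 else 0 := by
    intro m
    by_cases h : walk w m = z
    · rw [h]; simp
    · rw [Pi.single_eq_of_ne h, if_neg h]; simp
  simp only [envPotential, quenchedPathPotential, h1]
  rw [← Finset.mul_sum, visits, Finset.card_filter]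
  push_cast
  rfl

variable (lam : ℝ) (x : Site d)

/-- The discount at the hitting time of `x` in the environment `u`: an unnormalized density on the
space of walks. -/
def envDiscount (u : Env d) (w : WalkSpace d) : ℝ≥0∞ := hitDiscount lam (envPotential u) {x} ⊤ w

/-- Changing the environment by `f` tilts the density by `exp (-∑ f)`. -/
lemma envDiscount_add (u f : Env d) (w : WalkSpace d) :
    envDiscount lam x (u + f) w =
      ENNReal.ofReal (Real.exp (-envPotential f w (hitNat x w))) * envDiscount lam x u w := by
  by_cases h : hittingTime {x} w = ⊤
  · simp [envDiscount, hitDiscount_eq_zero (Or.inl h)]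
  obtain ⟨n, hn⟩ := ENat.ne_top_iff_exists.1 h
  have hn' : hitNat x w = n := by rw [hitNat, ← hn, ENat.toNat_natCast]
  simp only [envDiscount]
  rw [hitDiscount_of_eq hn.symm, hitDiscount_of_eq hn.symm, hitTerm_of_eq hn.symm le_top,
    hitTerm_of_eq hn.symm le_top, hn', envPotential_add_env,
    ← ENNReal.ofReal_mul (Real.exp_pos _).le, ← Real.exp_add]
  congr 2; ring

variable [NeZero d]

lemma envWeight_eq_lintegral (u : Env d) :
    envWeight lam u x ⊤ = ∫⁻ w, envDiscount lam x u w ∂walkMeasure d := rfl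

lemma measurable_envDiscount (u : Env d) : Measurable (envDiscount lam x u) :=
  measurable_hitDiscount (isPathPotential_env u)

lemma measurable_at_hitNat {β : Type*} [MeasurableSpace β] {F : WalkSpace d → ℕ → β}
    (hF : ∀ n, DependsOnSteps n fun w => F w n) : Measurable fun w => F w (hitNat x w) := by
  have h1 : Measurable fun p : WalkSpace d × ℕ => F p.1 p.2 :=
    measurable_from_prod_countable_left fun n => (hF n).measurable
  have h2 : Measurable fun w : WalkSpace d => (w, hitNat x w) :=
    measurable_id.prodMk (measurable_hitNat x)
  exact h1.comp h2

lemma measurable_envPotential_hitNat (f : Env d) :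
    Measurable fun w => envPotential f w (hitNat x w) :=
  measurable_at_hitNat x (F := fun w n => envPotential f w n) (isPathPotential_env f).adapted

lemma measurable_visits_hitNat (z : Site d) :
    Measurable fun w => (visits w z (hitNat x w) : ℝ≥0∞) :=
  measurable_at_hitNat x (F := fun w n => (visits w z n : ℝ≥0∞))
    fun n w w' h => by simp only [visits_congr h]

/-- The mean of the path sum `∑ f(S(m))` up to the hitting time of `x`, under the law on walks
with density proportional to the discount in the environment `u`. -/
def tiltedSum (f u : Env d) : ℝ≥0∞ :=
  (∫⁻ w, ENNReal.ofReal (envPotential f w (hitNat x w)) * envDiscount lam x u w ∂walkMeasure d) /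
    envWeight lam u x ⊤

/-- The mean number of visits to `z` up to the hitting time of `x`, under the same law. -/
def tiltedVisits (z : Site d) (u : Env d) : ℝ≥0∞ :=
  (∫⁻ w, (visits w z (hitNat x w) : ℝ≥0∞) * envDiscount lam x u w ∂walkMeasure d) /
    envWeight lam u x ⊤

lemma tiltedSum_eq_tsum (f u : Env d) :
    tiltedSum lam x f u = ∑' z, (f z : ℝ≥0∞) * tiltedVisits lam x z u := by
  simp only [tiltedSum, tiltedVisits, ofReal_envPotential, ← ENNReal.tsum_mul_right]
  have hm : ∀ z, Measurable fun w =>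
      (visits w z (hitNat x w) : ℝ≥0∞) * envDiscount lam x u w := fun z =>
    (measurable_visits_hitNat x z).mul (measurable_envDiscount lam x u)
  rw [lintegral_tsum]
  · simp only [div_eq_mul_inv, ← ENNReal.tsum_mul_right]
    refine tsum_congr fun z => ?_
    simp only [mul_assoc]
    rw [lintegral_const_mul _ (hm z)]
    simp only [mul_assoc]
  · intro z
    simp only [mul_assoc]
    exact ((hm z).const_mul _).aemeasurable

lemma measurable_tiltedVisits (z : Site d) : Measurable (tiltedVisits lam x z) := by
  refine Measurable.div ?_ (measurable_envWeight lam x ⊤)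
  refine Measurable.lintegral_prod_right' (f := fun p : Env d × WalkSpace d =>
    (visits p.2 z (hitNat x p.2) : ℝ≥0∞) * envDiscount lam x p.1 p.2) ?_
  exact ((measurable_visits_hitNat x z).comp measurable_snd).mul
    (measurable_hitDiscount_env lam {x} ⊤)

variable {lam}

lemma envWeight_top_ne_zero (hlam : 0 ≤ lam) (u : Env d) : envWeight lam u x ⊤ ≠ 0 :=
  reachable_top x lam u hlam

lemma envWeight_ne_top (hlam : 0 ≤ lam) (u : Env d) : envWeight lam u x ⊤ ≠ ⊤ :=
  hitWeight_ne_top hlam (isPathPotential_env u)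

/-- Raising the potential at `z` lowers the mean number of visits to `z`. -/
lemma tiltedVisits_anti (hlam : 0 ≤ lam) (z : Site d) (u : Env d) (r : ℝ≥0) :
    tiltedVisits lam x z (u + Pi.single z r) ≤ tiltedVisits lam x z u := by
  have h0 := envWeight_top_ne_zero x hlam u
  have h0' := envWeight_top_ne_zero x hlam (u + Pi.single z r)
  have ht := envWeight_ne_top x hlam u
  have ht' := envWeight_ne_top x hlam (u + Pi.single z r)
  let g : WalkSpace d → ℝ≥0∞ := fun w =>
    ENNReal.ofReal (Real.exp (-envPotential (Pi.single z r) w (hitNat x w)))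
  have hg : Measurable g :=
    ((measurable_envPotential_hitNat x _).neg.exp).ennreal_ofReal
  have h1 := lintegral_mul_mul_lintegral_le (walkMeasure d) (measurable_visits_hitNat x z) hg
    (measurable_envDiscount lam x u) fun a b hab => by
      refine ENNReal.ofReal_le_ofReal (Real.exp_le_exp.2 ?_)
      rw [envPotential_single, envPotential_single, neg_le_neg_iff]
      have : (visits a z (hitNat x a) : ℝ) ≤ visits b z (hitNat x b) := by exact_mod_cast hab
      gcongr
  have h2 : ∀ w, g w * envDiscount lam x u w = envDiscount lam x (u + Pi.single z r) w :=
    fun w => (envDiscount_add lam x u _ w).symm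
  simp only [mul_assoc, h2] at h1
  rw [← envWeight_eq_lintegral, ← envWeight_eq_lintegral] at h1
  rw [tiltedVisits, tiltedVisits, ENNReal.div_le_iff h0' ht', ← ENNReal.mul_div_right_comm,
    ENNReal.le_div_iff_mul_le (Or.inl h0) (Or.inl ht)]
  exact h1

/-- Jensen's inequality: the cost in the environment `u + f` exceeds the cost in `u` by at most
the mean path sum of `f` under the law tilted by `u`. -/
lemma ofReal_envCost_add_le (hlam : 0 ≤ lam) (u f : Env d) :
    ENNReal.ofReal (envCost lam (u + f) x ⊤) ≤
      ENNReal.ofReal (envCost lam u x ⊤) + tiltedSum lam x f u := by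
  have h0 := envWeight_top_ne_zero x hlam u
  have ht := envWeight_ne_top x hlam u
  by_cases hQ : tiltedSum lam x f u = ⊤
  · rw [hQ, add_top]; exact le_top
  set b := (tiltedSum lam x f u).toReal with hb
  have hb0 : 0 ≤ b := ENNReal.toReal_nonneg
  have hQb : tiltedSum lam x f u = ENNReal.ofReal b := (ENNReal.ofReal_toReal hQ).symm
  have hQ' : ∫⁻ w, ENNReal.ofReal (envPotential f w (hitNat x w)) * envDiscount lam x u w
      ∂walkMeasure d = ENNReal.ofReal b * envWeight lam u x ⊤ := by
    rw [← hQb, tiltedSum, ENNReal.div_mul_cancel h0 ht]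
  -- the tangent to `exp (-·)` at the mean `b`
  have hpt : ∀ w, ENNReal.ofReal (Real.exp (-b) * (1 + b)) * envDiscount lam x u w ≤
      envDiscount lam x (u + f) w + ENNReal.ofReal (Real.exp (-b)) *
        (ENNReal.ofReal (envPotential f w (hitNat x w)) * envDiscount lam x u w) := by
    intro w
    rw [envDiscount_add, ← mul_assoc, ← add_mul]
    gcongr
    have hX := (isPathPotential_env f).nonneg w (hitNat x w)
    rw [← ENNReal.ofReal_mul (Real.exp_pos _).le, ← ENNReal.ofReal_add (Real.exp_pos _).le
      (by positivity)]
    refine ENNReal.ofReal_le_ofReal ?_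
    have h3 := Real.add_one_le_exp (-envPotential f w (hitNat x w) + b)
    rw [Real.exp_add] at h3
    have h4 : Real.exp (-b) * Real.exp b = 1 := by rw [← Real.exp_add]; simp
    have h5 := mul_le_mul_of_nonneg_left h3 (Real.exp_pos (-b)).le
    have h6 : Real.exp (-b) * (Real.exp (-envPotential f w (hitNat x w)) * Real.exp b) =
        Real.exp (-envPotential f w (hitNat x w)) := by
      rw [mul_left_comm, h4, mul_one]
    rw [h6] at h5
    linarith
  have hint := lintegral_mono (μ := walkMeasure d) hpt
  have hmD := measurable_envDiscount lam x u
  have hmX : Measurable fun w =>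
      ENNReal.ofReal (envPotential f w (hitNat x w)) * envDiscount lam x u w :=
    (measurable_envPotential_hitNat x f).ennreal_ofReal.mul hmD
  rw [lintegral_const_mul _ hmD, lintegral_add_left (measurable_envDiscount lam x (u + f)),
    lintegral_const_mul _ hmX, hQ',
    ← envWeight_eq_lintegral, ← envWeight_eq_lintegral, mul_add, mul_one,
    ENNReal.ofReal_add (Real.exp_pos _).le (by positivity), add_mul,
    ENNReal.ofReal_mul (Real.exp_pos _).le, mul_assoc (ENNReal.ofReal (Real.exp (-b)))] at hint
  have hfin : ENNReal.ofReal (Real.exp (-b)) * (ENNReal.ofReal b * envWeight lam u x ⊤) ≠ ⊤ :=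
    ENNReal.mul_ne_top ENNReal.ofReal_ne_top (ENNReal.mul_ne_top ENNReal.ofReal_ne_top ht)
  have hle := (ENNReal.add_le_add_iff_right hfin).1 hint
  rw [hQb, ← ENNReal.ofReal_add (envCost_nonneg hlam u x ⊤) hb0]
  refine ENNReal.ofReal_le_ofReal ?_
  refine hitCost_le_of_le hlam (isPathPotential_env _) (le_trans (le_of_eq ?_) hle)
  have h7 := ofReal_exp_neg_hitCost hlam (isPathPotential_env u) h0
  rw [envWeight, ← h7, ← ENNReal.ofReal_mul (Real.exp_pos _).le, ← Real.exp_add]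
  congr 2
  simp only [envCost]; ring

/-- The entropy inequality: the mean path sum of the potential under the tilted law is at most the
cost. -/
lemma tiltedSum_self_le (hlam : 0 ≤ lam) (u : Env d) :
    tiltedSum lam x u u ≤ ENNReal.ofReal (envCost lam u x ⊤) := by
  have h0 := envWeight_top_ne_zero x hlam u
  have ht := envWeight_ne_top x hlam u
  set a := (envWeight lam u x ⊤).toReal with ha
  have ha0 : 0 < a := ENNReal.toReal_pos h0 ht
  have haw : envWeight lam u x ⊤ = ENNReal.ofReal a := (ENNReal.ofReal_toReal ht).symm
  let Y : WalkSpace d → ℝ := fun w => (envDiscount lam x u w).toReal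
  have hD1 : ∀ w, envDiscount lam x u w ≤ 1 := fun w =>
    hitDiscount_le_one hlam (isPathPotential_env u) w
  have hDY : ∀ w, envDiscount lam x u w = ENNReal.ofReal (Y w) := fun w =>
    (ENNReal.ofReal_toReal (ne_top_of_le_ne_top ENNReal.one_ne_top (hD1 w))).symm
  have hmD := measurable_envDiscount lam x u
  have hYi : Integrable Y (walkMeasure d) :=
    integrable_toReal_of_lintegral_ne_top hmD.aemeasurable ht
  have hYa : ∫ w, Y w ∂walkMeasure d = a := by
    rw [integral_toReal hmD.aemeasurable (Eventually.of_forall fun w =>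
      (hD1 w).trans_lt ENNReal.one_lt_top)]
    rfl
  -- the tangent to the concave function `y ↦ -y log y` at the mean `a` of `Y`
  have hpt : ∀ w, envPotential u w (hitNat x w) * Y w ≤ Y w * (-Real.log a) + (a - Y w) := by
    intro w
    by_cases h : hittingTime {x} w = ⊤
    · have h1 : Y w = 0 := by simp [Y, envDiscount, hitDiscount_eq_zero (Or.inl h)]
      rw [h1]; simp [ha0.le]
    obtain ⟨n, hn⟩ := ENat.ne_top_iff_exists.1 h
    have hn' : hitNat x w = n := by rw [hitNat, ← hn, ENat.toNat_natCast]
    have hY : Y w = Real.exp (-lam * n - envPotential u w n) := by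
      simp only [Y, envDiscount]
      rw [hitDiscount_of_eq hn.symm, hitTerm_of_eq hn.symm le_top,
        ENNReal.toReal_ofReal (Real.exp_pos _).le]
    have hY0 : 0 < Y w := by rw [hY]; exact Real.exp_pos _
    have h1 := Real.log_le_sub_one_of_pos (div_pos ha0 hY0)
    have hlogY : Real.log (Y w) = -lam * n - envPotential u w n := by rw [hY, Real.log_exp]
    rw [Real.log_div ha0.ne' hY0.ne', hlogY] at h1
    have h2 := mul_le_mul_of_nonneg_left h1 hY0.le
    have h3 : Y w * (a / Y w - 1) = a - Y w := by field_simp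
    rw [h3] at h2
    have h4 : 0 ≤ lam * n * Y w := by positivity
    rw [hn']
    linarith
  have hYi' : Integrable (fun w => a - Y w) (walkMeasure d) := (integrable_const a).sub hYi
  have hi : Integrable (fun w => Y w * (-Real.log a) + (a - Y w)) (walkMeasure d) :=
    (hYi.mul_const _).add hYi'
  have hnn : ∀ w, 0 ≤ Y w * (-Real.log a) + (a - Y w) := fun w =>
    (mul_nonneg ((isPathPotential_env u).nonneg w _) ENNReal.toReal_nonneg).trans (hpt w)
  have hval : ∫ w, (Y w * (-Real.log a) + (a - Y w)) ∂walkMeasure d = a * (-Real.log a) := by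
    rw [integral_add (hYi.mul_const _) hYi', integral_mul_const,
      integral_sub (integrable_const a) hYi, hYa, integral_const]
    simp
  rw [tiltedSum, ENNReal.div_le_iff h0 ht, haw, ← ENNReal.ofReal_mul (envCost_nonneg hlam u x ⊤)]
  calc ∫⁻ w, ENNReal.ofReal (envPotential u w (hitNat x w)) * envDiscount lam x u w
        ∂walkMeasure d
      ≤ ∫⁻ w, ENNReal.ofReal (Y w * (-Real.log a) + (a - Y w)) ∂walkMeasure d := by
        refine lintegral_mono fun w => ?_
        rw [hDY, ← ENNReal.ofReal_mul ((isPathPotential_env u).nonneg w _)]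
        exact ENNReal.ofReal_le_ofReal (hpt w)
    _ = ENNReal.ofReal (a * (-Real.log a)) := by
        rw [← ofReal_integral_eq_lintegral_ofReal hi (Eventually.of_forall hnn), hval]
    _ ≤ _ := by
        rw [mul_comm]; exact le_rfl

end Tilt

section Truncation

variable {d : ℕ}

/-- The environment truncated at level `M`. -/
def truncEnv (M : ℝ≥0) (v : Env d) : Env d := fun z => min (v z) M

lemma measurable_truncEnv (M : ℝ≥0) : Measurable (truncEnv (d := d) M) :=
  measurable_pi_lambda _ fun z => (measurable_pi_apply z).min measurable_const

lemma truncEnv_le (M : ℝ≥0) (v : Env d) (z : Site d) : truncEnv M v z ≤ v z := min_le_left _ _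

lemma truncEnv_add_sub (M : ℝ≥0) (v : Env d) :
    truncEnv M v + (fun z => v z - M) = v := by
  ext1 z
  simp only [truncEnv, Pi.add_apply]
  rcases le_total (v z) M with h | h
  · rw [min_eq_left h, tsub_eq_zero_of_le h, add_zero]
  · rw [min_eq_right h, add_tsub_cancel_of_le h]

lemma truncEnv_update [DecidableEq (Site d)] (M : ℝ≥0) (v : Env d) (z : Site d) (t : ℝ≥0) :
    truncEnv M (Function.update v z t) = Function.update (truncEnv M v) z (min t M) := by
  ext1 y
  by_cases h : y = z
  · subst h; simp [truncEnv]
  · simp [truncEnv, Function.update_of_ne h]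

/-- Resampling the potential at one site does not change the law of the environment. -/
lemma measurePreserving_update (ν : Measure ℝ≥0) [IsProbabilityMeasure ν] (z : Site d) :
    MeasurePreserving (fun p : Env d × ℝ≥0 => Function.update p.1 z p.2)
      ((envMeasure d ν).prod ν) (envMeasure d ν) := by
  have hm : Measurable fun p : Env d × ℝ≥0 => Function.update p.1 z p.2 := by
    refine measurable_pi_lambda _ fun y => ?_
    by_cases h : y = z
    · subst h; simpa using measurable_snd
    · simp only [Function.update_of_ne h]
      exact (measurable_pi_apply y).comp measurable_fst
  refine ⟨hm, Measure.eq_infinitePi _ fun s t ht => ?_⟩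
  rw [Measure.map_apply hm (.pi s.countable_toSet fun _ _ => ht _)]
  have h1 : (fun p : Env d × ℝ≥0 => Function.update p.1 z p.2) ⁻¹' ((s : Set (Site d)).pi t) =
      (((s.erase z : Finset (Site d)) : Set (Site d)).pi t) ×ˢ
        (if z ∈ s then t z else Set.univ) := by
    ext p
    simp only [Set.mem_preimage, Set.mem_pi, Set.mem_prod, Finset.mem_coe, Finset.mem_erase]
    constructor
    · intro h
      refine ⟨fun y hy => by simpa [Function.update_of_ne hy.1] using h y hy.2, ?_⟩
      split_ifs with hz
      · simpa using h z hz
      · trivial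
    · rintro ⟨h, h'⟩ y hy
      by_cases hyz : y = z
      · subst hyz; rw [if_pos hy] at h'; simpa using h'
      · simpa [Function.update_of_ne hyz] using h y ⟨hyz, hy⟩
  rw [h1, Measure.prod_prod, envMeasure, Measure.infinitePi_pi _ fun i _ => ht i]
  split_ifs with hz
  · exact Finset.prod_erase_mul s _ hz
  · rw [measure_univ, mul_one, Finset.erase_eq_of_notMem hz]

lemma measurable_excess (M : ℝ≥0) (z : Site d) :
    Measurable fun v : Env d => ((v z - M : ℝ≥0) : ℝ≥0∞) :=
  ((measurable_pi_apply (X := fun _ : Site d => ℝ≥0) z).sub measurable_const).coe_nnreal_ennreal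

lemma measurable_truncEnv_apply (M : ℝ≥0) (z : Site d) :
    Measurable fun v : Env d => (truncEnv M v z : ℝ≥0∞) :=
  ((measurable_pi_apply z).comp (measurable_truncEnv M)).coe_nnreal_ennreal

variable [NeZero d] {lam : ℝ}

/-- One-site comparison: the excess of the potential over `M` is charged, in the mean, to the
truncated potential at the same site, because the mean number of visits to a site decreases in the
potential there. -/
lemma lintegral_excess_le (hlam : 0 ≤ lam) (ν : Measure ℝ≥0) [IsProbabilityMeasure ν] {δ M : ℝ≥0}
    (hδ : δ ≠ 0) (hδν : ν (Set.Ici δ) ≠ 0) (hδM : δ ≤ M) (x z : Site d) :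
    ∫⁻ v, ((v z - M : ℝ≥0) : ℝ≥0∞) * tiltedVisits lam x z (truncEnv M v) ∂envMeasure d ν ≤
      (∫⁻ t, ((t - M : ℝ≥0) : ℝ≥0∞) ∂ν) / (δ * ν (Set.Ici δ)) *
        ∫⁻ v, (truncEnv M v z : ℝ≥0∞) * tiltedVisits lam x z (truncEnv M v) ∂envMeasure d ν := by
  have hmq : Measurable fun v : Env d => tiltedVisits lam x z (truncEnv M v) :=
    (measurable_tiltedVisits lam x z).comp (measurable_truncEnv M)
  have hm1 : Measurable fun v : Env d =>
      ((v z - M : ℝ≥0) : ℝ≥0∞) * tiltedVisits lam x z (truncEnv M v) :=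
    (measurable_excess M z).mul hmq
  have hm2 : Measurable fun v : Env d =>
      (truncEnv M v z : ℝ≥0∞) * tiltedVisits lam x z (truncEnv M v) :=
    (measurable_truncEnv_apply M z).mul hmq
  have hp := measurePreserving_update (d := d) ν z
  have hδ0 : (δ : ℝ≥0∞) * ν (Set.Ici δ) ≠ 0 := mul_ne_zero (by simpa using hδ) hδν
  have hδt : (δ : ℝ≥0∞) * ν (Set.Ici δ) ≠ ⊤ :=
    ENNReal.mul_ne_top ENNReal.coe_ne_top (measure_ne_top _ _)
  have hm1' : Measurable fun p : Env d × ℝ≥0 => ((Function.update p.1 z p.2 z - M : ℝ≥0) : ℝ≥0∞) *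
      tiltedVisits lam x z (truncEnv M (Function.update p.1 z p.2)) := hm1.comp hp.measurable
  have hm2' : Measurable fun p : Env d × ℝ≥0 =>
      (truncEnv M (Function.update p.1 z p.2) z : ℝ≥0∞) *
      tiltedVisits lam x z (truncEnv M (Function.update p.1 z p.2)) := hm2.comp hp.measurable
  have hm3 : Measurable fun v : Env d => ∫⁻ t, (truncEnv M (Function.update v z t) z : ℝ≥0∞) *
      tiltedVisits lam x z (truncEnv M (Function.update v z t)) ∂ν := hm2'.lintegral_prod_right'
  rw [← hp.lintegral_comp hm1, ← hp.lintegral_comp hm2, lintegral_prod _ hm1'.aemeasurable,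
    lintegral_prod _ hm2'.aemeasurable, ← lintegral_const_mul _ hm3]
  refine lintegral_mono fun v => ?_
  simp only [Function.update_self, truncEnv_update]
  set k : ℝ≥0 → ℝ≥0∞ := fun t => tiltedVisits lam x z (Function.update (truncEnv M v) z t) with hk
  have hanti : ∀ s t, s ≤ t → k t ≤ k s := by
    intro s t hst
    have h1 : Function.update (truncEnv M v) z t =
        Function.update (truncEnv M v) z s + Pi.single z (t - s) := by
      ext1 y
      by_cases hy : y = z
      · subst hy; simp [add_tsub_cancel_of_le hst]
      · simp [Function.update_of_ne hy, Pi.single_eq_of_ne hy]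
    simp only [hk, h1]
    exact tiltedVisits_anti x hlam z _ _
  have h1 : ∫⁻ t, ((t - M : ℝ≥0) : ℝ≥0∞) * k (min t M) ∂ν ≤
      (∫⁻ t, ((t - M : ℝ≥0) : ℝ≥0∞) ∂ν) * k M := by
    rw [← lintegral_mul_const _ (by fun_prop)]
    refine lintegral_mono fun t => ?_
    rcases le_total t M with h | h
    · simp [tsub_eq_zero_of_le h]
    · simp [min_eq_right h]
  have h2 : δ * ν (Set.Ici δ) * k M ≤ ∫⁻ t, ((min t M : ℝ≥0) : ℝ≥0∞) * k (min t M) ∂ν := by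
    calc δ * ν (Set.Ici δ) * k M = ∫⁻ _t in Set.Ici δ, δ * k M ∂ν := by
          rw [setLIntegral_const]; ring
      _ ≤ ∫⁻ t in Set.Ici δ, ((min t M : ℝ≥0) : ℝ≥0∞) * k (min t M) ∂ν := by
          refine setLIntegral_mono' measurableSet_Ici fun t ht => ?_
          refine mul_le_mul' ?_ (hanti _ _ (min_le_right _ _))
          exact_mod_cast le_min ht hδM
      _ ≤ _ := setLIntegral_le_lintegral _ _
  refine h1.trans ?_
  calc (∫⁻ t, ((t - M : ℝ≥0) : ℝ≥0∞) ∂ν) * k M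
      = (∫⁻ t, ((t - M : ℝ≥0) : ℝ≥0∞) ∂ν) / (δ * ν (Set.Ici δ)) *
          (δ * ν (Set.Ici δ) * k M) := by
        rw [← mul_assoc, ENNReal.div_mul_cancel hδ0 hδt]
    _ ≤ _ := by gcongr

/-- Truncating the potential at a high level changes mean costs by a factor close to one at
most. -/
lemma lintegral_envCost_le (hlam : 0 ≤ lam) (ν : Measure ℝ≥0) [IsProbabilityMeasure ν]
    {δ M : ℝ≥0} (hδ : δ ≠ 0) (hδν : ν (Set.Ici δ) ≠ 0) (hδM : δ ≤ M) (x : Site d) :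
    ∫⁻ v, ENNReal.ofReal (envCost lam v x ⊤) ∂envMeasure d ν ≤
      (1 + (∫⁻ t, ((t - M : ℝ≥0) : ℝ≥0∞) ∂ν) / (δ * ν (Set.Ici δ))) *
        ∫⁻ v, ENNReal.ofReal (envCost lam (truncEnv M v) x ⊤) ∂envMeasure d ν := by
  set κ := (∫⁻ t, ((t - M : ℝ≥0) : ℝ≥0∞) ∂ν) / (δ * ν (Set.Ici δ)) with hκ
  have hmq : ∀ z, Measurable fun v : Env d => tiltedVisits lam x z (truncEnv M v) := fun z =>
    (measurable_tiltedVisits lam x z).comp (measurable_truncEnv M)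
  have hmc : Measurable fun v : Env d => ENNReal.ofReal (envCost lam (truncEnv M v) x ⊤) :=
    ((measurable_envCost lam x ⊤).comp (measurable_truncEnv M)).ennreal_ofReal
  calc ∫⁻ v, ENNReal.ofReal (envCost lam v x ⊤) ∂envMeasure d ν
      ≤ ∫⁻ v, (ENNReal.ofReal (envCost lam (truncEnv M v) x ⊤) +
          tiltedSum lam x (fun z => v z - M) (truncEnv M v)) ∂envMeasure d ν := by
        refine lintegral_mono fun v => ?_
        have := ofReal_envCost_add_le x hlam (truncEnv M v) (fun z => v z - M)
        rwa [truncEnv_add_sub] at this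
    _ = ∫⁻ v, ENNReal.ofReal (envCost lam (truncEnv M v) x ⊤) ∂envMeasure d ν +
          ∑' z, ∫⁻ v, ((v z - M : ℝ≥0) : ℝ≥0∞) * tiltedVisits lam x z (truncEnv M v)
            ∂envMeasure d ν := by
        rw [lintegral_add_left hmc]
        congr 1
        simp_rw [tiltedSum_eq_tsum]
        exact lintegral_tsum fun z =>
          ((measurable_excess M z).mul (hmq z)).aemeasurable
    _ ≤ ∫⁻ v, ENNReal.ofReal (envCost lam (truncEnv M v) x ⊤) ∂envMeasure d ν +
          ∑' z, κ * ∫⁻ v, (truncEnv M v z : ℝ≥0∞) * tiltedVisits lam x z (truncEnv M v)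
            ∂envMeasure d ν := by
        gcongr with z
        exact lintegral_excess_le hlam ν hδ hδν hδM x z
    _ = ∫⁻ v, ENNReal.ofReal (envCost lam (truncEnv M v) x ⊤) ∂envMeasure d ν +
          κ * ∫⁻ v, tiltedSum lam x (truncEnv M v) (truncEnv M v) ∂envMeasure d ν := by
        rw [ENNReal.tsum_mul_left]
        simp_rw [tiltedSum_eq_tsum]
        congr 2
        exact (lintegral_tsum fun z =>
          ((measurable_truncEnv_apply M z).mul (hmq z)).aemeasurable).symm
    _ ≤ ∫⁻ v, ENNReal.ofReal (envCost lam (truncEnv M v) x ⊤) ∂envMeasure d ν +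
          κ * ∫⁻ v, ENNReal.ofReal (envCost lam (truncEnv M v) x ⊤) ∂envMeasure d ν := by
        gcongr with v
        exact tiltedSum_self_le x hlam _
    _ = _ := by ring

end Truncation

section TruncatedLaw

variable {d : ℕ}

/-- The law of the potential truncated at level `M`. -/
def truncLaw (M : ℝ≥0) (ν : Measure ℝ≥0) : Measure ℝ≥0 := ν.map fun t => min t M

lemma measurable_min_const (M : ℝ≥0) : Measurable fun t : ℝ≥0 => min t M :=
  measurable_id.min measurable_const

instance (M : ℝ≥0) (ν : Measure ℝ≥0) [IsProbabilityMeasure ν] :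
    IsProbabilityMeasure (truncLaw M ν) :=
  Measure.isProbabilityMeasure_map (measurable_min_const M).aemeasurable

lemma integrable_truncLaw (M : ℝ≥0) (ν : Measure ℝ≥0) [IsProbabilityMeasure ν] :
    Integrable (fun t : ℝ≥0 => (t : ℝ)) (truncLaw M ν) := by
  rw [truncLaw, integrable_map_measure measurable_coe_nnreal_real.aestronglyMeasurable
    (measurable_min_const M).aemeasurable]
  refine (integrable_const (M : ℝ)).mono'
    (measurable_coe_nnreal_real.comp (measurable_min_const M)).aestronglyMeasurable
    (Eventually.of_forall fun t => ?_)
  rw [Function.comp, Real.norm_of_nonneg (NNReal.coe_nonneg _)]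
  exact NNReal.coe_le_coe.2 (min_le_right t M)

lemma truncLaw_Ioi {M : ℝ≥0} (hM : 0 < M) (ν : Measure ℝ≥0) :
    truncLaw M ν (Set.Ioi 0) = ν (Set.Ioi 0) := by
  rw [truncLaw, Measure.map_apply (measurable_min_const M) measurableSet_Ioi]
  congr 1
  ext t
  simp [hM]

lemma measurePreserving_truncEnv (M : ℝ≥0) (ν : Measure ℝ≥0) [IsProbabilityMeasure ν] :
    MeasurePreserving (truncEnv (d := d) M) (envMeasure d ν) (envMeasure d (truncLaw M ν)) :=
  ⟨measurable_truncEnv M, Measure.infinitePi_map_pi _ fun _ => measurable_min_const M⟩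

variable [NeZero d]

lemma meanCost_truncLaw (lam : ℝ) (M : ℝ≥0) (ν : Measure ℝ≥0) [IsProbabilityMeasure ν]
    (x : Site d) :
    meanCost lam (truncLaw M ν) x = ∫ v, envCost lam (truncEnv M v) x ⊤ ∂envMeasure d ν := by
  have hm := measurePreserving_truncEnv (d := d) M ν
  rw [meanCost, ← hm.map_eq]
  exact integral_map hm.measurable.aemeasurable (measurable_envCost lam x ⊤).aestronglyMeasurable

lemma exists_meanCost_le_truncLaw {ν : Measure ℝ≥0} [IsProbabilityMeasure ν]
    (hν : Integrable (fun t : ℝ≥0 => (t : ℝ)) ν) (hpos : ν (Set.Ioi 0) ≠ 0) {ε : ℝ} (hε : 0 < ε) :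
    ∃ M : ℝ≥0, 0 < M ∧ ∀ lam : ℝ, 0 ≤ lam → ∀ x : Site d,
      meanCost lam ν x ≤ (1 + ε) * meanCost lam (truncLaw M ν) x := by
  obtain ⟨δ, hδ, hδν⟩ : ∃ δ : ℝ≥0, 0 < δ ∧ ν (Set.Ici δ) ≠ 0 := by
    by_contra hcon
    push Not at hcon
    refine hpos (measure_mono_null (t := ⋃ n : ℕ, Set.Ici (1 / ((n : ℝ≥0) + 1))) (fun t ht => ?_)
      (measure_iUnion_null fun n => hcon _ (by positivity)))
    obtain ⟨n, hn⟩ := exists_nat_one_div_lt (K := ℝ≥0) ht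
    exact Set.mem_iUnion.2 ⟨n, hn.le⟩
  have hlim : Tendsto (fun n : ℕ => ∫⁻ t : ℝ≥0, ((t - (n : ℝ≥0) : ℝ≥0) : ℝ≥0∞) ∂ν) atTop
      (𝓝 (∫⁻ _t : ℝ≥0, 0 ∂ν)) := by
    refine tendsto_lintegral_of_dominated_convergence (fun t => (t : ℝ≥0∞))
      (fun n => by fun_prop) (fun n => Eventually.of_forall fun t => ?_) ?_
      (Eventually.of_forall fun t => ?_)
    · exact ENNReal.coe_le_coe.2 tsub_le_self
    · have := hν.hasFiniteIntegral
      simpa [HasFiniteIntegral] using this.ne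
    · refine tendsto_const_nhds.congr' ?_
      obtain ⟨n, hn⟩ := exists_nat_ge t
      filter_upwards [eventually_ge_atTop n] with m hm
      rw [tsub_eq_zero_of_le (hn.trans (Nat.cast_le.2 hm)), ENNReal.coe_zero]
  rw [lintegral_zero] at hlim
  set b := ENNReal.ofReal ε * (δ * ν (Set.Ici δ)) with hb
  have hb0 : 0 < b := by
    refine pos_iff_ne_zero.2 (mul_ne_zero (by simpa using hε) (mul_ne_zero ?_ hδν))
    simpa using hδ.ne'
  obtain ⟨n, hn, hnδ⟩ := ((hlim.eventually (eventually_le_nhds hb0)).and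
    (eventually_ge_atTop ⌈δ⌉₊)).exists
  have hδn : δ ≤ n := (Nat.le_ceil δ).trans (Nat.cast_le.2 hnδ)
  refine ⟨n, hδ.trans_le hδn, fun lam hlam x => ?_⟩
  have h1 := lintegral_envCost_le hlam ν hδ.ne' hδν hδn x
  have hδ0 : (δ : ℝ≥0∞) * ν (Set.Ici δ) ≠ 0 := mul_ne_zero (by simpa using hδ.ne') hδν
  have hδt : (δ : ℝ≥0∞) * ν (Set.Ici δ) ≠ ⊤ :=
    ENNReal.mul_ne_top ENNReal.coe_ne_top (measure_ne_top _ _)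
  have hκ : (∫⁻ t, ((t - (n : ℝ≥0) : ℝ≥0) : ℝ≥0∞) ∂ν) / (δ * ν (Set.Ici δ)) ≤ ENNReal.ofReal ε :=
    (ENNReal.div_le_iff hδ0 hδt).2 hn
  have hi : Integrable (fun v => envCost lam (truncEnv n v) x ⊤) (envMeasure d ν) :=
    (measurePreserving_truncEnv (n : ℝ≥0) ν).integrable_comp_of_integrable
      (integrable_envCost (integrable_truncLaw _ ν) hlam x)
  have h0 : 0 ≤ meanCost lam (truncLaw n ν) x := integral_nonneg fun v => envCost_nonneg hlam v x ⊤
  rw [← ofReal_integral_eq_lintegral_ofReal (integrable_envCost hν hlam x)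
      (Eventually.of_forall fun v => envCost_nonneg hlam v x ⊤),
    ← ofReal_integral_eq_lintegral_ofReal hi
      (Eventually.of_forall fun v => envCost_nonneg hlam _ x ⊤), ← meanCost_truncLaw] at h1
  refine (ENNReal.ofReal_le_ofReal_iff (by positivity)).1 ?_
  rw [ENNReal.ofReal_mul (by positivity), ENNReal.ofReal_add zero_le_one hε.le, ENNReal.ofReal_one]
  exact h1.trans (by gcongr)

end TruncatedLaw

/-! ### The upper bound for costs along lattice directions -/

section LawOfLargeNumbers

variable {d : ℕ} [NeZero d] {lam : ℝ} {ν : Measure ℝ≥0} [IsProbabilityMeasure ν]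

lemma tendsto_envWeight (lam : ℝ) (v : Env d) (x : Site d) :
    Tendsto (fun n : ℕ => envWeight lam v x n) atTop (𝓝 (envWeight lam v x ⊤)) := by
  have hm : ∀ k, Measurable (hitTerm lam (envPotential v) {x} ⊤ k) := fun k =>
    measurable_hitTerm (isPathPotential_env v) k
  have h1 : envWeight lam v x ⊤ =
      ∑' k, ∫⁻ w, hitTerm lam (envPotential v) {x} ⊤ k w ∂walkMeasure d :=
    lintegral_tsum fun k => (hm k).aemeasurable
  have h2 : ∀ n : ℕ, envWeight lam v x n =
      ∑ k ∈ Finset.range (n + 1), ∫⁻ w, hitTerm lam (envPotential v) {x} ⊤ k w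
        ∂walkMeasure d := by
    intro n
    rw [← lintegral_finsetSum _ fun k _ => hm k]
    refine lintegral_congr fun w => ?_
    rw [hitDiscount, tsum_eq_sum (s := Finset.range (n + 1))]
    · refine Finset.sum_congr rfl fun k hk => ?_
      have hkn : (k : ℕ∞) ≤ n := Nat.cast_le.2 (Nat.lt_succ_iff.1 (Finset.mem_range.1 hk))
      simp [hitTerm, hkn]
    · intro k hk
      rw [hitTerm, if_neg]
      rintro ⟨-, h⟩
      exact hk (Finset.mem_range.2 (Nat.lt_succ_iff.2 (Nat.cast_le.1 h)))
  rw [h1]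
  simp_rw [h2]
  exact (ENNReal.tendsto_nat_tsum _).comp (tendsto_add_atTop_nat 1)

lemma tendsto_envCost (hlam : 0 ≤ lam) (v : Env d) (x : Site d) :
    Tendsto (fun n : ℕ => envCost lam v x n) atTop (𝓝 (envCost lam v x ⊤)) := by
  have h0 := envWeight_top_ne_zero x hlam v
  have ht := envWeight_ne_top x hlam v
  exact (((ENNReal.tendsto_toReal ht).comp (tendsto_envWeight lam v x)).log
    (ENNReal.toReal_pos h0 ht).ne').neg

/-- A finite time horizon changes mean costs by arbitrarily little. -/
lemma exists_integral_envCost_le (hν : Integrable (fun t : ℝ≥0 => (t : ℝ)) ν) (hlam : 0 ≤ lam)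
    (y : Site d) {ε : ℝ} (hε : 0 < ε) :
    ∃ T : ℕ, Reachable y T ∧ Integrable (fun v => envCost lam v y T) (envMeasure d ν) ∧
      ∫ v, envCost lam v y T ∂envMeasure d ν < meanCost lam ν y + ε := by
  obtain ⟨n, -, L, -, h⟩ := exists_envCost_le hlam y
  have hn : ∀ m : ℕ, (n : ℕ∞) ≤ ((m + n : ℕ) : ℕ∞) := fun m =>
    Nat.cast_le.2 (Nat.le_add_left n m)
  have hbi : Integrable (fun v : Env d => n * (Real.log (2 * d) + lam) +
      (L.map fun z => (v z : ℝ)).sum) (envMeasure d ν) :=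
    (integrable_const _).add (integrable_list_sum hν L).1
  have hb : ∀ m : ℕ, ∀ v : Env d, ‖envCost lam v y ((m + n : ℕ) : ℕ∞)‖ ≤
      n * (Real.log (2 * d) + lam) + (L.map fun z => (v z : ℝ)).sum := fun m v => by
    rw [Real.norm_of_nonneg (envCost_nonneg hlam v y _)]
    exact (h _ (hn m)).2 v
  have hlim : Tendsto (fun m : ℕ => ∫ v, envCost lam v y ((m + n : ℕ) : ℕ∞) ∂envMeasure d ν)
      atTop (𝓝 (meanCost lam ν y)) :=
    tendsto_integral_of_dominated_convergence _
      (fun m => (measurable_envCost lam y _).aestronglyMeasurable) hbi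
      (fun m => Eventually.of_forall (hb m)) (Eventually.of_forall fun v =>
        (tendsto_envCost hlam v y).comp (tendsto_add_atTop_nat n))
  obtain ⟨m, hm⟩ := (hlim.eventually (eventually_lt_nhds (lt_add_of_pos_right _ hε))).exists
  exact ⟨m + n, (h _ (hn m)).1, hbi.mono' (measurable_envCost lam y _).aestronglyMeasurable
    (Eventually.of_forall (hb m)), hm⟩

lemma envCost_nsmul_le_sum (hlam : 0 ≤ lam) {y : Site d} {T : ℕ∞} (hy : Reachable y T) (v : Env d)
    (n : ℕ) :
    envCost lam v (n • y) ⊤ ≤ ∑ i ∈ Finset.range n, envCost lam (shiftEnv (i • y) v) y T := by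
  induction n with
  | zero => simp [envCost_zero]
  | succ n ih =>
    rw [Finset.sum_range_succ, succ_nsmul]
    exact (envCost_add_le hlam v hy).trans (add_le_add ih le_rfl)

/-- Costs with horizon `T` seen from sites at distance more than `2T` are independent. -/
lemma indepFun_envCost_shiftEnv (lam : ℝ) (ν : Measure ℝ≥0) [IsProbabilityMeasure ν] (y : Site d)
    (T : ℕ) {a b : Site d} {i : Fin d} (hab : 2 * (T : ℤ) < |a i - b i|) :
    IndepFun (fun v => envCost lam (shiftEnv a v) y T) (fun v => envCost lam (shiftEnv b v) y T)
      (envMeasure d ν) := by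
  let r : Site d := fun _ => T
  let B : Site d → Finset (Site d) := fun a => Finset.Icc (a - r) (a + r)
  have hdisj : Disjoint (B a) (B b) := by
    rw [Finset.disjoint_left]
    intro z hza hzb
    rw [Finset.mem_Icc] at hza hzb
    have h1 := hza.1 i
    have h2 := hza.2 i
    have h3 := hzb.1 i
    have h4 := hzb.2 i
    simp only [r, Pi.sub_apply, Pi.add_apply] at h1 h2 h3 h4
    have : |a i - b i| ≤ 2 * (T : ℤ) := by rw [abs_le]; constructor <;> linarith
    omega
  let ext : ∀ a : Site d, (B a → ℝ≥0) → Env d := fun a u z => if h : z ∈ B a then u ⟨z, h⟩ else 0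
  have hext : ∀ a, Measurable (ext a) := by
    intro a
    refine measurable_pi_lambda _ fun z => ?_
    simp only [ext]
    split_ifs
    · exact measurable_pi_apply _
    · exact measurable_const
  have hfac : ∀ a : Site d, (fun v : Env d => envCost lam (shiftEnv a v) y T) =
      (fun u => envCost lam (shiftEnv a (ext a u)) y T) ∘ fun (v : Env d) (z : B a) => v z := by
    intro a
    ext1 v
    simp only [Function.comp]
    have h1 : envWeight lam (shiftEnv a v) y T =
        envWeight lam (shiftEnv a (ext a fun z : B a => v z)) y T := by
      refine envWeight_congr (fun z hz => ?_) y
      have hmem : a + z ∈ B a := by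
        have h2 : ∀ j, |z j| ≤ T := fun j => by
          have := (norm_le_pi_norm z j).trans hz
          rw [Int.norm_eq_abs] at this
          exact_mod_cast this
        refine Finset.mem_Icc.2 ⟨fun j => ?_, fun j => ?_⟩
        · have := (abs_le.1 (h2 j)).1
          simp only [r, Pi.sub_apply, Pi.add_apply]; linarith
        · have := (abs_le.1 (h2 j)).2
          simp only [r, Pi.add_apply]; linarith
      simp [shiftEnv, ext, hmem]
    simp only [envCost, hitCost]
    exact congrArg (fun t : ℝ≥0∞ => -Real.log t.toReal) h1
  have hm : ∀ a : Site d, Measurable fun u : B a → ℝ≥0 =>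
      envCost lam (shiftEnv a (ext a u)) y T := fun a =>
    (measurable_envCost lam y T).comp ((measurable_shiftEnv a).comp (hext a))
  have hind : iIndepFun (fun (z : Site d) (v : Env d) => v z) (envMeasure d ν) :=
    iIndepFun_infinitePi (X := fun _ (t : ℝ≥0) => t) fun _ => measurable_id
  rw [hfac a, hfac b]
  exact (hind.indepFun_finset (B a) (B b) hdisj fun z => measurable_pi_apply z).comp (hm a) (hm b)

/-- Almost surely, the costs along a lattice direction grow at most as fast as the Lyapunov norm
predicts: costs with a finite horizon are dominated by finitely many sums of independent random
variables, to which the strong law of large numbers applies. -/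
theorem exists_eventually_envCost_le (hν : Integrable (fun t : ℝ≥0 => (t : ℝ)) ν)
    (hpos : ν (Set.Ioi 0) ≠ 0) (hlam : 0 ≤ lam) (x : Site d) {ε : ℝ} (hε : 0 < ε) :
    ∃ k : ℕ, 0 < k ∧ ∀ᵐ v ∂envMeasure d ν, ∀ᶠ q : ℕ in atTop,
      envCost lam v (q • k • x) ⊤ ≤
        q * (k * (lyapunov (meanCost lam ν) (toReal x) + ε)) := by
  obtain ⟨c, hc⟩ := isSubadditiveCost_meanCost (d := d) hν hpos
  have h := hc lam hlam
  set α := lyapunov (meanCost lam ν) (toReal x) with hα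
  rcases eq_or_ne x 0 with rfl | hx
  · refine ⟨1, one_pos, Eventually.of_forall fun v => Eventually.of_forall fun q => ?_⟩
    have hα0 : 0 ≤ α := h.lyapunov_nonneg _
    rw [smul_zero, smul_zero, envCost_zero]
    positivity
  obtain ⟨m, hm, hm0⟩ := (((h.tendsto_apply_nsmul x).eventually (eventually_lt_nhds
    (lt_add_of_pos_right _ (half_pos hε)))).and (eventually_gt_atTop 0)).exists
  have hm0' : (0 : ℝ) < m := by exact_mod_cast hm0
  rw [div_lt_iff₀ hm0'] at hm
  set y := m • x with hy
  obtain ⟨i, hi⟩ : ∃ i, y i ≠ 0 := by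
    obtain ⟨i, hi⟩ := Function.ne_iff.1 hx
    refine ⟨i, ?_⟩
    rw [hy, Pi.smul_apply, nsmul_eq_mul]
    exact mul_ne_zero (by exact_mod_cast hm0.ne') hi
  have hmε : 0 < m * (ε / 2) := by positivity
  obtain ⟨T, hT, hTi, hTlt⟩ := exists_integral_envCost_le hν hlam y hmε
  have hTα : ∫ v, envCost lam v y T ∂envMeasure d ν < m * (α + ε) := by
    have h1 : (α + ε / 2) * m + m * (ε / 2) = m * (α + ε) := by ring
    linarith
  -- segments whose indices differ by a multiple of `L` see disjoint boxes of the environment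
  set L := 2 * T + 1 with hL
  have hL0 : (0 : ℝ) < L := by positivity
  let Y : ℕ → Env d → ℝ := fun n v => envCost lam (shiftEnv (n • y) v) y T
  have hYm : ∀ n, Measurable (Y n) := fun n =>
    (measurable_envCost lam y T).comp (measurable_shiftEnv _)
  have hYmap : ∀ n, (envMeasure d ν).map (Y n) =
      (envMeasure d ν).map fun v => envCost lam v y T := by
    intro n
    have h1 := measurePreserving_shiftEnv (d := d) ν (n • y)
    conv_rhs => rw [← h1.map_eq]
    rw [Measure.map_map (measurable_envCost lam y T) h1.measurable]
    rfl
  have hYid : ∀ n n', IdentDistrib (Y n) (Y n') (envMeasure d ν) (envMeasure d ν) := fun n n' =>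
    ⟨(hYm n).aemeasurable, (hYm n').aemeasurable, by rw [hYmap, hYmap]⟩
  have hYid0 : ∀ n, IdentDistrib (fun v => envCost lam v y T) (Y n) (envMeasure d ν)
      (envMeasure d ν) := fun n =>
    ⟨(measurable_envCost lam y T).aemeasurable, (hYm n).aemeasurable, (hYmap n).symm⟩
  have hslln : ∀ r, ∀ᵐ v ∂envMeasure d ν, ∀ᶠ q : ℕ in atTop,
      ∑ j ∈ Finset.range q, Y (j * L + r) v ≤ q * (m * (α + ε)) := by
    intro r
    have h1 := strong_law_ae_real (μ := envMeasure d ν) (fun j => Y (j * L + r))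
      ((hYid0 _).integrable_iff.1 hTi) (fun j j' hjj' => ?_) fun j => hYid _ _
    · filter_upwards [h1] with v hv
      have h2 : ∫ v, Y (0 * L + r) v ∂envMeasure d ν < m * (α + ε) := by
        rw [← (hYid0 _).integral_eq]; exact hTα
      filter_upwards [hv.eventually (eventually_lt_nhds h2), eventually_gt_atTop 0] with q hq hq0
      have hq0' : (0 : ℝ) < q := by exact_mod_cast hq0
      rw [div_lt_iff₀ hq0'] at hq
      linarith
    · refine indepFun_envCost_shiftEnv lam ν y T (i := i) ?_
      simp only [Pi.smul_apply, nsmul_eq_mul]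
      rw [← sub_mul, abs_mul]
      have h3 : 1 ≤ |y i| := Int.one_le_abs hi
      have h4 : ((j * L + r : ℕ) : ℤ) - ((j' * L + r : ℕ) : ℤ) = ((j : ℤ) - j') * L := by
        push_cast; ring
      have h5 : (1 : ℤ) ≤ |(j : ℤ) - j'| :=
        Int.one_le_abs (sub_ne_zero.2 (by exact_mod_cast hjj'))
      rw [h4, abs_mul, Nat.abs_cast]
      have h6 : (L : ℤ) = 2 * T + 1 := by rw [hL]; push_cast; ring
      have h7 : (L : ℤ) ≤ |(j : ℤ) - j'| * L := by nlinarith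
      nlinarith
  refine ⟨L * m, by positivity, ?_⟩
  filter_upwards [ae_all_iff.2 hslln] with v hv
  have hall : ∀ᶠ q : ℕ in atTop, ∀ r ∈ Finset.range L,
      ∑ j ∈ Finset.range q, Y (j * L + r) v ≤ q * (m * (α + ε)) :=
    (Finset.range L).eventually_all.2 fun r _ => hv r
  have hsplit : ∀ (f : ℕ → ℝ) (q : ℕ), ∑ i ∈ Finset.range (q * L), f i =
      ∑ r ∈ Finset.range L, ∑ j ∈ Finset.range q, f (j * L + r) := by
    intro f q
    rw [Finset.sum_comm]
    induction q with
    | zero => simp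
    | succ q ih => rw [Finset.sum_range_succ, ← ih, add_mul, one_mul, Finset.sum_range_add]
  filter_upwards [hall] with q hq
  have h1 : q • (L * m) • x = (q * L) • y := by
    rw [hy, smul_smul, smul_smul]; congr 1; ring
  rw [h1]
  calc envCost lam v ((q * L) • y) ⊤ ≤ ∑ i ∈ Finset.range (q * L), Y i v :=
        envCost_nsmul_le_sum hlam hT v _
    _ = ∑ r ∈ Finset.range L, ∑ j ∈ Finset.range q, Y (j * L + r) v := hsplit _ _
    _ ≤ ∑ _r ∈ Finset.range L, q * (m * (α + ε)) := Finset.sum_le_sum hq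
    _ = _ := by
        rw [Finset.sum_const, Finset.card_range, nsmul_eq_mul]
        push_cast; ring

end LawOfLargeNumbers

/-! ### Lower bound for subadditive processes -/

/-- A stopping argument for bounded subadditive processes. If from every point `v` the process
comes below the level `n (φ v + ε)` at some time `n ≥ 1`, where `φ` does not decrease along orbits,
then chopping time at these stopping times bounds `∫ f n` by `n (∫ φ + ε)`, up to the rare
points where the stopping time is large. -/
lemma le_integral_of_subadditive {X : Type*} [MeasurableSpace X] {P : Measure X}
    [IsProbabilityMeasure P] {S : X → X} (hS : MeasurePreserving S P P) {f : ℕ → X → ℝ}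
    (hfm : ∀ n, Measurable (f n)) {C : ℝ} (hf0 : ∀ n v, 0 ≤ f n v) (hfC : ∀ n v, f n v ≤ C * n)
    (hsub : ∀ n m v, f (n + m) v ≤ f n v + f m (S^[n] v))
    {φ : X → ℝ} (hφm : Measurable φ) (hφ0 : ∀ v, 0 ≤ φ v) (hφC : ∀ v, φ v ≤ C)
    (hφS : ∀ v, φ v ≤ φ (S v))
    (hbelow : ∀ v, ∀ ε > 0, ∃ n : ℕ, 0 < n ∧ f n v ≤ n * (φ v + ε))
    {a : ℝ} (ha : ∀ n : ℕ, n * a ≤ ∫ v, f n v ∂P) : a ≤ ∫ v, φ v ∂P := by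
  obtain ⟨v0⟩ : Nonempty X := nonempty_of_isProbabilityMeasure P
  have hC0 : 0 ≤ C := (hφ0 v0).trans (hφC v0)
  have hφi : Integrable φ P := (integrable_const C).mono' hφm.aestronglyMeasurable
    (Eventually.of_forall fun v => by rw [Real.norm_of_nonneg (hφ0 v)]; exact hφC v)
  refine le_of_forall_pos_le_add fun ε hε => ?_
  let G : ℕ → Set X := fun K => {v | ∃ n ∈ Finset.Icc 1 K, f n v ≤ n * (φ v + ε)}
  have hGm : ∀ K, MeasurableSet (G K) := by
    intro K
    have : G K = ⋃ n ∈ Finset.Icc 1 K, {v | f n v ≤ n * (φ v + ε)} := by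
      ext v; simp [G]
    rw [this]
    exact Finset.measurableSet_biUnion _ fun n _ =>
      measurableSet_le (hfm n) ((hφm.add_const ε).const_mul _)
  let h : ℕ → X → ℝ := fun K v => φ v + ε + (G K)ᶜ.indicator (fun _ => C) v
  have hhm : ∀ K, Measurable (h K) := fun K =>
    (hφm.add_const ε).add (measurable_const.indicator (hGm K).compl)
  have hind : ∀ K v, 0 ≤ (G K)ᶜ.indicator (fun _ => C) v := fun K v =>
    Set.indicator_nonneg (fun _ _ => hC0) v
  have hh0 : ∀ K v, φ v + ε ≤ h K v := fun K v => le_add_of_nonneg_right (hind K v)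
  have hiter : ∀ n v, φ v ≤ φ (S^[n] v) := by
    intro n
    induction n with
    | zero => intro v; exact le_rfl
    | succ n ih => intro v; exact (hφS v).trans (ih (S v))
  -- chop the time interval at the stopping times
  have hchop : ∀ K n v, f n v ≤ ∑ j ∈ Finset.range n, h K (S^[j] v) + C * K := by
    intro K n
    induction n using Nat.strong_induction_on with
    | _ n ih =>
      intro v
      have hsum0 : ∀ n v, 0 ≤ ∑ j ∈ Finset.range n, h K (S^[j] v) := fun n v =>
        Finset.sum_nonneg fun j _ => by
          have := hh0 K (S^[j] v); have := hφ0 (S^[j] v); linarith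
      rcases le_or_gt n K with hnK | hnK
      · have h1 : C * n ≤ C * K := by gcongr
        linarith [hfC n v, hsum0 n v]
      have step : ∀ m, 0 < m → m ≤ n → f m v ≤ ∑ j ∈ Finset.range m, h K (S^[j] v) →
          f n v ≤ ∑ j ∈ Finset.range n, h K (S^[j] v) + C * K := by
        intro m hm0 hmn hm
        obtain ⟨k, rfl⟩ := Nat.exists_eq_add_of_le hmn
        have h2 := ih k (by omega) (S^[m] v)
        have h3 := hsub m k v
        rw [Finset.sum_range_add]
        have h4 : ∑ j ∈ Finset.range k, h K (S^[j] (S^[m] v)) =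
            ∑ j ∈ Finset.range k, h K (S^[m + j] v) :=
          Finset.sum_congr rfl fun j _ => by rw [add_comm m j, Function.iterate_add_apply]
        rw [h4] at h2
        linarith
      by_cases hv : v ∈ G K
      · obtain ⟨m, hmK, hm⟩ := hv
        rw [Finset.mem_Icc] at hmK
        refine step m hmK.1 (hmK.2.trans hnK.le) (hm.trans ?_)
        calc m * (φ v + ε) = ∑ _j ∈ Finset.range m, (φ v + ε) := by
              rw [Finset.sum_const, Finset.card_range, nsmul_eq_mul]
          _ ≤ _ := Finset.sum_le_sum fun j _ =>
            (add_le_add (hiter j v) le_rfl).trans (hh0 K _)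
      · refine step 1 one_pos (by omega) ?_
        have h5 : h K v = φ v + ε + C := by
          simp only [h]
          rw [Set.indicator_of_mem (show v ∈ (G K)ᶜ from hv)]
        have h6 := hfC 1 v
        rw [Finset.sum_range_one, Function.iterate_zero_apply, h5]
        have := hφ0 v
        push_cast at h6
        linarith
  have hindi : ∀ K, Integrable ((G K)ᶜ.indicator fun _ => C) P := fun K =>
    (integrable_const C).indicator (hGm K).compl
  have hhi : ∀ K, Integrable (h K) P := fun K =>
    (hφi.add (integrable_const ε)).add (hindi K)
  have hhS : ∀ K j, Integrable (fun v => h K (S^[j] v)) P := fun K j =>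
    (hS.iterate j).integrable_comp_of_integrable (hhi K)
  have hhint : ∀ K j, ∫ v, h K (S^[j] v) ∂P = ∫ v, h K v ∂P := by
    intro K j
    have h1 := hS.iterate j
    conv_rhs => rw [← h1.map_eq]
    exact (integral_map h1.measurable.aemeasurable (hhm K).aestronglyMeasurable).symm
  have hfi : ∀ n, Integrable (f n) P := fun n =>
    (integrable_const (C * n)).mono' (hfm n).aestronglyMeasurable
      (Eventually.of_forall fun v => by rw [Real.norm_of_nonneg (hf0 n v)]; exact hfC n v)
  have hbound : ∀ K, a ≤ ∫ v, h K v ∂P := by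
    intro K
    have h1 : ∀ n : ℕ, n * a ≤ n * (∫ v, h K v ∂P) + C * K := by
      intro n
      refine (ha n).trans ?_
      have hsi : Integrable (fun v => ∑ j ∈ Finset.range n, h K (S^[j] v)) P :=
        integrable_finsetSum _ fun j _ => hhS K j
      have hsi' : Integrable (fun v => ∑ j ∈ Finset.range n, h K (S^[j] v) + C * K) P :=
        hsi.add (integrable_const (C * K))
      calc ∫ v, f n v ∂P ≤ ∫ v, (∑ j ∈ Finset.range n, h K (S^[j] v) + C * K) ∂P :=
            integral_mono (hfi n) hsi' (hchop K n)
        _ = _ := by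
            rw [integral_add hsi (integrable_const _), integral_finsetSum _ fun j _ => hhS K j]
            simp [hhint]
    by_contra hneg
    obtain ⟨n, hn⟩ := exists_nat_gt (C * K / (a - ∫ v, h K v ∂P))
    rw [div_lt_iff₀ (by linarith [not_le.1 hneg])] at hn
    have := h1 n
    linarith
  have hlim : Tendsto (fun K => ∫ v, (G K)ᶜ.indicator (fun _ => C) v ∂P) atTop
      (𝓝 (∫ _v, 0 ∂P)) := by
    refine tendsto_integral_of_dominated_convergence (fun _ => C)
      (fun K => (hindi K).aestronglyMeasurable) (integrable_const C)
      (fun K => Eventually.of_forall fun v => ?_) (Eventually.of_forall fun v => ?_)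
    · rw [Real.norm_of_nonneg (hind K v)]
      exact Set.indicator_le_self' (fun _ _ => hC0) v
    · obtain ⟨n, hn0, hn⟩ := hbelow v ε hε
      refine tendsto_const_nhds.congr' ?_
      filter_upwards [eventually_ge_atTop n] with K hK
      rw [Set.indicator_of_notMem]
      exact fun hv => hv ⟨n, Finset.mem_Icc.2 ⟨hn0, hK⟩, hn⟩
  rw [integral_zero] at hlim
  have hlim2 := hlim.const_add (∫ v, φ v ∂P + ε)
  rw [add_zero] at hlim2
  refine ge_of_tendsto' hlim2 fun K => (hbound K).trans_eq ?_
  have h1 : ∫ v, h K v ∂P = ∫ v, (φ v + ε) ∂P + ∫ v, (G K)ᶜ.indicator (fun _ => C) v ∂P :=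
    integral_add (hφi.add (integrable_const ε)) (hindi K)
  rw [h1, integral_add hφi (integrable_const ε)]
  simp

/-! ### The lower bound for costs in bounded environments -/

section LowerBound

variable {d : ℕ}

lemma truncEnv_shiftEnv (M : ℝ≥0) (x : Site d) (v : Env d) :
    truncEnv M (shiftEnv x v) = shiftEnv x (truncEnv M v) := rfl

lemma shiftEnv_iterate (x : Site d) (n : ℕ) (v : Env d) :
    (shiftEnv x)^[n] v = shiftEnv (n • x) v := by
  induction n with
  | zero => simp [shiftEnv_zero]
  | succ n ih => rw [Function.iterate_succ_apply', ih, shiftEnv_shiftEnv, succ_nsmul]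

lemma tendsto_norm_site : Tendsto (fun y : Site d => ‖y‖) cofinite atTop := by
  rw [← cocompact_eq_cofinite]
  exact tendsto_norm_cocompact_atTop

lemma finite_norm_le (r : ℝ) : {x : Site d | ‖x‖ ≤ r}.Finite := by
  have h1 := (isCompact_closedBall (0 : Site d) r).finite_of_discrete
  refine h1.subset fun x hx => ?_
  simpa using hx

variable [NeZero d] {lam : ℝ}

/-- In an environment bounded by `M`, costs are bounded by a multiple of the norm. -/
lemma envCost_le_of_bounded (hlam : 0 ≤ lam) {M : ℝ≥0} {v : Env d} (hv : ∀ z, v z ≤ M)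
    (x : Site d) : envCost lam v x ⊤ ≤ d * (Real.log (2 * d) + lam + M) * ‖x‖ := by
  obtain ⟨n, hn, L, hL, h⟩ := exists_envCost_le hlam x
  have h1 : (L.map fun z => (v z : ℝ)).sum ≤ n * M := by
    have := List.sum_le_card_nsmul (L.map fun z => (v z : ℝ)) M (by simpa using fun z _ => hv z)
    simpa [hL] using this
  have h2 := log_two_mul_nonneg (d := d)
  calc envCost lam v x ⊤ ≤ n * (Real.log (2 * d) + lam) + (L.map fun z => (v z : ℝ)).sum :=
        (h ⊤ le_top).2 v
    _ ≤ n * (Real.log (2 * d) + lam + M) := by linarith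
    _ ≤ (d * ‖x‖) * (Real.log (2 * d) + lam + M) := by gcongr
    _ = _ := by ring

lemma envCost_mono (hlam : 0 ≤ lam) {v v' : Env d} (h : ∀ z, v z ≤ v' z) (x : Site d) :
    envCost lam v x ⊤ ≤ envCost lam v' x ⊤ :=
  hitCost_mono hlam le_rfl (isPathPotential_env v) (isPathPotential_env v')
    (fun w n => envPotential_mono h w n) (reachable_top x lam v' hlam)

variable {ν : Measure ℝ≥0} [IsProbabilityMeasure ν]

/-- Almost surely, in the truncated environment the costs along a lattice direction grow at least
as fast as the Lyapunov norm predicts: their lower rate is at most the Lyapunov norm almost surely,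
and at least the Lyapunov norm in the mean. -/
theorem eventually_le_envCost_nsmul (hpos : ν (Set.Ioi 0) ≠ 0) (hlam : 0 ≤ lam) {M : ℝ≥0}
    (hM : 0 < M) (x : Site d) :
    ∀ᵐ v ∂envMeasure d ν, ∀ ε > 0, ∀ᶠ n : ℕ in atTop,
      n * (lyapunov (meanCost lam (truncLaw M ν)) (toReal x) - ε) ≤
        envCost lam (truncEnv M v) (n • x) ⊤ := by
  have hνM := integrable_truncLaw M ν
  have hposM : truncLaw M ν (Set.Ioi 0) ≠ 0 := by rwa [truncLaw_Ioi hM]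
  obtain ⟨c, hc⟩ := isSubadditiveCost_meanCost (d := d) hνM hposM
  have h := hc lam hlam
  set α := lyapunov (meanCost lam (truncLaw M ν)) (toReal x) with hα
  set C := d * (Real.log (2 * d) + lam + M) * ‖x‖ with hC
  have hC0 : 0 ≤ C := by
    have := log_two_mul_nonneg (d := d)
    positivity
  let f : ℕ → Env d → ℝ := fun n v => envCost lam (truncEnv M v) (n • x) ⊤
  have hfm : ∀ n, Measurable (f n) := fun n =>
    (measurable_envCost lam _ ⊤).comp (measurable_truncEnv M)
  have hf0 : ∀ n v, 0 ≤ f n v := fun n v => envCost_nonneg hlam _ _ _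
  have hfC : ∀ n v, f n v ≤ C * n := by
    intro n v
    refine (envCost_le_of_bounded hlam (M := M) (fun z => min_le_right _ _) _).trans_eq ?_
    have h1 : ‖n • x‖ = n * ‖x‖ := by
      rw [← norm_toReal, toReal_nsmul, ← Nat.cast_smul_eq_nsmul ℝ, norm_smul, norm_toReal,
        Real.norm_natCast]
    rw [h1, hC]; ring
  have hsub : ∀ n m v, f (n + m) v ≤ f n v + f m ((shiftEnv x)^[n] v) := by
    intro n m v
    simp only [f]
    rw [shiftEnv_iterate, truncEnv_shiftEnv, add_smul]
    exact envCost_add_le hlam _ (reachable_top _)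
  have hr0 : ∀ n v, 0 ≤ f n v / (n : ℝ) := fun n v => div_nonneg (hf0 n v) (Nat.cast_nonneg _)
  have hrC : ∀ n v, f n v / (n : ℝ) ≤ C := fun n v =>
    div_le_of_le_mul₀ (Nat.cast_nonneg _) hC0 (hfC n v)
  have hbdd : ∀ v, IsBoundedUnder (· ≥ ·) atTop fun n : ℕ => f n v / (n : ℝ) := fun v =>
    isBoundedUnder_of ⟨0, fun n => hr0 n v⟩
  have hcobdd : ∀ v, IsCoboundedUnder (· ≥ ·) atTop fun n : ℕ => f n v / (n : ℝ) := fun v =>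
    (isBoundedUnder_of ⟨C, fun n => hrC n v⟩ :
      IsBoundedUnder (· ≤ ·) atTop fun n : ℕ => f n v / (n : ℝ)).isCoboundedUnder_ge
  let φ : Env d → ℝ := fun v => liminf (fun n : ℕ => f n v / (n : ℝ)) atTop
  have hφm : Measurable φ := Measurable.liminf fun n => (hfm n).div_const _
  have hφ0 : ∀ v, 0 ≤ φ v := fun v =>
    le_liminf_of_le (hcobdd v) (Eventually.of_forall fun n => hr0 n v)
  have hφC : ∀ v, φ v ≤ C := fun v =>
    liminf_le_of_frequently_le (Eventually.of_forall fun n => hrC n v).frequently (hbdd v)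
  -- the first segment costs at most `C`, which does not affect the rate
  have hφS : ∀ v, φ v ≤ φ (shiftEnv x v) := by
    intro v
    refine le_of_forall_pos_sub_le fun ε hε => ?_
    refine le_liminf_of_le (hcobdd _) ?_
    have h1 : ∀ᶠ n : ℕ in atTop, φ v - ε / 2 < f n v / (n : ℝ) :=
      eventually_lt_of_lt_liminf (by simp only [φ]; linarith) (hbdd v)
    have h2 : Tendsto (fun n : ℕ => C / (n : ℝ)) atTop (𝓝 0) :=
      tendsto_const_div_atTop_nhds_zero_nat C
    have h3 := h2.eventually (eventually_lt_nhds (half_pos hε))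
    filter_upwards [(tendsto_add_atTop_nat 1).eventually h1,
      (tendsto_add_atTop_nat 1).eventually h3, eventually_gt_atTop 0] with n hn1 hn2 hn0
    have hn0' : (0 : ℝ) < n := by exact_mod_cast hn0
    have h4 := hsub 1 n v
    rw [Function.iterate_one, add_comm 1 n] at h4
    have h5 := hfC 1 v
    rw [Nat.cast_one, mul_one] at h5
    have h6 : f (n + 1) v / ((n + 1 : ℕ) : ℝ) ≤
        C / ((n + 1 : ℕ) : ℝ) + f n (shiftEnv x v) / (n : ℝ) := by
      calc f (n + 1) v / ((n + 1 : ℕ) : ℝ)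
          ≤ (C + f n (shiftEnv x v)) / ((n + 1 : ℕ) : ℝ) := by gcongr; linarith
        _ = C / ((n + 1 : ℕ) : ℝ) + f n (shiftEnv x v) / ((n + 1 : ℕ) : ℝ) := add_div _ _ _
        _ ≤ _ := by
          gcongr
          · exact hf0 _ _
          · exact Nat.le_succ n
    linarith
  have hbelow : ∀ v, ∀ ε > 0, ∃ n : ℕ, 0 < n ∧ f n v ≤ n * (φ v + ε) := by
    intro v ε hε
    have h1 : ∃ᶠ n : ℕ in atTop, f n v / (n : ℝ) < φ v + ε :=
      frequently_lt_of_liminf_lt (hcobdd v) (by simp only [φ]; linarith)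
    obtain ⟨n, hn, hn0⟩ := (h1.and_eventually (eventually_gt_atTop 0)).exists
    have hn0' : (0 : ℝ) < n := by exact_mod_cast hn0
    rw [div_lt_iff₀ hn0'] at hn
    exact ⟨n, hn0, by linarith⟩
  have hαφ : α ≤ ∫ v, φ v ∂envMeasure d ν :=
    le_integral_of_subadditive (measurePreserving_shiftEnv ν x) hfm hf0 hfC hsub hφm hφ0 hφC hφS
      hbelow fun n => by
        have := h.nsmul_lyapunov_le n x
        rwa [meanCost_truncLaw] at this
  -- the upper bound for costs, along the multiples of `k`
  have hφα : ∀ᵐ v ∂envMeasure d ν, φ v ≤ α := by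
    have h1 : ∀ j : ℕ, ∀ᵐ v ∂envMeasure d ν, φ v ≤ α + 1 / ((j : ℝ) + 1) := by
      intro j
      obtain ⟨k, hk0, hk⟩ := exists_eventually_envCost_le hνM hposM hlam x
        (Nat.one_div_pos_of_nat (n := j) (α := ℝ))
      filter_upwards [(measurePreserving_truncEnv M ν).quasiMeasurePreserving.ae hk] with v hv
      refine liminf_le_of_frequently_le ?_ (hbdd v)
      have h2 : Tendsto (fun q : ℕ => q * k) atTop atTop := tendsto_id.atTop_mul_const' hk0
      refine h2.frequently (Eventually.frequently ?_)
      filter_upwards [hv, eventually_gt_atTop 0] with q hq hq0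
      have hqk : (0 : ℝ) < ((q * k : ℕ) : ℝ) := by exact_mod_cast Nat.mul_pos hq0 hk0
      rw [div_le_iff₀ hqk]
      rw [smul_smul] at hq
      refine hq.trans_eq ?_
      push_cast; ring
    filter_upwards [ae_all_iff.2 h1] with v hv
    have h3 : Tendsto (fun j : ℕ => α + 1 / ((j : ℝ) + 1)) atTop (𝓝 (α + 0)) :=
      tendsto_one_div_add_atTop_nhds_zero_nat.const_add α
    rw [add_zero] at h3
    exact ge_of_tendsto' h3 hv
  have hφi : Integrable φ (envMeasure d ν) := (integrable_const C).mono' hφm.aestronglyMeasurable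
    (Eventually.of_forall fun v => by rw [Real.norm_of_nonneg (hφ0 v)]; exact hφC v)
  have hgi : Integrable (fun v => α - φ v) (envMeasure d ν) := (integrable_const α).sub hφi
  have hg0 : 0 ≤ᵐ[envMeasure d ν] fun v => α - φ v := by
    filter_upwards [hφα] with v hv using sub_nonneg.2 hv
  have hgz : ∫ v, (α - φ v) ∂envMeasure d ν = 0 := by
    refine le_antisymm ?_ (integral_nonneg_of_ae hg0)
    rw [integral_sub (integrable_const α) hφi, integral_const]
    simp only [probReal_univ, one_smul]
    linarith
  filter_upwards [(integral_eq_zero_iff_of_nonneg_ae hg0 hgi).1 hgz] with v hv ε hε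
  have hv' : φ v = α := by
    have : α - φ v = 0 := hv
    linarith
  have h1 : ∀ᶠ n : ℕ in atTop, α - ε < f n v / (n : ℝ) :=
    eventually_lt_of_lt_liminf (by rw [← hv']; simp only [φ]; linarith) (hbdd v)
  filter_upwards [h1, eventually_gt_atTop 0] with n hn hn0
  have hn0' : (0 : ℝ) < n := by exact_mod_cast hn0
  rw [lt_div_iff₀ hn0'] at hn
  linarith

/-- Almost surely, in the truncated environment the lower bound for costs holds at all but
finitely many points: these are close to multiples of finitely many lattice directions, and costs
are Lipschitz there. -/
theorem eventually_le_envCost_truncEnv (hpos : ν (Set.Ioi 0) ≠ 0) (hlam : 0 ≤ lam) {M : ℝ≥0}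
    (hM : 0 < M) :
    ∀ᵐ v ∂envMeasure d ν, ∀ ε > 0, ∀ᶠ y : Site d in cofinite,
      lyapunov (meanCost lam (truncLaw M ν)) (toReal y) - ε * ‖y‖ ≤
        envCost lam (truncEnv M v) y ⊤ := by
  have hposM : truncLaw M ν (Set.Ioi 0) ≠ 0 := by rwa [truncLaw_Ioi hM]
  obtain ⟨c, hc⟩ := isSubadditiveCost_meanCost (d := d) (integrable_truncLaw M ν) hposM
  have h := hc lam hlam
  set C' := d * (Real.log (2 * d) + lam + ∫ t, (t : ℝ) ∂truncLaw M ν) with hC'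
  have hC'0 : 0 ≤ C' := h.const_nonneg
  set C := d * (Real.log (2 * d) + lam + M) with hC
  have hC0 : 0 ≤ C := by
    have := log_two_mul_nonneg (d := d)
    positivity
  set N := lyapunov (meanCost (d := d) lam (truncLaw M ν)) with hN
  filter_upwards [ae_all_iff.2 fun x : Site d => eventually_le_envCost_nsmul hpos hlam hM x]
    with v hv ε hε
  set u := truncEnv M v with hu
  have hLip : ∀ y z : Site d, envCost lam u z ⊤ ≤ envCost lam u y ⊤ + C * ‖z - y‖ := by
    intro y z
    have h1 := envCost_add_le hlam u (x := y) (reachable_top (z - y))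
    rw [add_sub_cancel] at h1
    refine h1.trans (add_le_add le_rfl (envCost_le_of_bounded hlam (fun w => ?_) _))
    exact min_le_right _ _
  obtain ⟨K, hK⟩ := exists_nat_gt ((C + C' + 1) / ε)
  have hK0 : (0 : ℝ) < K := lt_of_le_of_lt (by positivity) hK
  rw [div_lt_iff₀ hε] at hK
  have hdir : ∀ᶠ n : ℕ in atTop, ∀ x ∈ {x : Site d | ‖x‖ ≤ 2 * K + 1},
      n * (N (toReal x) - 1) ≤ envCost lam u (n • x) ⊤ :=
    (finite_norm_le _).eventually_all.2 fun x _ => hv x 1 one_pos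
  have hn : Tendsto (fun y : Site d => ⌊‖y‖ / K⌋₊) cofinite atTop :=
    tendsto_nat_floor_atTop.comp (tendsto_norm_site.atTop_div_const hK0)
  filter_upwards [hn.eventually hdir, hn.eventually (eventually_gt_atTop 0)] with y hy hy0
  set n := ⌊‖y‖ / K⌋₊ with hndef
  have hn0 : (0 : ℝ) < n := by exact_mod_cast hy0
  have hn1 : n * K ≤ ‖y‖ := by
    have := Nat.floor_le (div_nonneg (norm_nonneg y) hK0.le)
    rwa [le_div_iff₀ hK0] at this
  have hn2 : ‖y‖ ≤ 2 * K * n := by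
    have h1 := (Nat.lt_floor_add_one (‖y‖ / K)).le
    rw [div_le_iff₀ hK0, ← hndef] at h1
    have h2 : (1 : ℝ) ≤ n := by exact_mod_cast hy0
    nlinarith
  -- the lattice direction `x` is the integer part of `y / n`
  let x : Site d := fun i => y i / (n : ℤ)
  have hxy : ‖n • x - y‖ ≤ n := by
    rw [pi_norm_le_iff_of_nonneg hn0.le]
    intro i
    have hnZ : (0 : ℤ) < n := by exact_mod_cast hy0
    have h1 := Int.emod_add_mul_ediv (y i) n
    have h2 := Int.emod_nonneg (y i) hnZ.ne'
    have h3 := Int.emod_lt_of_pos (y i) hnZ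
    have h4 : (n • x - y) i = -(y i % n) := by
      rw [Pi.sub_apply, Pi.smul_apply, nsmul_eq_mul]
      simp only [x]
      linarith
    rw [h4, Int.norm_eq_abs, ← Int.cast_abs, abs_neg, abs_of_nonneg h2]
    exact_mod_cast h3.le
  have hnx : ‖n • x‖ = n * ‖x‖ := by
    rw [← norm_toReal, toReal_nsmul, ← Nat.cast_smul_eq_nsmul ℝ, norm_smul, norm_toReal,
      Real.norm_natCast]
  have hx : ‖x‖ ≤ 2 * K + 1 := by
    have h1 : ‖n • x‖ ≤ ‖y‖ + n := by
      have := norm_add_le (n • x - y) y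
      rw [sub_add_cancel] at this
      linarith
    rw [hnx] at h1
    nlinarith
  have h1 := hy x hx
  have h2 := hLip y (n • x)
  have h3 : N (toReal y) ≤ n * N (toReal x) + C' * n := by
    rw [← h.lyapunov_nsmul, ← toReal_nsmul]
    refine h.lyapunov_le_add_of_near ?_
    rwa [← toReal_sub, norm_toReal, norm_sub_rev]
  have h4 : C * ‖n • x - y‖ ≤ C * n := by gcongr
  have h5 : (C + C' + 1) * n ≤ ε * ‖y‖ := by
    calc (C + C' + 1) * n ≤ K * ε * n := by gcongr
      _ = ε * (n * K) := by ring
      _ ≤ _ := by gcongr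
  linarith

lemma lyapunov_le_mul {g g' : Site d → ℝ} {c C c' C' a : ℝ} (h : IsSubadditiveCost g c C)
    (h' : IsSubadditiveCost g' c' C') (hle : ∀ x, g x ≤ a * g' x) (x : Fin d → ℝ) :
    lyapunov g x ≤ a * lyapunov g' x := by
  refine le_of_tendsto_of_tendsto' (h.tendsto_lyapunov x) ((h'.tendsto_lyapunov x).const_mul a)
    fun n => ?_
  rw [← mul_div_assoc]
  gcongr
  exact hle _

/-- Almost surely, the costs of all but finitely many points are at least as large as the Lyapunov
norm predicts. Truncation of the potential reduces this to bounded environments. -/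
theorem eventually_le_envCost (hν : Integrable (fun t : ℝ≥0 => (t : ℝ)) ν)
    (hpos : ν (Set.Ioi 0) ≠ 0) (hlam : 0 ≤ lam) :
    ∀ᵐ v ∂envMeasure d ν, ∀ ε > 0, ∀ᶠ y : Site d in cofinite,
      (1 - ε) * lyapunov (meanCost lam ν) (toReal y) ≤ envCost lam v y ⊤ := by
  obtain ⟨c, hc⟩ := isSubadditiveCost_meanCost (d := d) hν hpos
  have h := hc lam hlam
  have hc0 := h.pos
  choose M hM hMle using fun j : ℕ => exists_meanCost_le_truncLaw (d := d) hν hpos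
    (Nat.one_div_pos_of_nat (n := j) (α := ℝ))
  filter_upwards [ae_all_iff.2 fun j : ℕ => eventually_le_envCost_truncEnv hpos hlam (hM j)]
    with v hv ε hε
  obtain ⟨j, hj⟩ := exists_nat_one_div_lt (K := ℝ) (half_pos hε)
  filter_upwards [hv j (c * (ε / 2)) (by positivity)] with y hy
  obtain ⟨c', hc'⟩ := isSubadditiveCost_meanCost (d := d) (integrable_truncLaw (M j) ν)
    (by rw [truncLaw_Ioi (hM j)]; exact hpos)
  have h' := hc' lam hlam
  have h1 := lyapunov_le_mul h h' (hMle j lam hlam) (toReal y)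
  have h2 := envCost_mono hlam (truncEnv_le (M j) v) y
  have h3 := h.le_lyapunov (toReal y)
  rw [norm_toReal] at h3
  set N := lyapunov (meanCost lam ν) (toReal y)
  set N' := lyapunov (meanCost lam (truncLaw (M j) ν)) (toReal y)
  set η := 1 / ((j : ℝ) + 1) with hη
  have hη0 : 0 < η := Nat.one_div_pos_of_nat
  have hN0 : 0 ≤ N := h.lyapunov_nonneg _
  have h4 : (1 - η) * N ≤ N' := by
    rcases le_total 1 η with h5 | h5
    · exact (mul_nonpos_of_nonpos_of_nonneg (by linarith) hN0).trans (h'.lyapunov_nonneg _)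
    · have h6 := mul_le_mul_of_nonneg_left h1 (by linarith : 0 ≤ 1 - η)
      have h7 : 0 ≤ N' := h'.lyapunov_nonneg _
      have h8 : (1 - η) * ((1 + η) * N') = N' - η ^ 2 * N' := by ring
      have h9 := mul_nonneg (sq_nonneg η) h7
      linarith
  have h5 : c * (ε / 2) * ‖y‖ ≤ ε / 2 * N := by
    calc c * (ε / 2) * ‖y‖ = ε / 2 * (c * ‖y‖) := by ring
      _ ≤ _ := by gcongr
  nlinarith

end LowerBound

/-! ### All values of `λ` simultaneously -/

section AllLambda

variable {d : ℕ} [NeZero d] {ν : Measure ℝ≥0} [IsProbabilityMeasure ν]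

/-- The Lyapunov norm divided by `λ` decreases in `λ`, as do the costs. -/
lemma lyapunov_meanCost_le (hν : Integrable (fun t : ℝ≥0 => (t : ℝ)) ν)
    (hpos : ν (Set.Ioi 0) ≠ 0) {lam lam' : ℝ} (hlam : 0 < lam) (hlt : lam < lam')
    (x : Fin d → ℝ) :
    lyapunov (meanCost lam' ν) x ≤ lam' / lam * lyapunov (meanCost lam ν) x := by
  obtain ⟨c, hc⟩ := isSubadditiveCost_meanCost (d := d) hν hpos
  have hlam' := hlam.trans hlt
  refine lyapunov_le_mul (hc lam' hlam'.le) (hc lam hlam.le) (fun z => ?_) x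
  have ht0 : 0 < lam / lam' := div_pos hlam hlam'
  have ht : lam / lam' * lam' = lam := div_mul_cancel₀ _ hlam'.ne'
  have h1 : lam / lam' * meanCost lam' ν z ≤ meanCost lam ν z := by
    rw [meanCost, ← integral_const_mul]
    refine integral_mono ((integrable_envCost hν hlam'.le z).const_mul _)
      (integrable_envCost hν hlam.le z) fun v => ?_
    have h2 := mul_hitCost_le (T := ⊤) (x := z) ht0 ((div_lt_one hlam').2 hlt) hlam'.le
      (isPathPotential_env v) (reachable_top z lam' v hlam'.le)
      (by rw [ht]; exact reachable_top z lam v hlam.le)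
    rwa [ht] at h2
  calc meanCost lam' ν z = lam' / lam * (lam / lam' * meanCost lam' ν z) := by
        field_simp
    _ ≤ _ := by gcongr

/-- The almost sure bounds on costs hold for all `λ` simultaneously: for rational `λ` the
exceptional sets can be united, and for `λ > 0` both costs and Lyapunov norms increase in `λ`, but
at most proportionally to `λ`. -/
theorem ae_forall_envCost_bounds (hν : Integrable (fun t : ℝ≥0 => (t : ℝ)) ν)
    (hpos : ν (Set.Ioi 0) ≠ 0) :
    ∀ᵐ v ∂envMeasure d ν, ∀ lam : ℝ, 0 ≤ lam →
      (∀ x : Site d, ∀ ε > 0, ∃ k : ℕ, 0 < k ∧ ∀ᶠ q : ℕ in atTop,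
        envCost lam v (q • k • x) ⊤ ≤ q * (k * (lyapunov (meanCost lam ν) (toReal x) + ε))) ∧
      ∀ ε > 0, ∀ᶠ y : Site d in cofinite,
        (1 - ε) * lyapunov (meanCost lam ν) (toReal y) ≤ envCost lam v y ⊤ := by
  obtain ⟨c, hc⟩ := isSubadditiveCost_meanCost (d := d) hν hpos
  have hq0 : ∀ r : ℚ≥0, (0 : ℝ) ≤ (r : ℝ) := fun r => by positivity
  have hA : ∀ᵐ v ∂envMeasure d ν, ∀ r : ℚ≥0, ∀ x : Site d, ∀ j : ℕ, ∃ k : ℕ, 0 < k ∧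
      ∀ᶠ q : ℕ in atTop, envCost (r : ℝ) v (q • k • x) ⊤ ≤
        q * (k * (lyapunov (meanCost (r : ℝ) ν) (toReal x) + 1 / ((j : ℝ) + 1))) := by
    refine ae_all_iff.2 fun r => ae_all_iff.2 fun x => ae_all_iff.2 fun j => ?_
    obtain ⟨k, hk, h⟩ := exists_eventually_envCost_le (d := d) hν hpos (hq0 r) x
      (Nat.one_div_pos_of_nat (n := j) (α := ℝ))
    filter_upwards [h] with v hv
    exact ⟨k, hk, hv⟩
  have hB : ∀ᵐ v ∂envMeasure d ν, ∀ r : ℚ≥0, ∀ ε > 0, ∀ᶠ y : Site d in cofinite,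
      (1 - ε) * lyapunov (meanCost (r : ℝ) ν) (toReal y) ≤ envCost (r : ℝ) v y ⊤ :=
    ae_all_iff.2 fun r => eventually_le_envCost hν hpos (hq0 r)
  filter_upwards [hA, hB] with v hv hv' lam hlam
  -- costs are monotone in `λ`
  have hmono : ∀ {s t : ℝ}, 0 ≤ s → s ≤ t → ∀ y, envCost s v y ⊤ ≤ envCost t v y ⊤ :=
    fun hs hst y => hitCost_mono hs hst (isPathPotential_env v) (isPathPotential_env v)
      (fun _ _ => le_rfl) (reachable_top y _ v (hs.trans hst))
  have hrat : ∀ s t : ℝ, 0 ≤ s → s < t → ∃ r : ℚ≥0, s < r ∧ (r : ℝ) < t := by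
    intro s t hs hst
    obtain ⟨r, h1, h2⟩ := exists_rat_btwn hst
    have h3 : (0 : ℚ) ≤ r := by exact_mod_cast hs.trans h1.le
    lift r to ℚ≥0 using h3
    exact ⟨r, by exact_mod_cast h1, by exact_mod_cast h2⟩
  have hN : ∀ x, 0 ≤ lyapunov (meanCost lam ν) x := fun x => (hc lam hlam).lyapunov_nonneg x
  constructor
  · intro x ε hε
    set N := lyapunov (meanCost lam ν) (toReal x) with hNdef
    have hNx : 0 ≤ N := hN _
    obtain ⟨r, hr, hle⟩ : ∃ r : ℚ≥0, lam ≤ r ∧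
        lyapunov (meanCost (r : ℝ) ν) (toReal x) ≤ N + ε / 2 := by
      rcases hlam.eq_or_lt with h0 | h0
      · refine ⟨0, by simp [h0], ?_⟩
        rw [NNRat.cast_zero, h0]
        linarith
      · obtain ⟨r, h1, h2⟩ := hrat lam (lam * (1 + ε / (2 * (N + 1)))) hlam
          (lt_mul_of_one_lt_right h0 (lt_add_of_pos_right _ (by positivity)))
        refine ⟨r, h1.le, (lyapunov_meanCost_le hν hpos h0 h1 _).trans ?_⟩
        have h3 : (r : ℝ) / lam ≤ 1 + ε / (2 * (N + 1)) := by
          rw [div_le_iff₀ h0, mul_comm]; exact h2.le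
        calc (r : ℝ) / lam * N ≤ (1 + ε / (2 * (N + 1))) * N := by gcongr
          _ = N + ε / 2 * (N / (N + 1)) := by field_simp
          _ ≤ N + ε / 2 * 1 := by
              gcongr; exact (div_le_one (by linarith)).2 (by linarith)
          _ = _ := by ring
    obtain ⟨j, hj⟩ := exists_nat_one_div_lt (K := ℝ) (half_pos hε)
    obtain ⟨k, hk, h⟩ := hv r x j
    refine ⟨k, hk, ?_⟩
    filter_upwards [h] with q hq
    refine (hmono hlam hr _).trans (hq.trans ?_)
    exact mul_le_mul_of_nonneg_left (mul_le_mul_of_nonneg_left (by linarith)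
      (Nat.cast_nonneg _)) (Nat.cast_nonneg _)
  · intro ε hε
    rcases le_or_gt 1 ε with h1 | h1
    · refine Eventually.of_forall fun y => ?_
      exact (mul_nonpos_of_nonpos_of_nonneg (by linarith) (hN _)).trans
        (envCost_nonneg hlam v y ⊤)
    · obtain ⟨r, hr, hle⟩ : ∃ r : ℚ≥0, (r : ℝ) ≤ lam ∧ ∀ y : Site d,
          (1 - ε / 2) * lyapunov (meanCost lam ν) (toReal y) ≤
            lyapunov (meanCost (r : ℝ) ν) (toReal y) := by
        rcases hlam.eq_or_lt with h0 | h0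
        · refine ⟨0, by simp [h0], fun y => ?_⟩
          rw [NNRat.cast_zero, h0]
          have := mul_nonneg hε.le (hN (toReal y))
          linarith
        · obtain ⟨r, h2, h3⟩ := hrat ((1 - ε / 2) * lam) lam
            (mul_nonneg (by linarith) hlam) (mul_lt_of_lt_one_left h0 (by linarith))
          have hr0 : (0 : ℝ) < r := (mul_pos (by linarith) h0).trans h2
          refine ⟨r, h3.le, fun y => ?_⟩
          have h4 := lyapunov_meanCost_le (d := d) hν hpos hr0 h3 (toReal y)
          have h5 : 0 ≤ lyapunov (meanCost (r : ℝ) ν) (toReal y) :=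
            (hc r hr0.le).lyapunov_nonneg _
          calc (1 - ε / 2) * lyapunov (meanCost lam ν) (toReal y)
              ≤ (1 - ε / 2) * (lam / r * lyapunov (meanCost (r : ℝ) ν) (toReal y)) := by
                refine mul_le_mul_of_nonneg_left h4 (by linarith)
            _ = (1 - ε / 2) * lam / r * lyapunov (meanCost (r : ℝ) ν) (toReal y) := by ring
            _ ≤ 1 * lyapunov (meanCost (r : ℝ) ν) (toReal y) := by
                gcongr; exact (div_le_one hr0).2 h2.le
            _ = _ := one_mul _
      filter_upwards [hv' r (ε / 2) (by positivity)] with y hy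
      refine le_trans ?_ (hy.trans (hmono (hq0 r) hr y))
      have h2 := mul_le_mul_of_nonneg_left (hle y) (by linarith : 0 ≤ 1 - ε / 2)
      have h3 := mul_nonneg (sq_nonneg (ε / 2)) (hN (toReal y))
      linarith

end AllLambda

/-! ### The quenched limit -/

section Quenched

variable {d : ℕ} {Ω : Type*} [MeasurableSpace Ω] {μ : Measure Ω} {V : Site d → Ω → ℝ}

/-- The random potential as a random environment; its negative values, which have probability
zero, are replaced by `0`. -/
def randomEnv (V : Site d → Ω → ℝ) (ω : Ω) : Env d :=
  fun z => (V z ω).toNNReal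

/-- The law of a single value of the potential. -/
def siteLaw (μ : Measure Ω) (V : Site d → Ω → ℝ) : Measure ℝ≥0 :=
  μ.map fun ω => (V 0 ω).toNNReal

namespace IsQuenchedPotential

lemma ae_nonneg (h : IsQuenchedPotential μ V) : ∀ᵐ ω ∂μ, ∀ z, 0 ≤ V z ω := by
  refine ae_all_iff.2 fun z => ?_
  have h1 := ae_essInf_le (μ := μ) (f := fun ω => (V z ω : EReal))
  rw [h.essInf_eq_zero z] at h1
  filter_upwards [h1] with ω hω
  exact_mod_cast hω

lemma ae_coe_randomEnv (h : IsQuenchedPotential μ V) :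
    ∀ᵐ ω ∂μ, (fun z => V z ω) = fun z => (randomEnv V ω z : ℝ) := by
  filter_upwards [h.ae_nonneg] with ω hω
  ext1 z
  exact (Real.coe_toNNReal _ (hω z)).symm

lemma measurable_randomEnv (h : IsQuenchedPotential μ V) : Measurable (randomEnv V) :=
  measurable_pi_lambda _ fun z => (h.measurable z).real_toNNReal

lemma map_randomEnv (h : IsQuenchedPotential μ V) :
    μ.map (randomEnv V) = envMeasure d (siteLaw μ V) := by
  have h1 : iIndepFun (fun z ω => (V z ω).toNNReal) μ :=
    h.indep.comp (fun _ t => t.toNNReal) fun _ => measurable_real_toNNReal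
  have h2 := h1.map_fun_eq_infinitePi_map fun z => (h.measurable z).real_toNNReal
  have h3 : ∀ z, μ.map (fun ω => (V z ω).toNNReal) = siteLaw μ V := fun z =>
    ((h.identDistrib z 0).comp measurable_real_toNNReal).map_eq
  unfold randomEnv envMeasure
  rw [h2]
  congr 1
  exact funext h3

lemma siteLaw_Ioi (h : IsQuenchedPotential μ V) : siteLaw μ V (Set.Ioi 0) ≠ 0 := by
  intro h0
  rw [siteLaw, Measure.map_apply (h.measurable 0).real_toNNReal measurableSet_Ioi] at h0
  refine h.nontrivial 0 0 ?_
  filter_upwards [h.ae_nonneg, measure_eq_zero_iff_ae_notMem.1 h0] with ω hω hω'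
  simp only [Set.mem_preimage, Set.mem_Ioi, Real.toNNReal_pos, not_lt] at hω'
  exact le_antisymm hω' (hω 0)

lemma isProbabilityMeasure_siteLaw [IsProbabilityMeasure μ] (h : IsQuenchedPotential μ V) :
    IsProbabilityMeasure (siteLaw μ V) :=
  Measure.isProbabilityMeasure_map (h.measurable 0).real_toNNReal.aemeasurable

variable [NeZero d]

lemma quenchedLyapunov_eq (h : IsQuenchedPotential μ V) (lam : ℝ) :
    quenchedLyapunov μ V lam = lyapunov (meanCost lam (siteLaw μ V)) := by
  have h1 : ∀ x : Site d,
      ∫ ω, quenchedTwoPoint lam (fun z => V z ω) x ∂μ = meanCost lam (siteLaw μ V) x := by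
    intro x
    rw [meanCost, ← h.map_randomEnv, integral_map h.measurable_randomEnv.aemeasurable
      (measurable_envCost lam x ⊤).aestronglyMeasurable]
    refine integral_congr_ae ?_
    filter_upwards [h.ae_coe_randomEnv] with ω hω
    rw [hω, quenchedTwoPoint, envCost, hitCost, ← hittingWeight_eq (isPathPotential_env _)]
    rfl
  ext x
  simp only [quenchedLyapunov, lyapunov, h1]

variable [IsProbabilityMeasure μ]

lemma integrable_siteLaw (h : IsQuenchedPotential μ V) :
    Integrable (fun t : ℝ≥0 => (t : ℝ)) (siteLaw μ V) := by
  have hd : (1 : ℝ≥0∞) ≤ ((d : ℝ≥0) : ℝ≥0∞) := by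
    exact_mod_cast Nat.one_le_iff_ne_zero.2 (NeZero.ne d)
  have h1 : Integrable (V 0) μ := (h.memLp 0).integrable (by simpa using hd)
  refine (integrable_map_measure measurable_coe_nnreal_real.aestronglyMeasurable
    (h.measurable 0).real_toNNReal.aemeasurable).2 (h1.congr ?_)
  filter_upwards [h.ae_nonneg] with ω hω
  exact (Real.coe_toNNReal _ (hω 0)).symm

/-- The quenched limit: the environment pulled back from its law `envMeasure d (siteLaw μ V)`
satisfies the almost sure bounds on costs. -/
theorem ae_tendsto_log_halfSpace (h : IsQuenchedPotential μ V) :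
    ∀ᵐ ω ∂μ, ∀ lam : ℝ, 0 ≤ lam → ∀ l : Fin d → ℝ, l ≠ 0 →
      Tendsto (fun u : ℝ => 1 / u * Real.log (hittingWeight lam
          (quenchedPathPotential fun x => V x ω) (halfSpace l u))) atTop
        (𝓝 (-(1 / dualNorm (quenchedLyapunov μ V lam) l))) := by
  have := h.isProbabilityMeasure_siteLaw
  obtain ⟨c, hc⟩ := isSubadditiveCost_meanCost (d := d) h.integrable_siteLaw h.siteLaw_Ioi
  have h1 := ae_forall_envCost_bounds (d := d) h.integrable_siteLaw h.siteLaw_Ioi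
  rw [← h.map_randomEnv] at h1
  filter_upwards [h.ae_coe_randomEnv, ae_of_ae_map h.measurable_randomEnv.aemeasurable h1]
    with ω hω hω' lam hlam l hl
  have hr := fun y => reachable_top y lam (randomEnv V ω) hlam
  have hp := isPathPotential_env (randomEnv V ω)
  rw [h.quenchedLyapunov_eq, hω]
  exact tendsto_log_halfSpace (hc lam hlam) hl
    (fun u y hy => exp_neg_hitCost_le hlam hp hr hy)
    (fun u => ofReal_hittingWeight_le hlam hp hr _) (hω' lam hlam).1 (hω' lam hlam).2

end IsQuenchedPotential

end Quenched

end RandomPotential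

end

theorem corollary1 (d : ℕ) [NeZero d] :
    (∀ {Ω : Type*} [MeasurableSpace Ω] (μ : Measure Ω) [IsProbabilityMeasure μ]
      (V : RandomPotential.Site d → Ω → ℝ), RandomPotential.IsQuenchedPotential μ V →
      ∀ᵐ ω ∂μ, ∀ lam : ℝ, 0 ≤ lam → ∀ l : Fin d → ℝ, l ≠ 0 →
        Tendsto
          (fun u : ℝ => 1 / u * Real.log
            (RandomPotential.hittingWeight lam
              (RandomPotential.quenchedPathPotential fun x => V x ω)
              (RandomPotential.halfSpace l u)))
          atTop
          (𝓝 (-(1 / RandomPotential.dualNorm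
            (RandomPotential.quenchedLyapunov μ V lam) l)))) ∧
    (∀ φ : ℝ → ℝ, RandomPotential.IsAnnealedPotential φ →
      ∀ lam : ℝ, 0 ≤ lam → ∀ l : Fin d → ℝ, l ≠ 0 →
        Tendsto
          (fun u : ℝ => 1 / u * Real.log
            (RandomPotential.hittingWeight lam
              (RandomPotential.annealedPathPotential φ)
              (RandomPotential.halfSpace l u)))
          atTop
          (𝓝 (-(1 / RandomPotential.dualNorm
            (RandomPotential.annealedLyapunov φ lam) l)))) :=   ⟨fun _ _ _ h => h.ae_tendsto_log_halfSpace,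
    fun _ hφ _ hlam _ hl => RandomPotential.tendsto_annealed hφ hlam hl⟩
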